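/- **Theorem 5.1 (convergence rate).** *Setting.* Let $T>0$, let $K_1,K_2\in C_b^2(\mathbb R^d;\mathbb R^d)$ (bounded, with bounded derivatives up to order two), and for a probability measure $\mu$ on $\mathbb R^d$ and $u=(u^1,\dots,u^M)\in\mathbb R^{dM}$ put $$v(\mu,u)(x)=-\int K_1(x-y)\,d\mu(y)-\sum_{\ell=1}^M K_2(x-u^\ell).$$ Let $J_1(\mu)=j(\langle g_1,\mu\rangle,\dots,\langle g_m,\mu\rangle)$ with $\langle g_l,\mu\rangle=\int g_l\,d\mu$, $j\in C^2(\mathbb R^m)$, $g_l\in C^1(\mathbb R^d)$ and $|\nabla g_l(x)|\le C_g(1+|x|)$ for all $l$ and $x$. For $\lambda>0$ let $$J(\mu,u)=\int_0^T J_1(\mu_t)\,dt+\frac\lambda2\Big\|\frac{du}{dt}\Big\|^2_{L^2((0,T),\mathbb R^{dM})}.$$ Let $\mathcal U_{ad}=\{u\in H^1((0,T),\mathbb R^{dM}):u_0=\hat u\}$ with $\hat u\in\mathbb R^{dM}$ given. Let $\mathcal P_2(\mathbb R^d)$ be the space of probability measures with finite second moment, with the 2-Wasserstein distance $W_2$,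 and for $x\in(\mathbb R^d)^N$ let $\mu^N_x=\frac1N\sum_{i=1}^N\delta_{x^i}$. * Mean-field problem: minimize $J(\mu,u)$ over all $u\in\mathcal U_{ad}$ and $\mu\in C([0,T],\mathcal P_2(\mathbb R^d))$ such that $\mu$ is a weak solution of $\partial_t\mu_t+\nabla\cdot(v(\mu_t,u_t)\mu_t)=0$, $\mu_0=\hat\mu$, that is, $$\int_0^T\!\!\int\big(\partial_t h_t+v(\mu_t,u_t)\cdot\nabla h_t\big)\,d\mu_t\,dt+\int h_0\,d\hat\mu=0\quad\text{for all }h\in C_0^\infty([0,T)\times\mathbb R^d).$$ * $N$-particle problem ($N\ge1$): minimize $J(\mu^N_{x},u)$ over all $u\in\mathcal U_{ad}$ and $x:[0,T]\to(\mathbb R^d)^N$ with $\frac{d}{dt}x^i_t=v(\mu^N_{x_t},u_t)(x^i_t)$ for $i=1,\dots,N$, and $x_0=\hat x^N$. An *optimal pair* is a global minimizer. An *adjoint velocity* of a pair $(\mu,u)$ is a continuous $\xi:[0,T]\times\mathbb R^d\to\mathbb R^d$ that solves $\partial_t\xi_t+D\xi_t\,v(\mu_t,u_t)=\Psi(\mu_t,u_t)[\xi_t]$,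 $\xi_T=0$, along characteristics: for all $t\in[0,T]$ and $x\in\mathbb R^d$, $$\xi_t(x)=-\int_t^T\Psi(\mu_s,u_s)[\xi_s](Q_s(x,t))\,ds,$$ where $\frac{d}{ds}Q_s(x,t)=v(\mu_s,u_s)(Q_s(x,t))$, $Q_t(x,t)=x$, and $$\Psi(\mu,u)[\xi](x)=-\nabla v(\mu,u)(x)\,\xi(x)-\int\nabla K_1(y-x)\,\xi(y)\,d\mu(y)+\sum_{l=1}^m\partial_l j(\langle g_1,\mu\rangle,\dots,\langle g_m,\mu\rangle)\,\nabla g_l(x);$$ here $\nabla$ of a vector field denotes the transposed Jacobian. *Claim.* For all $R$ and $\Lambda\ge0$ there is a constant $\gamma>0$, depending only on $d$, $M$, $T$, $K_1$, $K_2$, $J_1$ (that is, $j$ and the $g_l$), $R$ and $\Lambda$, such that the following holds for every $\lambda>\gamma$, every $N\ge1$, every $\hat u\in\mathbb R^{dM}$, every $\hat x^N\in(\mathbb R^d)^N$ and every compactly supported probability measure $\hat\mu$ on $\mathbb R^d$ with $\int|x|^2\,d\hat\mu\le R$ and $\frac1N\sum_{i=1}^N|\hat x^{N,i}|^2\le R$.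 If $(\bar x^N,\bar u^N)$ and $(\bar\mu,\bar u)$ are optimal pairs of the $N$-particle problem with initial datum $\hat x^N$ and of the mean-field problem with initial datum $\hat\mu$, and if $(\bar\mu,\bar u)$ has an adjoint velocity $\bar\xi$ that is bounded on $[0,T]\times\mathbb R^d$ and such that each $\bar\xi_t$, $t\in[0,T]$, is Lipschitz with constant $\Lambda$, then $$\|\bar u^N-\bar u\|^2_{L^2((0,T),\mathbb R^{dM})}\le\frac{\gamma}{\lambda-\gamma}\,W_2^2\big(\mu^N_{\hat x^N},\hat\mu\big).$$ -/

import Mathlib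

open Set Filter Topology MeasureTheory
open scoped ENNReal NNReal ContDiff

noncomputable section

namespace MeanFieldControl

/-- The state space `ℝ^d` of a single particle, with its Euclidean norm. -/
abbrev Space (d : ℕ) := EuclideanSpace ℝ (Fin d)

/-- The space `ℝ^{dM}` of the values of the `M` controls, with its Euclidean norm. -/
abbrev ControlSpace (d M : ℕ) := PiLp 2 (fun _ : Fin M => Space d)

/-! ### Probability measures with finite second moment -/

/-- Membership in the space `P_2(ℝ^d)`. -/
structure IsP2 {d : ℕ} (μ : Measure (Space d)) : Prop where
  prob : IsProbabilityMeasure μ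
  memLp : MemLp (fun x : Space d => x) 2 μ

/-- The second moment of a measure (used for members of `P_2(ℝ^d)` only). -/
def secondMoment {d : ℕ} (μ : Measure (Space d)) : ℝ := ∫ x, ‖x‖ ^ 2 ∂μ

/-- The set of couplings of `μ` and `ν`. -/
def couplings {d : ℕ} (μ ν : Measure (Space d)) : Set (Measure (Space d × Space d)) :=
  {π | π.map Prod.fst = μ ∧ π.map Prod.snd = ν}

/-- The squared 2-Wasserstein distance, with values in `[0, ∞]`. It is finite on `P_2(ℝ^d)`. -/
def W2sq {d : ℕ} (μ ν : Measure (Space d)) : ℝ≥0∞ :=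
  ⨅ π ∈ couplings μ ν, ∫⁻ z, ‖z.1 - z.2‖ₑ ^ 2 ∂π

/-- The curve `t ↦ μ_t` belongs to `C([0,T], P_2(ℝ^d))`, where `P_2(ℝ^d)` carries the
2-Wasserstein distance. -/
structure IsP2Curve {d : ℕ} (T : ℝ) (μ : ℝ → Measure (Space d)) : Prop where
  isP2 : ∀ t ∈ Icc 0 T, IsP2 (μ t)
  continuous : ∀ t ∈ Icc 0 T, Tendsto (fun s => W2sq (μ s) (μ t)) (𝓝[Icc 0 T] t) (𝓝 0)

/-- The empirical measure `(1/N) ∑ᵢ δ_{xᵢ}`. -/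
def empirical {d N : ℕ} (x : Fin N → Space d) : Measure (Space d) :=
  (N : ℝ≥0∞)⁻¹ • ∑ i, Measure.dirac (x i)

/-! ### The velocity field and the two state systems -/

/-- The class `C_b^2(ℝ^d, ℝ^d)`. -/
def IsCb2 {d : ℕ} (K : Space d → Space d) : Prop :=
  ContDiff ℝ 2 K ∧ ∀ i ≤ 2, ∃ C : ℝ, ∀ x, ‖iteratedFDeriv ℝ i K x‖ ≤ C

/-- `v(μ,u)(x) = -(K₁ ∗ μ)(x) - ∑_ℓ K₂(x - u^ℓ)`. -/
def velocity {d M : ℕ} (K₁ K₂ : Space d → Space d) (μ : Measure (Space d))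
    (u : ControlSpace d M) (x : Space d) : Space d :=
  -(∫ y, K₁ (x - y) ∂μ) - ∑ l, K₂ (x - u l)

/-- The particle system `d/dt x^i = v(μ^N_x, u)(x^i)` on `[0,T]` with initial state `x₀`. -/
structure IsParticleSolution {d M N : ℕ} (T : ℝ) (K₁ K₂ : Space d → Space d)
    (x₀ : Fin N → Space d) (u : ℝ → ControlSpace d M) (x : ℝ → Fin N → Space d) : Prop where
  init : x 0 = x₀
  ode : ∀ t ∈ Icc 0 T, ∀ i, HasDerivWithinAt (fun s => x s i)
    (velocity K₁ K₂ (empirical (x t)) (u t) (x t i)) (Icc 0 T) t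

/-- Test functions in `C_0^∞([0,T) × ℝ^d)`: restrictions of smooth compactly supported functions
on space-time whose support lies in `{t < T}`. They need not vanish at time `0`. -/
structure IsTestFunction {d : ℕ} (T : ℝ) (φ : ℝ × Space d → ℝ) : Prop where
  smooth : ContDiff ℝ ∞ φ
  compact : HasCompactSupport φ
  support : tsupport φ ⊆ Iio T ×ˢ univ

/-- Weak measure solutions `μ ∈ C([0,T], P_2(ℝ^d))` of
`∂_t μ + ∇·(v(μ,u) μ) = 0`, `μ|_{t=0} = μ₀`. Here `fderiv ℝ φ (t, x) (1, w)` is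
`∂_t φ(t,x) + w · ∇φ(t,x)`. -/
structure IsWeakSolution {d M : ℕ} (T : ℝ) (K₁ K₂ : Space d → Space d)
    (μ₀ : Measure (Space d)) (u : ℝ → ControlSpace d M) (μ : ℝ → Measure (Space d)) : Prop where
  curve : IsP2Curve T μ
  weak : ∀ φ : ℝ × Space d → ℝ, IsTestFunction T φ →
    (∫ t in (0 : ℝ)..T, ∫ x, fderiv ℝ φ (t, x) (1, velocity K₁ K₂ (μ t) (u t) x) ∂(μ t))
      + ∫ x, φ (0, x) ∂μ₀ = 0

/-! ### Controls and costs -/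

/-- Admissible controls: `H^1((0,T), ℝ^{dM})` functions `u` with `u_0 = u₀`. In one dimension an
`H^1` function is represented by a continuous function that is the integral of its weak derivative
`du ∈ L^2((0,T), ℝ^{dM})`; the latter is determined by `u` up to null sets. -/
structure Control (d M : ℕ) (T : ℝ) (u₀ : ControlSpace d M) where
  u : ℝ → ControlSpace d M
  du : ℝ → ControlSpace d M
  memLp : MemLp du 2 (volume.restrict (Ioc 0 T))
  eq_integral : ∀ t ∈ Icc 0 T, u t = u₀ + ∫ s in (0 : ℝ)..t, du s

/-- The vector `(⟨g₁,μ⟩, …, ⟨g_m,μ⟩)`. -/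
def moments {d m : ℕ} (g : Fin m → Space d → ℝ) (μ : Measure (Space d)) : Fin m → ℝ :=
  fun l => ∫ x, g l x ∂μ

/-- The cylindrical cost `J₁(μ) = j(⟨g₁,μ⟩, …, ⟨g_m,μ⟩)`. -/
def J₁ {d m : ℕ} (j : (Fin m → ℝ) → ℝ) (g : Fin m → Space d → ℝ) (μ : Measure (Space d)) : ℝ :=
  j (moments g μ)

/-- The control cost `J₂(u) = (λ/2) ‖u'‖²_{L²(0,T)}`. -/
def J₂ {d M : ℕ} {T : ℝ} {u₀ : ControlSpace d M} (lam : ℝ) (c : Control d M T u₀) : ℝ :=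
  lam / 2 * ∫ t in (0 : ℝ)..T, ‖c.du t‖ ^ 2

/-- The total cost `J(μ,u) = ∫_0^T J₁(μ_t) dt + J₂(u)`. -/
def totalCost {d M m : ℕ} {T : ℝ} {u₀ : ControlSpace d M} (lam : ℝ) (j : (Fin m → ℝ) → ℝ)
    (g : Fin m → Space d → ℝ) (μ : ℝ → Measure (Space d)) (c : Control d M T u₀) : ℝ :=
  (∫ t in (0 : ℝ)..T, J₁ j g (μ t)) + J₂ lam c

/-- `(μ, c)` is an optimal pair of the mean-field problem with initial datum `μ₀`. -/
structure IsMeanFieldOptimal {d M m : ℕ} {T : ℝ} {u₀ : ControlSpace d M} (lam : ℝ)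
    (K₁ K₂ : Space d → Space d) (j : (Fin m → ℝ) → ℝ) (g : Fin m → Space d → ℝ)
    (μ₀ : Measure (Space d)) (μ : ℝ → Measure (Space d)) (c : Control d M T u₀) : Prop where
  admissible : IsWeakSolution T K₁ K₂ μ₀ c.u μ
  minimal : ∀ (ν : ℝ → Measure (Space d)) (c' : Control d M T u₀),
    IsWeakSolution T K₁ K₂ μ₀ c'.u ν → totalCost lam j g μ c ≤ totalCost lam j g ν c'

/-- `(x, c)` is an optimal pair of the `N`-particle problem with initial datum `x₀`; the cost is
`J_N(x,u) = ∫_0^T J₁(μ^N_{x_t}) dt + J₂(u)`. -/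
structure IsParticleOptimal {d M m N : ℕ} {T : ℝ} {u₀ : ControlSpace d M} (lam : ℝ)
    (K₁ K₂ : Space d → Space d) (j : (Fin m → ℝ) → ℝ) (g : Fin m → Space d → ℝ)
    (x₀ : Fin N → Space d) (x : ℝ → Fin N → Space d) (c : Control d M T u₀) : Prop where
  admissible : IsParticleSolution T K₁ K₂ x₀ c.u x
  minimal : ∀ (y : ℝ → Fin N → Space d) (c' : Control d M T u₀),
    IsParticleSolution T K₁ K₂ x₀ c'.u y →
      totalCost lam j g (fun t => empirical (x t)) c
        ≤ totalCost lam j g (fun t => empirical (y t)) c'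

/-! ### The mean-field adjoint velocity -/

/-- `δ_μ J₁(μ)(x) = ∑_l (∂_l j)(⟨g₁,μ⟩, …, ⟨g_m,μ⟩) ∇g_l(x)`. -/
def deltaJ₁ {d m : ℕ} (j : (Fin m → ℝ) → ℝ) (g : Fin m → Space d → ℝ) (μ : Measure (Space d))
    (x : Space d) : Space d :=
  ∑ l, (fderiv ℝ j (moments g μ) (Pi.single l 1)) • gradient (g l) x

/-- The right-hand side of the adjoint equation,
`Ψ(μ,u)[ξ](x) = -∇v(μ,u)(x) ξ(x) - ∫ ∇K₁(y - x) ξ(y) dμ(y) + δ_μ J₁(μ)(x)`,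
where `∇` is the transposed Jacobian. -/
def adjointRHS {d M m : ℕ} (K₁ K₂ : Space d → Space d) (j : (Fin m → ℝ) → ℝ)
    (g : Fin m → Space d → ℝ) (μ : Measure (Space d)) (u : ControlSpace d M)
    (ξ : Space d → Space d) (x : Space d) : Space d :=
  -(ContinuousLinearMap.adjoint (fderiv ℝ (velocity K₁ K₂ μ u) x) (ξ x))
    - (∫ y, ContinuousLinearMap.adjoint (fderiv ℝ K₁ (y - x)) (ξ y) ∂μ)
    + deltaJ₁ j g μ x

/-- `Q t s x` is the position at time `t` of the characteristic of the time-dependent field `w`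
that is at `x` at time `s`, for `s, t ∈ [0,T]`. -/
def IsFlow {d : ℕ} (T : ℝ) (w : ℝ → Space d → Space d) (Q : ℝ → ℝ → Space d → Space d) : Prop :=
  ∀ s ∈ Icc 0 T, ∀ x, Q s s x = x ∧
    ∀ t ∈ Icc 0 T, HasDerivWithinAt (fun r => Q r s x) (w t (Q t s x)) (Icc 0 T) t

/-- `ξ` is the adjoint velocity of the pair `(μ,u)`: the continuous solution of
`∂_t ξ + Dξ v(μ,u) = Ψ(μ,u)[ξ]`, `ξ_T = 0`, along the characteristics of `v(μ,u)`. -/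
structure IsAdjointVelocity {d M m : ℕ} (T : ℝ) (K₁ K₂ : Space d → Space d)
    (j : (Fin m → ℝ) → ℝ) (g : Fin m → Space d → ℝ) (μ : ℝ → Measure (Space d))
    (u : ℝ → ControlSpace d M) (ξ : ℝ → Space d → Space d) : Prop where
  continuousOn : ContinuousOn (fun p : ℝ × Space d => ξ p.1 p.2) (Icc 0 T ×ˢ univ)
  representation : ∃ Q, IsFlow T (fun t => velocity K₁ K₂ (μ t) (u t)) Q ∧
    ∀ t ∈ Icc 0 T, ∀ x,
      ξ t x = -∫ s in t..T, adjointRHS K₁ K₂ j g (μ s) (u s) (ξ s) (Q s t x)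

end MeanFieldControl

end

open MeanFieldControl

/-!
The two optimal pairs are compared with the states driven by the midpoint `ū = (u^N + u) / 2` of the
two optimal controls. Adding the two minimality inequalities, each tested with `ū`, and using the
parallelogram identity gives
`λ/4 ‖(u^N - u)'‖² ≤ ∫ J₁(X₁) - J₁(X₂) + J₁(X₃) - J₁(Y)`,
where `X₁`, `X₂` are the states of the particle system for `ū`, `u^N` and `X₃`, `Y` the mean-field
states for `ū`, `u`. Poincaré's inequality turns the left-hand side into a multiple of
`λ ‖u^N - u‖²`, so it remains to bound the right-hand side by
`C (‖u^N - u‖² + ∫ |x - y|² dπ)` for every coupling `π` of the initial data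
(`optimal_pair_estimate`), and then to minimize over `π`.

All four states are realized as random trajectories on the probability space `π`: each solves an
ordinary differential equation with the law of the trajectory as a parameter (`IsMcKean`). The
particle and mean-field flows exist by the Picard-Lindelöf theorem in a space of bounded continuous
functions (`exists_isMeanFieldFlow`). For the given weak solution this requires that a weak solution
of the continuity equation with its own Lipschitz velocity is transported by the characteristics
(`IsWeakSolution.eq_map`). The proof tests the equation with mollified functions that are constant
along the characteristics, since the velocity need not be smooth.

The cost is expanded to second order around `Y` (`abs_cost_sub_le`). The first-order part is
expressed through the adjoint velocity `ξ`. The point is that `-ξ_t` is the gradient of the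
potential `φ_t(x) = ∫_t^T H_s(Q_s(x,t)) ds`, where `∇H` collects the terms of `Ψ` that do not involve
the value of `ξ` at the point (`IsAdjointSystem.hasFDerivAt_potential`). Hence along an arbitrary
curve `q` the integral of `H_t(q) + ⟨ξ_t(q), q' - v(q)⟩` is `φ_0(q_0)`
(`IsAdjointSystem.integral_curve_eq`). Consequently the first-order terms cancel: `X₁`, `X₂` share
their initial states and so do `X₃`, `Y`, while the explicit dependence on the controls
cancels because `ū` is the midpoint (`integral_cost_comparison_le`). The second-order remainder is
estimated by the stability of the state equation (`IsMcKean.integral_norm_sub_sq_le`).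

The constant must not depend on the supremum of `ξ`, which enters only qualitatively: a backward
Grönwall argument gives a linear growth bound for `ξ` with a constant that depends on the data alone
(`IsMcKean.norm_adjoint_le`).
-/

namespace MeanFieldControl

/-! ### Bounds for the interaction kernels -/

/-- A differentiable kernel such that the constant `k` bounds it, its derivative, and the Lipschitz
constants of both. -/
structure KernelBound {d : ℕ} (k : ℝ) (K : Space d → Space d) : Prop where
  differentiable : Differentiable ℝ K
  norm_le : ∀ x, ‖K x‖ ≤ k
  lip : ∀ x y, ‖K x - K y‖ ≤ k * ‖x - y‖
  norm_fderiv_le : ∀ x, ‖fderiv ℝ K x‖ ≤ k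
  lip_fderiv : ∀ x y, ‖fderiv ℝ K x - fderiv ℝ K y‖ ≤ k * ‖x - y‖

theorem continuous_of_norm_sub_le {E F : Type*} [NormedAddCommGroup E] [NormedAddCommGroup F]
    {f : E → F} {c : ℝ} (h : ∀ x y, ‖f x - f y‖ ≤ c * ‖x - y‖) : Continuous f := by
  refine (LipschitzWith.of_dist_le_mul (K := c.toNNReal) fun x y => ?_).continuous
  rw [dist_eq_norm, dist_eq_norm]
  exact (h x y).trans (mul_le_mul_of_nonneg_right (Real.le_coe_toNNReal c) (norm_nonneg _))

theorem norm_sub_le_of_hasFDerivAt {E F : Type*} [NormedAddCommGroup E] [NormedSpace ℝ E]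
    [NormedAddCommGroup F] [NormedSpace ℝ F] {f : E → F} {f' : E → E →L[ℝ] F} {c : ℝ}
    (hf : ∀ x, HasFDerivAt f (f' x) x) (hc : ∀ x, ‖f' x‖ ≤ c) (x y : E) :
    ‖f x - f y‖ ≤ c * ‖x - y‖ :=
  convex_univ.norm_image_sub_le_of_norm_hasFDerivWithin_le
    (fun z _ => (hf z).hasFDerivWithinAt) (fun z _ => hc z) (mem_univ y) (mem_univ x)

theorem norm_taylor_le_of_hasFDerivAt {E F : Type*} [NormedAddCommGroup E] [NormedSpace ℝ E]
    [NormedAddCommGroup F] [NormedSpace ℝ F] {f : E → F} {f' : E → E →L[ℝ] F} {c : ℝ} (hc : 0 ≤ c)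
    (hf : ∀ x, HasFDerivAt f (f' x) x) (hlip : ∀ x y, ‖f' x - f' y‖ ≤ c * ‖x - y‖) (x y : E) :
    ‖f x - f y - f' y (x - y)‖ ≤ c * ‖x - y‖ ^ 2 := by
  have h := (convex_segment y x).norm_image_sub_le_of_norm_hasFDerivWithin_le'
    (f := f) (φ := f' y) (C := c * ‖x - y‖)
    (fun z _ => (hf z).hasFDerivWithinAt) (fun z hz => (hlip z y).trans ?_)
    (left_mem_segment ℝ y x) (right_mem_segment ℝ y x)
  · exact h.trans_eq (by ring)
  · exact mul_le_mul_of_nonneg_left (norm_sub_le_of_mem_segment hz) hc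

theorem IsCb2.exists_kernelBound {d : ℕ} {K : Space d → Space d} (h : IsCb2 K) :
    ∃ k₀, ∀ k, k₀ ≤ k → KernelBound k K := by
  obtain ⟨hc, hb⟩ := h
  obtain ⟨C₀, h₀⟩ := hb 0 (by norm_num)
  obtain ⟨C₁, h₁⟩ := hb 1 (by norm_num)
  obtain ⟨C₂, h₂⟩ := hb 2 (by norm_num)
  have hd : Differentiable ℝ K := hc.differentiable (by norm_num)
  have hd' : Differentiable ℝ (fderiv ℝ K) :=
    (hc.fderiv_right (m := 1) (by norm_num)).differentiable (by norm_num)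
  refine ⟨max C₀ (max C₁ C₂), fun k hk => ?_⟩
  have hk₀ : C₀ ≤ k := (le_max_left _ _).trans hk
  have hk₁ : C₁ ≤ k := ((le_max_left _ _).trans (le_max_right _ _)).trans hk
  have hk₂ : C₂ ≤ k := ((le_max_right _ _).trans (le_max_right _ _)).trans hk
  have hf : ∀ x, ‖fderiv ℝ K x‖ ≤ k := fun x => by
    have := h₁ x
    rw [norm_iteratedFDeriv_one] at this
    exact this.trans hk₁
  have hf' : ∀ x, ‖fderiv ℝ (fderiv ℝ K) x‖ ≤ k := fun x => by
    have := h₂ x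
    rw [← norm_iteratedFDeriv_fderiv, norm_iteratedFDeriv_one] at this
    exact this.trans hk₂
  refine ⟨hd, fun x => ?_, norm_sub_le_of_hasFDerivAt (fun x => (hd x).hasFDerivAt) hf, hf,
    norm_sub_le_of_hasFDerivAt (fun x => (hd' x).hasFDerivAt) hf'⟩
  have := h₀ x
  rw [norm_iteratedFDeriv_zero] at this
  exact this.trans hk₀

namespace KernelBound

variable {d : ℕ} {k : ℝ} {K : Space d → Space d}

theorem nonneg (h : KernelBound k K) : 0 ≤ k := (norm_nonneg _).trans (h.norm_le 0)

theorem continuous (h : KernelBound k K) : Continuous K := h.differentiable.continuous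

theorem continuous_fderiv (h : KernelBound k K) : Continuous (fderiv ℝ K) :=
  continuous_of_norm_sub_le h.lip_fderiv

theorem taylor (h : KernelBound k K) (x y : Space d) :
    ‖K x - K y - fderiv ℝ K y (x - y)‖ ≤ k * ‖x - y‖ ^ 2 :=
  norm_taylor_le_of_hasFDerivAt h.nonneg (fun x => (h.differentiable x).hasFDerivAt)
    h.lip_fderiv x y

theorem second_difference (h : KernelBound k K) (x y a b : Space d) :
    ‖(K (x - a) - K (x - b)) - (K (y - a) - K (y - b))‖ ≤ k * ‖a - b‖ * ‖x - y‖ := by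
  have hd : ∀ c z, HasFDerivAt (fun z => K (z - c)) (fderiv ℝ K (z - c)) z := fun c z =>
    (h.differentiable (z - c)).hasFDerivAt.comp z ((hasFDerivAt_id z).sub_const c)
  refine norm_sub_le_of_hasFDerivAt (f := fun z => K (z - a) - K (z - b))
    (fun z => (hd a z).sub (hd b z)) (fun z => ?_) x y
  refine (h.lip_fderiv _ _).trans_eq ?_
  rw [sub_sub_sub_cancel_left, norm_sub_rev]

/-- The second difference of the kernel about a midpoint. -/
theorem midpoint_difference (h : KernelBound k K) (x a b c : Space d) (hc : a - c = c - b) :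
    ‖K (x - c) + K (x - c) - K (x - a) - K (x - b)‖ ≤ k * ‖a - b‖ ^ 2 := by
  have hb : x - b = (x - c) + (c - b) := by abel
  have hac : x - c = (x - a) + (c - b) := by rw [← hc]; abel
  have h1 := h.second_difference (x - a) (x - c) 0 (-(c - b))
  simp only [sub_zero, sub_neg_eq_add, ← hb, ← hac, zero_add] at h1
  have hab : a - b = (2 : ℝ) • (c - b) := by rw [two_smul]; nth_rw 1 [← hc]; abel
  have hxx : x - a - (x - c) = -(c - b) := by rw [← hc]; abel
  rw [hxx, norm_neg] at h1
  have h2 : K (x - c) + K (x - c) - K (x - a) - K (x - b)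
      = -((K (x - a) - K (x - c)) - (K (x - c) - K (x - b))) := by abel
  rw [h2, norm_neg, hab, norm_smul]
  refine h1.trans ?_
  have hk := h.nonneg
  norm_num
  nlinarith [mul_nonneg hk (sq_nonneg ‖c - b‖)]

end KernelBound

/-! ### The velocity field -/

section velocity

variable {d M : ℕ} {k : ℝ} {K₁ K₂ : Space d → Space d}

theorem integrable_of_continuous_of_norm_le {Ω E : Type*} [MeasurableSpace Ω]
    [NormedAddCommGroup E]
    {P : Measure Ω} [IsFiniteMeasure P] {f : Ω → E} {c : ℝ} (hf : AEStronglyMeasurable f P)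
    (hc : ∀ x, ‖f x‖ ≤ c) : Integrable f P :=
  Integrable.of_bound hf c (Eventually.of_forall hc)

theorem norm_integral_le_of_bound {Ω E : Type*} [MeasurableSpace Ω] [NormedAddCommGroup E]
    [NormedSpace ℝ E] {P : Measure Ω} [IsProbabilityMeasure P] {f : Ω → E} {c : ℝ}
    (hc : ∀ x, ‖f x‖ ≤ c) : ‖∫ x, f x ∂P‖ ≤ c := by
  simpa using norm_integral_le_of_norm_le_const (μ := P) (Eventually.of_forall hc)

theorem norm_sum_fin_le {E : Type*} [NormedAddCommGroup E] {f : Fin M → E} {c : ℝ}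
    (h : ∀ l, ‖f l‖ ≤ c) : ‖∑ l, f l‖ ≤ M * c := by
  refine (norm_sum_le_of_le _ fun l _ => h l).trans_eq ?_
  simp

theorem KernelBound.integrable (h₁ : KernelBound k K₁) {μ : Measure (Space d)}
    [IsFiniteMeasure μ] (x : Space d) : Integrable (fun y => K₁ (x - y)) μ :=
  integrable_of_continuous_of_norm_le
    (h₁.continuous.comp (continuous_const.sub continuous_id)).aestronglyMeasurable
    fun _ => h₁.norm_le _

theorem norm_velocity_le (h₁ : KernelBound k K₁) (h₂ : KernelBound k K₂) (μ : Measure (Space d))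
    [IsProbabilityMeasure μ] (u : ControlSpace d M) (x : Space d) :
    ‖velocity K₁ K₂ μ u x‖ ≤ (1 + M) * k := by
  unfold velocity
  refine (norm_sub_le _ _).trans ?_
  rw [norm_neg, add_mul, one_mul]
  exact add_le_add (norm_integral_le_of_bound fun _ => h₁.norm_le _)
    (norm_sum_fin_le fun _ => h₂.norm_le _)

theorem norm_velocity_sub_le (h₁ : KernelBound k K₁) (h₂ : KernelBound k K₂)
    (μ : Measure (Space d)) [IsProbabilityMeasure μ] (u : ControlSpace d M) (x y : Space d) :
    ‖velocity K₁ K₂ μ u x - velocity K₁ K₂ μ u y‖ ≤ (1 + M) * k * ‖x - y‖ := by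
  have e : velocity K₁ K₂ μ u x - velocity K₁ K₂ μ u y
      = -(∫ z, (K₁ (x - z) - K₁ (y - z)) ∂μ) - ∑ l, (K₂ (x - u l) - K₂ (y - u l)) := by
    unfold velocity
    rw [integral_sub (h₁.integrable x) (h₁.integrable y), Finset.sum_sub_distrib]
    abel
  rw [e]
  refine (norm_sub_le _ _).trans ?_
  rw [norm_neg]
  refine (add_le_add (norm_integral_le_of_bound (c := k * ‖x - y‖) fun z => ?_)
    (norm_sum_fin_le (c := k * ‖x - y‖) fun l => ?_)).trans_eq (by ring)
  · exact (h₁.lip _ _).trans_eq (by rw [sub_sub_sub_cancel_right])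
  · exact (h₂.lip _ _).trans_eq (by rw [sub_sub_sub_cancel_right])

theorem norm_velocity_control_sub_le (h₂ : KernelBound k K₂)
    (μ : Measure (Space d)) (u w : ControlSpace d M) (x : Space d) :
    ‖velocity K₁ K₂ μ w x - velocity K₁ K₂ μ u x‖ ≤ M * k * ‖w - u‖ := by
  have e : velocity K₁ K₂ μ w x - velocity K₁ K₂ μ u x
      = - ∑ l, (K₂ (x - w l) - K₂ (x - u l)) := by
    unfold velocity
    rw [Finset.sum_sub_distrib]
    abel
  rw [e, norm_neg, mul_assoc]
  refine norm_sum_fin_le fun l => (h₂.lip _ _).trans ?_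
  rw [sub_sub_sub_cancel_left, norm_sub_rev]
  exact mul_le_mul_of_nonneg_left (PiLp.norm_apply_le (w - u) l) h₂.nonneg

/-- The derivative of the velocity field in space. -/
noncomputable def velocityDeriv (K₁ K₂ : Space d → Space d) (μ : Measure (Space d)) (u : ControlSpace d M)
    (x : Space d) : Space d →L[ℝ] Space d :=
  -(∫ y, fderiv ℝ K₁ (x - y) ∂μ) - ∑ l, fderiv ℝ K₂ (x - u l)

theorem KernelBound.integrable_fderiv (h₁ : KernelBound k K₁) {μ : Measure (Space d)}
    [IsFiniteMeasure μ] (x : Space d) : Integrable (fun y => fderiv ℝ K₁ (x - y)) μ :=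
  integrable_of_continuous_of_norm_le
    (h₁.continuous_fderiv.comp (continuous_const.sub continuous_id)).aestronglyMeasurable
    fun _ => h₁.norm_fderiv_le _

theorem hasFDerivAt_velocity (h₁ : KernelBound k K₁) (h₂ : KernelBound k K₂)
    (μ : Measure (Space d)) [IsProbabilityMeasure μ] (u : ControlSpace d M) (x : Space d) :
    HasFDerivAt (velocity K₁ K₂ μ u) (velocityDeriv K₁ K₂ μ u x) x := by
  refine HasFDerivAt.sub (HasFDerivAt.neg ?_) (HasFDerivAt.fun_sum fun l _ => ?_)
  · refine hasFDerivAt_integral_of_dominated_of_fderiv_le (bound := fun _ => k)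
      (F := fun z y => K₁ (z - y)) (F' := fun z y => fderiv ℝ K₁ (z - y)) univ_mem
      (Eventually.of_forall fun z => (h₁.integrable z).aestronglyMeasurable) (h₁.integrable x)
      (h₁.integrable_fderiv x).aestronglyMeasurable
      (Eventually.of_forall fun y z _ => h₁.norm_fderiv_le _) (integrable_const _)
      (Eventually.of_forall fun y z _ => ?_)
    exact (h₁.differentiable (z - y)).hasFDerivAt.comp z ((hasFDerivAt_id z).sub_const y)
  · exact (h₂.differentiable (x - u l)).hasFDerivAt.comp x ((hasFDerivAt_id x).sub_const _)

theorem norm_velocityDeriv_le (h₁ : KernelBound k K₁) (h₂ : KernelBound k K₂)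
    (μ : Measure (Space d)) [IsProbabilityMeasure μ] (u : ControlSpace d M) (x : Space d) :
    ‖velocityDeriv K₁ K₂ μ u x‖ ≤ (1 + M) * k := by
  unfold velocityDeriv
  refine (norm_sub_le _ _).trans ?_
  rw [norm_neg, add_mul, one_mul]
  exact add_le_add (norm_integral_le_of_bound fun _ => h₁.norm_fderiv_le _)
    (norm_sum_fin_le fun _ => h₂.norm_fderiv_le _)

theorem norm_velocityDeriv_sub_le (h₁ : KernelBound k K₁) (h₂ : KernelBound k K₂)
    (μ : Measure (Space d)) [IsProbabilityMeasure μ] (u : ControlSpace d M) (x y : Space d) :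
    ‖velocityDeriv K₁ K₂ μ u x - velocityDeriv K₁ K₂ μ u y‖ ≤ (1 + M) * k * ‖x - y‖ := by
  have e : velocityDeriv K₁ K₂ μ u x - velocityDeriv K₁ K₂ μ u y
      = -(∫ z, (fderiv ℝ K₁ (x - z) - fderiv ℝ K₁ (y - z)) ∂μ)
        - ∑ l, (fderiv ℝ K₂ (x - u l) - fderiv ℝ K₂ (y - u l)) := by
    unfold velocityDeriv
    rw [integral_sub (h₁.integrable_fderiv x) (h₁.integrable_fderiv y), Finset.sum_sub_distrib]
    abel
  rw [e]
  refine (norm_sub_le _ _).trans ?_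
  rw [norm_neg]
  refine (add_le_add (norm_integral_le_of_bound (c := k * ‖x - y‖) fun z => ?_)
    (norm_sum_fin_le (c := k * ‖x - y‖) fun l => ?_)).trans_eq (by ring)
  · exact (h₁.lip_fderiv _ _).trans_eq (by rw [sub_sub_sub_cancel_right])
  · exact (h₂.lip_fderiv _ _).trans_eq (by rw [sub_sub_sub_cancel_right])

theorem velocity_taylor (h₁ : KernelBound k K₁) (h₂ : KernelBound k K₂)
    (μ : Measure (Space d)) [IsProbabilityMeasure μ] (u : ControlSpace d M) (x y : Space d) :
    ‖velocity K₁ K₂ μ u x - velocity K₁ K₂ μ u y - velocityDeriv K₁ K₂ μ u y (x - y)‖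
      ≤ (1 + M) * k * ‖x - y‖ ^ 2 :=
  norm_taylor_le_of_hasFDerivAt (by have := h₁.nonneg; positivity)
    (hasFDerivAt_velocity h₁ h₂ μ u) (norm_velocityDeriv_sub_le h₁ h₂ μ u) x y

theorem velocity_map {Ω : Type*} [MeasurableSpace Ω] {P : Measure Ω} {Z : Ω → Space d}
    (hZ : AEMeasurable Z P) (h₁ : KernelBound k K₁) (u : ControlSpace d M) (x : Space d) :
    velocity K₁ K₂ (P.map Z) u x = -(∫ η, K₁ (x - Z η) ∂P) - ∑ l, K₂ (x - u l) := by
  unfold velocity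
  rw [integral_map (f := fun y => K₁ (x - y)) hZ
    (h₁.continuous.comp (continuous_const.sub continuous_id)).aestronglyMeasurable]

end velocity

/-! ### Trajectories of a Lipschitz field -/

theorem norm_sub_le_of_hasDerivWithinAt_Icc {E : Type*} [NormedAddCommGroup E] [NormedSpace ℝ E]
    {T c : ℝ} {q q' : ℝ → E} (hq : ∀ t ∈ Icc 0 T, HasDerivWithinAt q (q' t) (Icc 0 T) t)
    (hc : ∀ t ∈ Icc 0 T, ‖q' t‖ ≤ c) {s t : ℝ} (hs : s ∈ Icc 0 T) (ht : t ∈ Icc 0 T) :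
    ‖q t - q s‖ ≤ c * |t - s| := by
  simpa using (convex_Icc (0 : ℝ) T).norm_image_sub_le_of_norm_hasDerivWithin_le hq hc hs ht

/-- Grönwall's inequality for two trajectories of a Lipschitz field, forwards in time. -/
theorem norm_sub_le_of_trajectories {E : Type*} [NormedAddCommGroup E] [NormedSpace ℝ E]
    {T c : ℝ} (hc : 0 ≤ c) {b : ℝ → E → E}
    (hb : ∀ t ∈ Icc 0 T, ∀ x y, ‖b t x - b t y‖ ≤ c * ‖x - y‖) {q r : ℝ → E} {t₀ : ℝ}
    (ht₀ : 0 ≤ t₀)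
    (hq : ∀ t ∈ Icc t₀ T, HasDerivWithinAt q (b t (q t)) (Icc 0 T) t)
    (hr : ∀ t ∈ Icc t₀ T, HasDerivWithinAt r (b t (r t)) (Icc 0 T) t) {t : ℝ}
    (ht : t ∈ Icc t₀ T) : ‖q t - r t‖ ≤ Real.exp (c * T) * ‖q t₀ - r t₀‖ := by
  have hsub : Icc t₀ T ⊆ Icc 0 T := Icc_subset_Icc_left ht₀
  have key : ∀ q : ℝ → E, (∀ t ∈ Icc t₀ T, HasDerivWithinAt q (b t (q t)) (Icc 0 T) t) →
      ∀ t ∈ Ico t₀ T, HasDerivWithinAt q (b t (q t)) (Ici t) t := fun q hq t ht => by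
    refine ((hq t ⟨ht.1, ht.2.le⟩).mono (?_ : Icc t T ⊆ _)).mono_of_mem_nhdsWithin
      (Icc_mem_nhdsGE ht.2)
    exact Icc_subset_Icc_left (ht₀.trans ht.1)
  have h := dist_le_of_trajectories_ODE_of_mem (v := b) (K := c.toNNReal) (s := fun _ => univ)
    (a := t₀) (b := T) (f := q) (g := r) (δ := ‖q t₀ - r t₀‖)
    (fun t ht => (LipschitzWith.of_dist_le_mul fun x y => by
      rw [Real.coe_toNNReal c hc, dist_eq_norm, dist_eq_norm]
      exact hb t (hsub ⟨ht.1, ht.2.le⟩) x y).lipschitzOnWith)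
    (fun t ht => ((hq t ht).continuousWithinAt).mono hsub) (key q hq) (fun _ _ => mem_univ _)
    (fun t ht => ((hr t ht).continuousWithinAt).mono hsub) (key r hr) (fun _ _ => mem_univ _)
    (dist_eq_norm _ _).le t ht
  rw [dist_eq_norm, Real.coe_toNNReal c hc, mul_comm] at h
  refine h.trans (mul_le_mul_of_nonneg_right (Real.exp_le_exp.2 ?_) (norm_nonneg _))
  exact mul_le_mul_of_nonneg_left (by linarith [ht.2]) hc

/-! ### Existence of the mean-field flow -/

section existence

variable {d M : ℕ} {k T : ℝ} {K₁ K₂ : Space d → Space d}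

theorem integrable_kernel_comp {Ω : Type*} [MeasurableSpace Ω] {P : Measure Ω}
    [IsFiniteMeasure P] {Z : Ω → Space d} (hZ : AEStronglyMeasurable Z P)
    (h₁ : KernelBound k K₁) (x : Space d) : Integrable (fun η => K₁ (x - Z η)) P :=
  integrable_of_continuous_of_norm_le
    (h₁.continuous.comp_aestronglyMeasurable (aestronglyMeasurable_const.sub hZ))
    fun _ => h₁.norm_le _

theorem velocity_map_sub {Ω : Type*} [MeasurableSpace Ω] {P : Measure Ω} [IsFiniteMeasure P]
    {Z Z' : Ω → Space d} (hZ : AEStronglyMeasurable Z P) (hZ' : AEStronglyMeasurable Z' P)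
    (h₁ : KernelBound k K₁) (w u : ControlSpace d M) (x : Space d) :
    velocity K₁ K₂ (P.map Z) w x - velocity K₁ K₂ (P.map Z') u x
      = -(∫ η, (K₁ (x - Z η) - K₁ (x - Z' η)) ∂P) - ∑ l, (K₂ (x - w l) - K₂ (x - u l)) := by
  rw [velocity_map hZ.aemeasurable h₁, velocity_map hZ'.aemeasurable h₁,
    integral_sub (integrable_kernel_comp hZ h₁ x) (integrable_kernel_comp hZ' h₁ x),
    Finset.sum_sub_distrib]
  abel

/-- `X` is the mean-field flow of the control `w` started from the identity, that is, each
`t ↦ X t x` solves `q' = v(ν_t, w_t)(q)` on `[0,T]`, where `ν_t` is the image of `ν₀` under `X t`. -/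
structure IsMeanFieldFlow (T : ℝ) (K₁ K₂ : Space d → Space d) (ν₀ : Measure (Space d))
    (w : ℝ → ControlSpace d M) (X : ℝ → Space d → Space d) : Prop where
  continuous : ∀ t, Continuous (X t)
  init : ∀ x, X 0 x = x
  ode : ∀ t ∈ Icc 0 T, ∀ x, HasDerivWithinAt (fun s => X s x)
    (velocity K₁ K₂ (ν₀.map (X t)) (w t) (X t x)) (Icc 0 T) t

open BoundedContinuousFunction in
/-- The mean-field system is an ordinary differential equation with a bounded Lipschitz right-hand
side for the displacement `X t - id`, in the space of bounded continuous functions. -/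
theorem exists_isMeanFieldFlow (hT : 0 < T) (h₁ : KernelBound k K₁) (h₂ : KernelBound k K₂)
    (ν₀ : Measure (Space d)) [IsProbabilityMeasure ν₀] {w : ℝ → ControlSpace d M}
    (hw : ContinuousOn w (Icc 0 T)) : ∃ X, IsMeanFieldFlow T K₁ K₂ ν₀ w X := by
  have hk := h₁.nonneg
  have hm : ∀ f : Space d →ᵇ Space d, Continuous fun x => x + f x := fun f =>
    continuous_id.add f.continuous
  have hp : ∀ f : Space d →ᵇ Space d, IsProbabilityMeasure (ν₀.map fun x => x + f x) := fun f =>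
    Measure.isProbabilityMeasure_map (hm f).aemeasurable
  let Φ : ℝ → (Space d →ᵇ Space d) → (Space d →ᵇ Space d) := fun t f =>
    ofNormedAddCommGroup (fun x => velocity K₁ K₂ (ν₀.map fun x => x + f x) (w t) (x + f x))
      ((continuous_of_norm_sub_le (norm_velocity_sub_le h₁ h₂ _ _)).comp (hm f)) ((1 + M) * k)
      (fun x => norm_velocity_le h₁ h₂ _ _ _)
  have hlip : ∀ t f g, ‖Φ t f - Φ t g‖ ≤ ((2 + M) * k) * ‖f - g‖ := fun t f g => by
    refine (BoundedContinuousFunction.norm_le (by positivity)).2 fun x => ?_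
    have e : (Φ t f - Φ t g) x
        = (velocity K₁ K₂ (ν₀.map fun x => x + f x) (w t) (x + f x)
          - velocity K₁ K₂ (ν₀.map fun x => x + g x) (w t) (x + f x))
        + (velocity K₁ K₂ (ν₀.map fun x => x + g x) (w t) (x + f x)
          - velocity K₁ K₂ (ν₀.map fun x => x + g x) (w t) (x + g x)) := by
      rw [sub_add_sub_cancel]; rfl
    have hfg : ∀ y, ‖f y - g y‖ ≤ ‖f - g‖ := fun y => (f - g).norm_coe_le_norm y
    rw [e]
    refine (norm_add_le_of_le (?_ : _ ≤ k * ‖f - g‖)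
      (?_ : _ ≤ (1 + M) * k * ‖f - g‖)).trans_eq (by ring)
    · rw [velocity_map_sub (hm f).aestronglyMeasurable (hm g).aestronglyMeasurable h₁]
      simp only [sub_self, Finset.sum_const_zero, sub_zero, norm_neg]
      refine norm_integral_le_of_bound fun y => (h₁.lip _ _).trans ?_
      refine mul_le_mul_of_nonneg_left ?_ hk
      rw [sub_sub_sub_cancel_left, add_sub_add_left_eq_sub, norm_sub_rev]
      exact hfg y
    · refine (norm_velocity_sub_le h₁ h₂ _ _ _ _).trans ?_
      rw [add_sub_add_left_eq_sub]
      exact mul_le_mul_of_nonneg_left (hfg x) (by positivity)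
  have hcont : ∀ f, ContinuousOn (fun t => Φ t f) (Icc 0 T) := fun f t ht => by
    have hlim : Tendsto (fun s => M * k * ‖w s - w t‖) (𝓝[Icc 0 T] t) (𝓝 0) := by
      have := ((hw t ht).sub (continuousWithinAt_const (b := w t))).norm.const_mul (M * k)
      simpa [ContinuousWithinAt] using this
    refine tendsto_iff_norm_sub_tendsto_zero.2 (squeeze_zero (fun _ => norm_nonneg _)
      (fun s => ?_) hlim)
    refine (BoundedContinuousFunction.norm_le (by positivity)).2 fun x => ?_
    exact norm_velocity_control_sub_le h₂ _ _ _ _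
  have hPL : IsPicardLindelof Φ (tmin := 0) (tmax := T) ⟨0, left_mem_Icc.2 hT.le⟩ 0
      (((1 + M) * k * T).toNNReal) 0 (((1 + M) * k).toNNReal) (((2 + M) * k).toNNReal) := by
    refine ⟨fun t _ => (LipschitzWith.of_dist_le_mul fun f g => ?_).lipschitzOnWith,
      fun f _ => hcont f, fun t _ f _ => ?_, ?_⟩
    · rw [Real.coe_toNNReal _ (by positivity), dist_eq_norm, dist_eq_norm]
      exact hlip t f g
    · rw [Real.coe_toNNReal _ (by positivity)]
      exact (BoundedContinuousFunction.norm_le (by positivity)).2 fun x =>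
        norm_velocity_le h₁ h₂ _ _ _
    · rw [Real.coe_toNNReal _ (by positivity), Real.coe_toNNReal _ (by positivity)]
      simp [hT.le]
  obtain ⟨α, h0, hα⟩ := hPL.exists_eq_forall_mem_Icc_hasDerivWithinAt₀
  refine ⟨fun t x => x + α t x, fun t => hm (α t), fun x => ?_, fun t ht x => ?_⟩
  · have : α 0 = 0 := h0
    simp [this]
  · have := (evalCLM ℝ x).hasFDerivAt.comp_hasDerivWithinAt t (hα t ht)
    exact this.const_add x

end existence

/-! ### Families of random variables dominated in time -/

section dominated

variable {Ω E : Type*} [MeasurableSpace Ω] [NormedAddCommGroup E]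
  {P : Measure Ω} {T : ℝ}

/-- A family of random variables that is continuous in time on `[0,T]` and dominated there by an
integrable function. -/
structure TimeDominated (P : Measure Ω) (T : ℝ) (F : ℝ → Ω → E) : Prop where
  continuousOn : ∀ η, ContinuousOn (fun t => F t η) (Icc 0 T)
  measurable : ∀ t ∈ Icc 0 T, StronglyMeasurable (F t)
  dominated : ∃ D : Ω → ℝ, Integrable D P ∧ ∀ t ∈ Icc 0 T, ∀ η, ‖F t η‖ ≤ D η

namespace TimeDominated

variable {F : ℝ → Ω → E}

theorem integrable (h : TimeDominated P T F) {t : ℝ} (ht : t ∈ Icc 0 T) : Integrable (F t) P := by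
  obtain ⟨D, hD, hb⟩ := h.dominated
  exact hD.mono' (h.measurable t ht).aestronglyMeasurable (Eventually.of_forall (hb t ht))

theorem continuousOn_integral [NormedSpace ℝ E] (h : TimeDominated P T F) :
    ContinuousOn (fun t => ∫ η, F t η ∂P) (Icc 0 T) := by
  obtain ⟨D, hD, hb⟩ := h.dominated
  exact continuousOn_of_dominated (fun t ht => (h.measurable t ht).aestronglyMeasurable)
    (fun t ht => Eventually.of_forall (hb t ht)) hD (Eventually.of_forall h.continuousOn)

theorem integral_swap [NormedSpace ℝ E] (hT : 0 ≤ T) [SFinite P] (h : TimeDominated P T F) :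
    ∫ t in (0 : ℝ)..T, (∫ η, F t η ∂P) = ∫ η, (∫ t in (0 : ℝ)..T, F t η) ∂P := by
  obtain ⟨D, hD, hb⟩ := h.dominated
  -- Freezing time outside `[0,T]` makes the family jointly measurable.
  let G : ℝ → Ω → E := fun t => F (projIcc 0 T hT t)
  have hG : StronglyMeasurable (Function.uncurry G) :=
    stronglyMeasurable_uncurry_of_continuous_of_stronglyMeasurable
      (fun η => (continuousOn_iff_continuous_domRestrict.1 (h.continuousOn η)).comp
        (continuous_projIcc (h := hT)))
      (fun t => h.measurable _ (projIcc 0 T hT t).2)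
  have hGF : ∀ t ∈ Ioc 0 T, G t = F t := fun t ht => by
    simp only [G, projIcc_of_mem hT (Ioc_subset_Icc_self ht)]
  simp only [intervalIntegral.integral_of_le hT]
  have e1 : ∫ t in Ioc 0 T, (∫ η, F t η ∂P) = ∫ t in Ioc 0 T, (∫ η, G t η ∂P) :=
    setIntegral_congr_fun measurableSet_Ioc fun t ht => by simp only [hGF t ht]
  have e2 : ∀ η, ∫ t in Ioc 0 T, F t η = ∫ t in Ioc 0 T, G t η := fun η =>
    setIntegral_congr_fun measurableSet_Ioc fun t ht => by simp only [hGF t ht]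
  simp only [e1, e2]
  refine integral_integral_swap (f := G) ?_
  have hint : Integrable (fun p : ℝ × Ω => D p.2) ((volume.restrict (Ioc 0 T)).prod P) :=
    hD.comp_snd _
  refine hint.mono' ?_ (Eventually.of_forall fun p => hb _ (projIcc 0 T hT p.1).2 p.2)
  exact hG.aestronglyMeasurable

end TimeDominated

end dominated

/-! ### The mean-field flow yields admissible competitors -/

theorem integral_eq_sub_of_hasDerivWithinAt_Icc {E : Type*} [NormedAddCommGroup E]
    [NormedSpace ℝ E] [CompleteSpace E] {a b : ℝ} (hab : a ≤ b) {f f' : ℝ → E}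
    (hf : ∀ t ∈ Icc a b, HasDerivWithinAt f (f' t) (Icc a b) t) (hf' : ContinuousOn f' (Icc a b)) :
    ∫ t in a..b, f' t = f b - f a :=
  intervalIntegral.integral_eq_sub_of_hasDerivAt_of_le hab
    (fun t ht => (hf t ht).continuousWithinAt)
    (fun t ht => (hf t (Ioo_subset_Icc_self ht)).hasDerivAt (Icc_mem_nhds ht.1 ht.2))
    (ContinuousOn.intervalIntegrable (by rwa [uIcc_of_le hab]))

section

variable {d M : ℕ} {k T : ℝ} {K₁ K₂ : Space d → Space d}

theorem continuousOn_velocity {Ω S : Type*} [MeasurableSpace Ω] {P : Measure Ω}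
    [IsProbabilityMeasure P] [TopologicalSpace S] [FirstCountableTopology S] {s : Set S}
    (h₁ : KernelBound k K₁) (h₂ : KernelBound k K₂) {Z : S → Ω → Space d}
    (hZ : ∀ η, ContinuousOn (fun p => Z p η) s) (hm : ∀ p ∈ s, AEStronglyMeasurable (Z p) P)
    {w : S → ControlSpace d M} (hw : ContinuousOn w s) {q : S → Space d} (hq : ContinuousOn q s) :
    ContinuousOn (fun p => velocity K₁ K₂ (P.map (Z p)) (w p) (q p)) s := by
  have e : EqOn (fun p => velocity K₁ K₂ (P.map (Z p)) (w p) (q p))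
      (fun p => -(∫ η, K₁ (q p - Z p η) ∂P) - ∑ l, K₂ (q p - w p l)) s := fun p hp =>
    velocity_map (hm p hp).aemeasurable h₁ _ _
  refine ContinuousOn.congr (ContinuousOn.sub (ContinuousOn.neg ?_)
    (continuousOn_finsetSum _ fun l _ => ?_)) e
  · exact continuousOn_of_dominated (bound := fun _ => k)
      (fun p hp => (integrable_kernel_comp (hm p hp) h₁ _).aestronglyMeasurable)
      (fun p _ => Eventually.of_forall fun η => h₁.norm_le _) (integrable_const _)
      (Eventually.of_forall fun η => h₁.continuous.comp_continuousOn (hq.sub (hZ η)))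
  · refine h₂.continuous.comp_continuousOn (hq.sub ?_)
    exact (PiLp.continuous_apply 2 _ l).comp_continuousOn hw

theorem continuousOn_velocityDeriv {Ω S : Type*} [MeasurableSpace Ω] {P : Measure Ω}
    [IsProbabilityMeasure P] [TopologicalSpace S] [FirstCountableTopology S] {s : Set S}
    (h₁ : KernelBound k K₁) (h₂ : KernelBound k K₂) {Z : S → Ω → Space d}
    (hZ : ∀ η, ContinuousOn (fun p => Z p η) s) (hm : ∀ p ∈ s, AEStronglyMeasurable (Z p) P)
    {w : S → ControlSpace d M} (hw : ContinuousOn w s) {q : S → Space d} (hq : ContinuousOn q s) :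
    ContinuousOn (fun p => velocityDeriv K₁ K₂ (P.map (Z p)) (w p) (q p)) s := by
  have e : EqOn (fun p => velocityDeriv K₁ K₂ (P.map (Z p)) (w p) (q p))
      (fun p => -(∫ η, fderiv ℝ K₁ (q p - Z p η) ∂P) - ∑ l, fderiv ℝ K₂ (q p - w p l)) s := by
    intro p hp
    simp only [velocityDeriv]
    rw [integral_map (f := fun y => fderiv ℝ K₁ (q p - y)) (hm p hp).aemeasurable
      (h₁.continuous_fderiv.comp (continuous_const.sub continuous_id)).aestronglyMeasurable]
  refine ContinuousOn.congr (ContinuousOn.sub (ContinuousOn.neg ?_)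
    (continuousOn_finsetSum _ fun l _ => ?_)) e
  · exact continuousOn_of_dominated (bound := fun _ => k)
      (fun p hp => h₁.continuous_fderiv.comp_aestronglyMeasurable
        (aestronglyMeasurable_const.sub (hm p hp)))
      (fun p _ => Eventually.of_forall fun η => h₁.norm_fderiv_le _) (integrable_const _)
      (Eventually.of_forall fun η => h₁.continuous_fderiv.comp_continuousOn (hq.sub (hZ η)))
  · refine h₂.continuous_fderiv.comp_continuousOn (hq.sub ?_)
    exact (PiLp.continuous_apply 2 _ l).comp_continuousOn hw

namespace IsMeanFieldFlow

variable {ν₀ : Measure (Space d)} [IsProbabilityMeasure ν₀] {w : ℝ → ControlSpace d M}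
  {X : ℝ → Space d → Space d}

theorem isProbabilityMeasure_map (h : IsMeanFieldFlow T K₁ K₂ ν₀ w X) (t : ℝ) :
    IsProbabilityMeasure (ν₀.map (X t)) :=
  Measure.isProbabilityMeasure_map (h.continuous t).aemeasurable

theorem norm_sub_le (h : IsMeanFieldFlow T K₁ K₂ ν₀ w X) (h₁ : KernelBound k K₁)
    (h₂ : KernelBound k K₂) {s t : ℝ} (hs : s ∈ Icc 0 T) (ht : t ∈ Icc 0 T) (x : Space d) :
    ‖X t x - X s x‖ ≤ (1 + M) * k * |t - s| :=
  norm_sub_le_of_hasDerivWithinAt_Icc (fun t ht => h.ode t ht x) (fun t _ => by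
    have := h.isProbabilityMeasure_map t
    exact norm_velocity_le h₁ h₂ _ _ _) hs ht

theorem continuousOn_velocity_comp (h : IsMeanFieldFlow T K₁ K₂ ν₀ w X) (h₁ : KernelBound k K₁)
    (h₂ : KernelBound k K₂) (hw : ContinuousOn w (Icc 0 T)) {q : ℝ → Space d}
    (hq : ContinuousOn q (Icc 0 T)) :
    ContinuousOn (fun t => velocity K₁ K₂ (ν₀.map (X t)) (w t) (q t)) (Icc 0 T) :=
  continuousOn_velocity h₁ h₂ (fun x t ht => (h.ode t ht x).continuousWithinAt)
    (fun t _ => (h.continuous t).aestronglyMeasurable) hw hq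

theorem isP2_map (h : IsMeanFieldFlow T K₁ K₂ ν₀ w X) (h₁ : KernelBound k K₁)
    (h₂ : KernelBound k K₂) (hν₀ : IsP2 ν₀) {t : ℝ} (ht : t ∈ Icc 0 T) : IsP2 (ν₀.map (X t)) := by
  refine ⟨h.isProbabilityMeasure_map t, ?_⟩
  refine (memLp_map_measure_iff aestronglyMeasurable_id (h.continuous t).aemeasurable).2 ?_
  have hb : MemLp (fun x => X t x - x) 2 ν₀ :=
    MemLp.of_bound ((h.continuous t).sub continuous_id).aestronglyMeasurable
      ((1 + M) * k * |t - 0|) (Eventually.of_forall fun x => by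
        have := h.norm_sub_le h₁ h₂ (left_mem_Icc.2 (ht.1.trans ht.2)) ht x
        rwa [h.init] at this)
  convert hb.add hν₀.memLp using 1
  ext1 x
  simp

theorem isP2Curve (h : IsMeanFieldFlow T K₁ K₂ ν₀ w X) (h₁ : KernelBound k K₁)
    (h₂ : KernelBound k K₂) (hν₀ : IsP2 ν₀) : IsP2Curve T fun t => ν₀.map (X t) := by
  refine ⟨fun t ht => h.isP2_map h₁ h₂ hν₀ ht, fun t ht => ?_⟩
  have hlim : Tendsto (fun s => ENNReal.ofReal ((1 + M) * k * |s - t|) ^ 2) (𝓝[Icc 0 T] t)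
      (𝓝 0) := by
    have h0 : Tendsto (fun s : ℝ => (1 + M) * k * |s - t|) (𝓝[Icc 0 T] t) (𝓝 0) := by
      have : Continuous fun s : ℝ => (1 + M) * k * |s - t| := by fun_prop
      simpa using (this.tendsto t).mono_left nhdsWithin_le_nhds
    simpa using ENNReal.Tendsto.pow (n := 2) (ENNReal.tendsto_ofReal h0)
  refine tendsto_of_tendsto_of_tendsto_of_le_of_le' tendsto_const_nhds hlim
    (Eventually.of_forall fun _ => zero_le) ?_
  filter_upwards [self_mem_nhdsWithin] with s hs
  have hc : Continuous fun x => (X s x, X t x) := (h.continuous s).prodMk (h.continuous t)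
  refine (iInf₂_le (ν₀.map fun x => (X s x, X t x)) ⟨Measure.map_map measurable_fst hc.measurable,
    Measure.map_map measurable_snd hc.measurable⟩).trans ?_
  · rw [lintegral_map (by fun_prop) hc.measurable]
    refine (lintegral_mono (g := fun _ => ENNReal.ofReal ((1 + M) * k * |s - t|) ^ 2)
      fun x => ?_).trans_eq (by simp)
    refine pow_le_pow_left' ?_ 2
    rw [← ofReal_norm]
    exact ENNReal.ofReal_le_ofReal (h.norm_sub_le h₁ h₂ ht hs x)

/-- The laws of the mean-field flow are a weak solution of the continuity equation. -/
theorem isWeakSolution (hT : 0 < T) (h : IsMeanFieldFlow T K₁ K₂ ν₀ w X)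
    (h₁ : KernelBound k K₁) (h₂ : KernelBound k K₂) (hν₀ : IsP2 ν₀)
    (hw : ContinuousOn w (Icc 0 T)) : IsWeakSolution T K₁ K₂ ν₀ w fun t => ν₀.map (X t) := by
  refine ⟨h.isP2Curve h₁ h₂ hν₀, fun φ hφ => ?_⟩
  have hk := h₁.nonneg
  have hdφ : Continuous (fderiv ℝ φ) := hφ.smooth.continuous_fderiv (by norm_num)
  obtain ⟨C, hC⟩ := hdφ.bounded_above_of_compact_support (hφ.compact.fderiv (𝕜 := ℝ))
  have hXt : ∀ x, ContinuousOn (fun t => X t x) (Icc 0 T) := fun x t ht =>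
    (h.ode t ht x).continuousWithinAt
  have hp := h.isProbabilityMeasure_map
  let F : ℝ → Space d → ℝ := fun t x =>
    fderiv ℝ φ (t, X t x) (1, velocity K₁ K₂ (ν₀.map (X t)) (w t) (X t x))
  have hFt : ∀ x, ContinuousOn (fun t => F t x) (Icc 0 T) := fun x =>
    (hdφ.comp_continuousOn (continuousOn_id.prodMk (hXt x))).clm_apply
      (continuousOn_const.prodMk (h.continuousOn_velocity_comp h₁ h₂ hw (hXt x)))
  have hvx : ∀ t, Continuous (velocity K₁ K₂ (ν₀.map (X t)) (w t)) := fun t => by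
    have := hp t
    exact continuous_of_norm_sub_le (norm_velocity_sub_le h₁ h₂ _ _)
  have hF : TimeDominated ν₀ T F := by
    refine ⟨hFt, fun t _ => Continuous.stronglyMeasurable ?_, fun _ => C * max 1 ((1 + M) * k),
      integrable_const _, fun t ht x => ?_⟩
    · exact (hdφ.comp (continuous_const.prodMk (h.continuous t))).clm_apply
        (continuous_const.prodMk ((hvx t).comp (h.continuous t)))
    · refine (ContinuousLinearMap.le_opNorm _ _).trans ?_
      refine mul_le_mul (hC _) ?_ (norm_nonneg _) ((norm_nonneg _).trans (hC 0))
      rw [Prod.norm_def]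
      refine max_le_max (by simp) ?_
      have := hp t
      exact norm_velocity_le h₁ h₂ _ _ _
  have e1 : ∀ t, ∫ x, fderiv ℝ φ (t, x) (1, velocity K₁ K₂ (ν₀.map (X t)) (w t) x) ∂(ν₀.map (X t))
      = ∫ x, F t x ∂ν₀ := fun t => by
    rw [integral_map (h.continuous t).aemeasurable]
    refine Continuous.aestronglyMeasurable ?_
    exact (hdφ.comp (continuous_const.prodMk continuous_id)).clm_apply
        (continuous_const.prodMk (hvx t))
  have e2 : ∀ x, ∫ t in (0 : ℝ)..T, F t x = -φ (0, x) := fun x => by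
    rw [integral_eq_sub_of_hasDerivWithinAt_Icc (f := fun t => φ (t, X t x)) hT.le
      (fun t ht => ?_) (hFt x), h.init, image_eq_zero_of_notMem_tsupport (f := φ) (x := (T, X T x)), zero_sub]
    · exact fun hmem => lt_irrefl T (hφ.support hmem).1
    · have hd : HasFDerivAt φ (fderiv ℝ φ (t, X t x)) (t, X t x) :=
        (hφ.smooth.differentiable (by norm_num) _).hasFDerivAt
      exact hd.comp_hasDerivWithinAt t ((hasDerivWithinAt_id t _).prodMk (h.ode t ht x))
  simp only [e1]
  rw [hF.integral_swap hT.le]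
  simp only [e2]
  rw [integral_neg, neg_add_cancel]

end IsMeanFieldFlow

/-! ### The particle system -/

/-- The uniform probability measure on the labels of `N` particles. -/
noncomputable def uniformLabels (N : ℕ) : Measure (Fin N) :=
  (N : ℝ≥0∞)⁻¹ • ∑ i, Measure.dirac i

theorem isProbabilityMeasure_uniformLabels {N : ℕ} (hN : 0 < N) :
    IsProbabilityMeasure (uniformLabels N) := by
  refine ⟨?_⟩
  have : (N : ℝ≥0∞) ≠ 0 := by exact_mod_cast hN.ne'
  simp [uniformLabels, ENNReal.inv_mul_cancel this (ENNReal.natCast_ne_top N)]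

theorem empirical_eq_map {N : ℕ} (x : Fin N → Space d) :
    empirical x = (uniformLabels N).map x := by
  have hx : Measurable x := measurable_of_finite x
  unfold empirical uniformLabels
  rw [Measure.map_smul, Measure.map_finset_sum hx.aemeasurable]
  simp only [Measure.map_dirac' hx]

theorem map_empirical {N : ℕ} (x : Fin N → Space d) {f : Space d → Space d} (hf : Measurable f) :
    (empirical x).map f = empirical fun i => f (x i) := by
  rw [empirical_eq_map, empirical_eq_map, Measure.map_map hf (measurable_of_finite x)]
  rfl

theorem isProbabilityMeasure_empirical {N : ℕ} (hN : 0 < N) (x : Fin N → Space d) :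
    IsProbabilityMeasure (empirical x) := by
  have := isProbabilityMeasure_uniformLabels hN
  rw [empirical_eq_map]
  exact Measure.isProbabilityMeasure_map (measurable_of_finite x).aemeasurable

theorem isP2_empirical {N : ℕ} (hN : 0 < N) (x : Fin N → Space d) : IsP2 (empirical x) := by
  have := isProbabilityMeasure_uniformLabels hN
  refine ⟨isProbabilityMeasure_empirical hN x, ?_⟩
  have hx : Measurable x := measurable_of_finite x
  rw [empirical_eq_map]
  refine (memLp_map_measure_iff aestronglyMeasurable_id hx.aemeasurable).2 ?_
  exact MemLp.of_bound hx.aestronglyMeasurable ‖x‖ (Eventually.of_forall fun i => norm_le_pi_norm x i)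

theorem IsMeanFieldFlow.isParticleSolution {N : ℕ} {x₀ : Fin N → Space d}
    {w : ℝ → ControlSpace d M} {X : ℝ → Space d → Space d}
    (h : IsMeanFieldFlow T K₁ K₂ (empirical x₀) w X) :
    IsParticleSolution T K₁ K₂ x₀ w fun t i => X t (x₀ i) := by
  refine ⟨funext fun i => h.init _, fun t ht i => ?_⟩
  rw [← map_empirical x₀ (h.continuous t).measurable]
  exact h.ode t ht (x₀ i)

/-- The particle system has at most one solution. -/
theorem IsParticleSolution.unique {N : ℕ} (hN : 0 < N) (h₁ : KernelBound k K₁)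
    (h₂ : KernelBound k K₂) {x₀ : Fin N → Space d} {w : ℝ → ControlSpace d M}
    {x y : ℝ → Fin N → Space d} (hx : IsParticleSolution T K₁ K₂ x₀ w x)
    (hy : IsParticleSolution T K₁ K₂ x₀ w y) {t : ℝ} (ht : t ∈ Icc 0 T) : x t = y t := by
  have hk := h₁.nonneg
  have := isProbabilityMeasure_uniformLabels hN
  let b : ℝ → (Fin N → Space d) → (Fin N → Space d) := fun t x i =>
    velocity K₁ K₂ (empirical x) (w t) (x i)
  have hm : ∀ z : Fin N → Space d, AEStronglyMeasurable z (uniformLabels N) := fun z =>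
    (measurable_of_finite z).aestronglyMeasurable
  have hb : ∀ t ∈ Icc 0 T, ∀ x y, ‖b t x - b t y‖ ≤ (2 + M) * k * ‖x - y‖ := by
    intro t _ x y
    refine (pi_norm_le_iff_of_nonneg (by positivity)).2 fun i => ?_
    have hxy : ∀ i, ‖x i - y i‖ ≤ ‖x - y‖ := fun i => norm_le_pi_norm (x - y) i
    have e : (b t x - b t y) i
        = (velocity K₁ K₂ (empirical x) (w t) (x i) - velocity K₁ K₂ (empirical y) (w t) (x i))
        + (velocity K₁ K₂ (empirical y) (w t) (x i)
          - velocity K₁ K₂ (empirical y) (w t) (y i)) := by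
      rw [sub_add_sub_cancel]; rfl
    rw [e]
    refine (norm_add_le_of_le (?_ : _ ≤ k * ‖x - y‖)
      (?_ : _ ≤ (1 + M) * k * ‖x - y‖)).trans_eq (by ring)
    · rw [empirical_eq_map, empirical_eq_map, velocity_map_sub (hm x) (hm y) h₁]
      simp only [sub_self, Finset.sum_const_zero, sub_zero, norm_neg]
      refine norm_integral_le_of_bound fun j => (h₁.lip _ _).trans ?_
      refine mul_le_mul_of_nonneg_left ?_ hk
      rw [sub_sub_sub_cancel_left, norm_sub_rev]
      exact hxy j
    · have := isProbabilityMeasure_empirical hN y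
      refine (norm_velocity_sub_le h₁ h₂ _ _ _ _).trans ?_
      exact mul_le_mul_of_nonneg_left (hxy i) (by positivity)
  have h := norm_sub_le_of_trajectories (c := (2 + M) * k) (by positivity) hb le_rfl
    (fun t ht => hasDerivWithinAt_pi.2 fun i => hx.ode t ht i)
    (fun t ht => hasDerivWithinAt_pi.2 fun i => hy.ode t ht i) ht
  rw [hx.init, hy.init, sub_self, norm_zero, mul_zero] at h
  exact sub_eq_zero.1 (norm_le_zero_iff.1 h)

end

/-! ### Characteristics -/

section flow

variable {d : ℕ} {T c V : ℝ} {b : ℝ → Space d → Space d} {Q : ℝ → ℝ → Space d → Space d}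

theorem IsFlow.norm_sub_le (hQ : IsFlow T b Q) (hc : 0 ≤ c)
    (hb : ∀ t ∈ Icc 0 T, ∀ x y, ‖b t x - b t y‖ ≤ c * ‖x - y‖) {s t : ℝ} (hs : s ∈ Icc 0 T)
    (ht : t ∈ Icc s T) (x y : Space d) :
    ‖Q t s x - Q t s y‖ ≤ Real.exp (c * T) * ‖x - y‖ := by
  have h := norm_sub_le_of_trajectories (q := fun r => Q r s x) (r := fun r => Q r s y) hc hb hs.1
    (fun r hr => (hQ s hs x).2 r ⟨hs.1.trans hr.1, hr.2⟩)
    (fun r hr => (hQ s hs y).2 r ⟨hs.1.trans hr.1, hr.2⟩) ht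
  simpa only [(hQ s hs x).1, (hQ s hs y).1] using h

/-- A trajectory is recovered by the flow from any of its earlier positions. -/
theorem IsFlow.eq_of_trajectory (hQ : IsFlow T b Q) (hc : 0 ≤ c)
    (hb : ∀ t ∈ Icc 0 T, ∀ x y, ‖b t x - b t y‖ ≤ c * ‖x - y‖) {q : ℝ → Space d} {s : ℝ}
    (hs : s ∈ Icc 0 T) (hq : ∀ t ∈ Icc s T, HasDerivWithinAt q (b t (q t)) (Icc 0 T) t) {t : ℝ}
    (ht : t ∈ Icc s T) : Q t s (q s) = q t := by
  have h := norm_sub_le_of_trajectories (q := fun r => Q r s (q s)) (r := q) hc hb hs.1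
    (fun r hr => (hQ s hs _).2 r ⟨hs.1.trans hr.1, hr.2⟩) hq ht
  simp only [(hQ s hs (q s)).1, sub_self, norm_zero, mul_zero] at h
  exact sub_eq_zero.1 (norm_le_zero_iff.1 h)

theorem IsFlow.comp (hQ : IsFlow T b Q) (hc : 0 ≤ c)
    (hb : ∀ t ∈ Icc 0 T, ∀ x y, ‖b t x - b t y‖ ≤ c * ‖x - y‖) {r s t : ℝ} (hr : r ∈ Icc 0 T)
    (hs : s ∈ Icc r T) (ht : t ∈ Icc s T) (x : Space d) : Q t s (Q s r x) = Q t r x :=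
  hQ.eq_of_trajectory (q := fun a => Q a r x) hc hb ⟨hr.1.trans hs.1, hs.2⟩
    (fun a ha => (hQ r hr x).2 a ⟨hr.1.trans (hs.1.trans ha.1), ha.2⟩) ht

theorem IsFlow.displacement (hQ : IsFlow T b Q) (hV : ∀ t ∈ Icc 0 T, ∀ x, ‖b t x‖ ≤ V) {s t : ℝ}
    (hs : s ∈ Icc 0 T) (ht : t ∈ Icc 0 T) (x : Space d) : ‖Q t s x - x‖ ≤ V * |t - s| := by
  have h := norm_sub_le_of_hasDerivWithinAt_Icc (fun r hr => (hQ s hs x).2 r hr)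
    (fun r hr => hV r hr _) hs ht
  simpa only [(hQ s hs x).1] using h

end flow

theorem hasDerivWithinAt_integral_Icc {E : Type*} [NormedAddCommGroup E] [NormedSpace ℝ E]
    [CompleteSpace E] {T : ℝ} {f : ℝ → E} (hf : ContinuousOn f (Icc 0 T)) {t : ℝ}
    (ht : t ∈ Icc 0 T) :
    HasDerivWithinAt (fun s => ∫ r in (0 : ℝ)..s, f r) (f t) (Icc 0 T) t := by
  have hT : 0 ≤ T := ht.1.trans ht.2
  let F : ℝ → E := fun r => f (projIcc 0 T hT r)
  have hF : Continuous F := (continuousOn_iff_continuous_domRestrict.1 hf).comp continuous_projIcc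
  have hFf : ∀ r ∈ Icc 0 T, F r = f r := fun r hr => by simp only [F, projIcc_of_mem hT hr]
  have h := (intervalIntegral.integral_hasDerivAt_right (hF.intervalIntegrable 0 t)
    (hF.stronglyMeasurableAtFilter _ _) hF.continuousAt).hasDerivWithinAt (s := Icc 0 T)
  rw [hFf t ht] at h
  have e : ∀ s ∈ Icc 0 T, ∫ r in (0 : ℝ)..s, f r = ∫ r in (0 : ℝ)..s, F r := fun s hs =>
    intervalIntegral.integral_congr fun r hr => by
      rw [uIcc_of_le hs.1] at hr
      exact (hFf r ⟨hr.1, hr.2.trans hs.2⟩).symm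
  exact h.congr e (e t ht)

theorem hasDerivWithinAt_integral_Icc_left {E : Type*} [NormedAddCommGroup E] [NormedSpace ℝ E]
    [CompleteSpace E] {T : ℝ} {f : ℝ → E} (hf : ContinuousOn f (Icc 0 T)) {t : ℝ}
    (ht : t ∈ Icc 0 T) :
    HasDerivWithinAt (fun s => ∫ r in s..T, f r) (-f t) (Icc 0 T) t := by
  have hi : ∀ s ∈ Icc 0 T, IntervalIntegrable f volume 0 s := fun s hs =>
    ContinuousOn.intervalIntegrable (hf.mono (by
      rw [uIcc_of_le hs.1]; exact Icc_subset_Icc_right hs.2))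
  have e : ∀ s ∈ Icc 0 T, ∫ r in s..T, f r
      = (∫ r in (0 : ℝ)..T, f r) - ∫ r in (0 : ℝ)..s, f r := fun s hs =>
    (intervalIntegral.integral_interval_sub_left
      (hi T (right_mem_Icc.2 (ht.1.trans ht.2))) (hi s hs)).symm
  exact ((hasDerivWithinAt_integral_Icc hf ht).const_sub _).congr e (e t ht)

/-! ### Couplings -/

theorem sq_integral_le {Ω : Type*} [MeasurableSpace Ω] {P : Measure Ω} [IsProbabilityMeasure P]
    {f : Ω → ℝ} (hf : MemLp f 2 P) : (∫ η, f η ∂P) ^ 2 ≤ ∫ η, f η ^ 2 ∂P := by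
  have hi := hf.integrable (by norm_num)
  set c := ∫ η, f η ∂P with hc
  have h : 0 ≤ ∫ η, (f η ^ 2 - 2 * c * f η + c ^ 2) ∂P := integral_nonneg fun η => by
    have := sq_nonneg (f η - c)
    simp only [Pi.zero_apply]
    linarith
  rw [integral_add (f := fun η => f η ^ 2 - 2 * c * f η)
    (hf.integrable_sq.sub (hi.const_mul (2 * c))) (integrable_const _),
    integral_sub hf.integrable_sq (hi.const_mul (2 * c)), integral_const_mul, ← hc] at h
  simp only [integral_const, probReal_univ, smul_eq_mul, one_mul] at h
  linarith

section coupling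

variable {d : ℕ} {μ ν : Measure (Space d)} {π : Measure (Space d × Space d)}

theorem isProbabilityMeasure_of_mem_couplings [hμ : IsProbabilityMeasure μ]
    (hπ : π ∈ couplings μ ν) : IsProbabilityMeasure π := by
  refine ⟨?_⟩
  rw [← hμ.measure_univ, ← hπ.1, Measure.map_apply measurable_fst .univ, preimage_univ]

theorem IsP2.memLp_fst (hμ : IsP2 μ) (hπ : π ∈ couplings μ ν) :
    MemLp (fun z : Space d × Space d => z.1) 2 π := by
  have h := hμ.memLp
  rw [← hπ.1] at h
  exact (memLp_map_measure_iff aestronglyMeasurable_id measurable_fst.aemeasurable).1 h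

theorem IsP2.memLp_snd (hν : IsP2 ν) (hπ : π ∈ couplings μ ν) :
    MemLp (fun z : Space d × Space d => z.2) 2 π := by
  have h := hν.memLp
  rw [← hπ.2] at h
  exact (memLp_map_measure_iff aestronglyMeasurable_id measurable_snd.aemeasurable).1 h

/-- The transport cost of a coupling as a Bochner integral. -/
theorem integral_cost_eq (hμ : IsP2 μ) (hν : IsP2 ν) (hπ : π ∈ couplings μ ν) :
    ENNReal.ofReal (∫ z, ‖z.1 - z.2‖ ^ 2 ∂π) = ∫⁻ z, ‖z.1 - z.2‖ₑ ^ 2 ∂π := by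
  have hi : Integrable (fun z : Space d × Space d => ‖z.1 - z.2‖ ^ 2) π :=
    ((hμ.memLp_fst hπ).sub (hν.memLp_snd hπ)).norm.integrable_sq
  rw [ofReal_integral_eq_lintegral_ofReal hi (Eventually.of_forall fun _ => sq_nonneg _)]
  refine lintegral_congr fun z => ?_
  rw [ENNReal.ofReal_pow (norm_nonneg _), ofReal_norm]

theorem IsP2.integrable_of_lip (hμ : IsP2 μ) {E : Type*} [NormedAddCommGroup E]
    {F : Space d → E} {L : ℝ} (hF : ∀ x y, ‖F x - F y‖ ≤ L * ‖x - y‖) : Integrable F μ := by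
  have := hμ.prob
  have hi : Integrable (fun x : Space d => x) μ := hμ.memLp.integrable (by norm_num)
  refine ((hi.norm.const_mul L).add (integrable_const ‖F 0‖)).mono'
    (continuous_of_norm_sub_le hF).aestronglyMeasurable (Eventually.of_forall fun x => ?_)
  have h1 := hF x 0
  rw [sub_zero] at h1
  have h2 := norm_sub_norm_le (F x) (F 0)
  simp only [Pi.add_apply]
  linarith

theorem norm_integral_sub_le_of_coupling (hμ : IsP2 μ) (hν : IsP2 ν) (hπ : π ∈ couplings μ ν)
    {E : Type*} [NormedAddCommGroup E] [NormedSpace ℝ E] {F : Space d → E} {L : ℝ} (hL : 0 ≤ L)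
    (hF : ∀ x y, ‖F x - F y‖ ≤ L * ‖x - y‖) :
    ‖∫ x, F x ∂μ - ∫ x, F x ∂ν‖ ≤ L * √(∫ z, ‖z.1 - z.2‖ ^ 2 ∂π) := by
  have := hμ.prob
  have := isProbabilityMeasure_of_mem_couplings hπ
  have hm : MemLp (fun z : Space d × Space d => ‖z.1 - z.2‖) 2 π :=
    ((hμ.memLp_fst hπ).sub (hν.memLp_snd hπ)).norm
  have hFc := continuous_of_norm_sub_le hF
  have e1 : ∫ x, F x ∂μ = ∫ z, F z.1 ∂π := by
    rw [← hπ.1, integral_map measurable_fst.aemeasurable hFc.aestronglyMeasurable]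
  have e2 : ∫ x, F x ∂ν = ∫ z, F z.2 ∂π := by
    rw [← hπ.2, integral_map measurable_snd.aemeasurable hFc.aestronglyMeasurable]
  have i1 : Integrable (fun z : Space d × Space d => F z.1) π := by
    have h := hμ.integrable_of_lip hF
    rw [← hπ.1] at h
    exact h.comp_measurable measurable_fst
  have i2 : Integrable (fun z : Space d × Space d => F z.2) π := by
    have h := hν.integrable_of_lip hF
    rw [← hπ.2] at h
    exact h.comp_measurable measurable_snd
  rw [e1, e2, ← integral_sub i1 i2]
  calc ‖∫ z, (F z.1 - F z.2) ∂π‖ ≤ ∫ z, L * ‖z.1 - z.2‖ ∂π :=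
        norm_integral_le_of_norm_le ((hm.integrable (by norm_num)).const_mul L)
          (Eventually.of_forall fun z => hF _ _)
    _ = L * ∫ z, ‖z.1 - z.2‖ ∂π := integral_const_mul _ _
    _ ≤ _ := mul_le_mul_of_nonneg_left (Real.le_sqrt_of_sq_le (sq_integral_le hm)) hL

theorem IsP2Curve.eventually_norm_integral_sub_le {T : ℝ} {μ : ℝ → Measure (Space d)}
    (h : IsP2Curve T μ) {t : ℝ} (ht : t ∈ Icc 0 T) {δ : ℝ} (hδ : 0 < δ) (E : Type*)
    [NormedAddCommGroup E] [NormedSpace ℝ E] :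
    ∀ᶠ s in 𝓝[Icc 0 T] t, ∀ (F : Space d → E) (L : ℝ), 0 ≤ L →
      (∀ x y, ‖F x - F y‖ ≤ L * ‖x - y‖) → ‖∫ x, F x ∂(μ s) - ∫ x, F x ∂(μ t)‖ ≤ L * δ := by
  have hδ' : (0 : ℝ≥0∞) < ENNReal.ofReal (δ ^ 2) := by
    rw [ENNReal.ofReal_pos]; positivity
  filter_upwards [(h.continuous t ht).eventually_lt_const hδ', self_mem_nhdsWithin]
    with s hs hsI F L hL hF
  obtain ⟨π, hπ, hlt⟩ : ∃ π ∈ couplings (μ s) (μ t),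
      ∫⁻ z, ‖z.1 - z.2‖ₑ ^ 2 ∂π < ENNReal.ofReal (δ ^ 2) := by
    simpa only [W2sq, iInf_lt_iff, exists_prop] using hs
  refine (norm_integral_sub_le_of_coupling (h.isP2 s hsI) (h.isP2 t ht) hπ hL hF).trans
    (mul_le_mul_of_nonneg_left ?_ hL)
  rw [← integral_cost_eq (h.isP2 s hsI) (h.isP2 t ht) hπ] at hlt
  rw [Real.sqrt_le_left hδ.le]
  exact ((ENNReal.ofReal_lt_ofReal_iff (by positivity)).1 hlt).le

end coupling

/-! ### Weak solutions tested in space -/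

/-- A smooth compactly supported function of space whose derivative is bounded by `L` and
Lipschitz with constant `L'`. -/
structure IsSpaceTest {d : ℕ} (L L' : ℝ) (g : Space d → ℝ) : Prop where
  smooth : ContDiff ℝ ∞ g
  compact : HasCompactSupport g
  norm_fderiv_le : ∀ x, ‖fderiv ℝ g x‖ ≤ L
  lip_fderiv : ∀ x y, ‖fderiv ℝ g x - fderiv ℝ g y‖ ≤ L' * ‖x - y‖

section weak

variable {d M : ℕ} {k T : ℝ} {K₁ K₂ : Space d → Space d} {μ₀ : Measure (Space d)}
  {u : ℝ → ControlSpace d M} {μ : ℝ → Measure (Space d)}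

theorem IsSpaceTest.lip {L L' : ℝ} {g : Space d → ℝ} (hg : IsSpaceTest L L' g) (x y : Space d) :
    ‖g x - g y‖ ≤ L * ‖x - y‖ :=
  norm_sub_le_of_hasFDerivAt
    (fun x => (hg.smooth.differentiable (by norm_num) x).hasFDerivAt) hg.norm_fderiv_le x y

theorem IsSpaceTest.exists_of_smooth {g : Space d → ℝ} (hg : ContDiff ℝ ∞ g)
    (hc : HasCompactSupport g) : ∃ L L', 0 ≤ L ∧ 0 ≤ L' ∧ IsSpaceTest L L' g := by
  have hg' : ContDiff ℝ ∞ (fderiv ℝ g) := hg.fderiv_right (by norm_num)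
  obtain ⟨L, hL⟩ := hg'.continuous.bounded_above_of_compact_support (hc.fderiv (𝕜 := ℝ))
  obtain ⟨L', hL'⟩ := hg'.lipschitzWith_of_hasCompactSupport (hc.fderiv (𝕜 := ℝ)) (by norm_num)
  refine ⟨L, L', (norm_nonneg _).trans (hL 0), L'.2, hg, hc, hL, fun x y => ?_⟩
  rw [← dist_eq_norm, ← dist_eq_norm]
  exact hL'.dist_le_mul x y

theorem IsP2Curve.eventually_norm_velocity_sub_le (h : IsP2Curve T μ) (h₁ : KernelBound k K₁)
    (h₂ : KernelBound k K₂) (hu : ContinuousOn u (Icc 0 T)) {t : ℝ} (ht : t ∈ Icc 0 T) {δ : ℝ}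
    (hδ : 0 < δ) :
    ∀ᶠ s in 𝓝[Icc 0 T] t, ∀ x,
      ‖velocity K₁ K₂ (μ s) (u s) x - velocity K₁ K₂ (μ t) (u t) x‖ ≤ δ := by
  have hk := h₁.nonneg
  have hlim : Tendsto (fun s => M * k * ‖u s - u t‖) (𝓝[Icc 0 T] t) (𝓝 0) := by
    have := ((hu t ht).sub (continuousWithinAt_const (b := u t))).norm.const_mul (M * k)
    simpa [ContinuousWithinAt] using this
  have hδ' : 0 < δ / 2 / (k + 1) := by positivity
  filter_upwards [h.eventually_norm_integral_sub_le ht hδ' (Space d),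
    hlim.eventually_lt_const (half_pos hδ), self_mem_nhdsWithin] with s hs hs' hsI x
  have := (h.isP2 s hsI).prob
  have := (h.isP2 t ht).prob
  have e : velocity K₁ K₂ (μ s) (u s) x - velocity K₁ K₂ (μ t) (u t) x
      = (velocity K₁ K₂ (μ s) (u s) x - velocity K₁ K₂ (μ s) (u t) x)
        - (∫ y, K₁ (x - y) ∂(μ s) - ∫ y, K₁ (x - y) ∂(μ t)) := by
    simp only [velocity]; abel
  have h3 := hs (fun y => K₁ (x - y)) k hk fun y z => (h₁.lip _ _).trans_eq (by
    rw [sub_sub_sub_cancel_left, norm_sub_rev])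
  have h4 : k * (δ / 2 / (k + 1)) ≤ δ / 2 := by
    rw [mul_div_assoc', div_le_iff₀ (by positivity)]
    nlinarith
  rw [e]
  have h5 := norm_sub_le_of_le
    ((norm_velocity_control_sub_le (K₁ := K₁) h₂ (μ s) (u t) (u s) x).trans hs'.le) (h3.trans h4)
  linarith

theorem norm_fderiv_velocity_sub_le {L L' : ℝ} {g : Space d → ℝ} (hg : IsSpaceTest L L' g)
    (hL' : 0 ≤ L') {c : ℝ} {b : Space d → Space d} (hbc : ∀ x, ‖b x‖ ≤ c)
    (hb : ∀ x y, ‖b x - b y‖ ≤ c * ‖x - y‖) (x y : Space d) :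
    ‖fderiv ℝ g x (b x) - fderiv ℝ g y (b y)‖ ≤ (L + L') * c * ‖x - y‖ := by
  have hL : 0 ≤ L := (norm_nonneg _).trans (hg.norm_fderiv_le 0)
  have e : fderiv ℝ g x (b x) - fderiv ℝ g y (b y)
      = fderiv ℝ g x (b x - b y) + (fderiv ℝ g x - fderiv ℝ g y) (b y) := by
    simp
  rw [e]
  refine (norm_add_le_of_le (?_ : _ ≤ L * (c * ‖x - y‖))
    (?_ : _ ≤ L' * ‖x - y‖ * c)).trans_eq (by ring)
  · exact (ContinuousLinearMap.le_opNorm _ _).trans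
      (mul_le_mul (hg.norm_fderiv_le x) (hb x y) (norm_nonneg _) hL)
  · exact (ContinuousLinearMap.le_opNorm _ _).trans
      (mul_le_mul (hg.lip_fderiv x y) (hbc y) (norm_nonneg _) (by positivity))

theorem integral_fderiv_velocity_sub_le {L L' δ : ℝ} {g : Space d → ℝ} (hg : IsSpaceTest L L' g)
    (hL' : 0 ≤ L') {c : ℝ} (hc : 0 ≤ c) {b b' : Space d → Space d} (hbc : ∀ x, ‖b x‖ ≤ c)
    (hb : ∀ x y, ‖b x - b y‖ ≤ c * ‖x - y‖)
    (hb' : ∀ x y, ‖b' x - b' y‖ ≤ c * ‖x - y‖) (hbc' : ∀ x, ‖b' x‖ ≤ c)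
    (hδ : ∀ x, ‖b' x - b x‖ ≤ δ) {μ ν : Measure (Space d)} (hν : IsP2 ν)
    (hμν : ∀ (F : Space d → ℝ) (L : ℝ), 0 ≤ L →
      (∀ x y, ‖F x - F y‖ ≤ L * ‖x - y‖) → ‖∫ x, F x ∂ν - ∫ x, F x ∂μ‖ ≤ L * δ) :
    ‖∫ x, fderiv ℝ g x (b' x) ∂ν - ∫ x, fderiv ℝ g x (b x) ∂μ‖ ≤ (L + (L + L') * c) * δ := by
  have hL : 0 ≤ L := (norm_nonneg _).trans (hg.norm_fderiv_le 0)
  have := hν.prob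
  have i1 := hν.integrable_of_lip (norm_fderiv_velocity_sub_le hg hL' hbc' hb')
  have i2 := hν.integrable_of_lip (norm_fderiv_velocity_sub_le hg hL' hbc hb)
  have e : ∫ x, fderiv ℝ g x (b' x) ∂ν - ∫ x, fderiv ℝ g x (b x) ∂μ
      = ∫ x, (fderiv ℝ g x (b' x) - fderiv ℝ g x (b x)) ∂ν
        + (∫ x, fderiv ℝ g x (b x) ∂ν - ∫ x, fderiv ℝ g x (b x) ∂μ) := by
    rw [integral_sub i1 i2]; abel
  rw [e]
  refine (norm_add_le_of_le (?_ : _ ≤ L * δ) (hμν _ ((L + L') * c) (by positivity)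
    (norm_fderiv_velocity_sub_le hg hL' hbc hb))).trans_eq (by ring)
  refine norm_integral_le_of_bound fun x => ?_
  rw [← map_sub]
  exact (ContinuousLinearMap.le_opNorm _ _).trans
    (mul_le_mul (hg.norm_fderiv_le x) (hδ x) (norm_nonneg _) hL)

/-- The rate of change `∫ ∇g · v(μ_t,u_t) dμ_t` of `∫ g dμ_t`. -/
noncomputable def testRate (K₁ K₂ : Space d → Space d) (u : ℝ → ControlSpace d M)
    (μ : ℝ → Measure (Space d)) (g : Space d → ℝ) (t : ℝ) : ℝ :=
  ∫ x, fderiv ℝ g x (velocity K₁ K₂ (μ t) (u t) x) ∂(μ t)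

theorem IsP2Curve.eventually_testRate (h : IsP2Curve T μ) (h₁ : KernelBound k K₁)
    (h₂ : KernelBound k K₂) (hu : ContinuousOn u (Icc 0 T)) {t : ℝ} (ht : t ∈ Icc 0 T) {δ : ℝ}
    (hδ : 0 < δ) :
    ∀ᶠ s in 𝓝[Icc 0 T] t, ∀ (g : Space d → ℝ) (L L' : ℝ), 0 ≤ L' → IsSpaceTest L L' g →
      ‖testRate K₁ K₂ u μ g s - testRate K₁ K₂ u μ g t‖
        ≤ (L + (L + L') * ((1 + M) * k)) * δ := by
  have hk := h₁.nonneg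
  filter_upwards [h.eventually_norm_integral_sub_le ht hδ ℝ,
    h.eventually_norm_velocity_sub_le h₁ h₂ hu ht hδ, self_mem_nhdsWithin]
    with s hs hs' hsI g L L' hL' hg
  have := (h.isP2 s hsI).prob
  have := (h.isP2 t ht).prob
  exact integral_fderiv_velocity_sub_le hg hL' (by positivity)
    (fun x => norm_velocity_le h₁ h₂ _ _ x)
    (norm_velocity_sub_le h₁ h₂ _ _) (norm_velocity_sub_le h₁ h₂ _ _)
    (fun x => norm_velocity_le h₁ h₂ _ _ x) hs' (h.isP2 s hsI) hs

theorem IsP2Curve.continuousOn_testRate (h : IsP2Curve T μ) (h₁ : KernelBound k K₁)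
    (h₂ : KernelBound k K₂) (hu : ContinuousOn u (Icc 0 T)) {L L' : ℝ} (hL' : 0 ≤ L')
    {g : Space d → ℝ} (hg : IsSpaceTest L L' g) :
    ContinuousOn (testRate K₁ K₂ u μ g) (Icc 0 T) := by
  intro t ht
  have hk := h₁.nonneg
  have hL : 0 ≤ L := (norm_nonneg _).trans (hg.norm_fderiv_le 0)
  refine Metric.tendsto_nhds.2 fun ε hε => ?_
  set A := L + (L + L') * ((1 + M) * k) with hA
  have hA0 : 0 ≤ A := by positivity
  filter_upwards [h.eventually_testRate h₁ h₂ hu ht (δ := ε / (A + 1)) (by positivity)] with s hs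
  rw [dist_eq_norm]
  refine (hs g L L' hL' hg).trans_lt ?_
  rw [← hA, mul_div_assoc', div_lt_iff₀ (by positivity)]
  nlinarith

theorem IsP2Curve.continuousOn_integral (h : IsP2Curve T μ) {L : ℝ} (hL : 0 ≤ L)
    {g : Space d → ℝ} (hg : ∀ x y, ‖g x - g y‖ ≤ L * ‖x - y‖) :
    ContinuousOn (fun t => ∫ x, g x ∂(μ t)) (Icc 0 T) := by
  intro t ht
  refine Metric.tendsto_nhds.2 fun ε hε => ?_
  filter_upwards [h.eventually_norm_integral_sub_le ht (δ := ε / (L + 1)) (by positivity) ℝ]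
    with s hs
  rw [dist_eq_norm]
  refine (hs g L hL hg).trans_lt ?_
  rw [mul_div_assoc', div_lt_iff₀ (by positivity)]
  nlinarith

/-- A smooth function of time whose support is compact in `(0,T)` has a primitive vanishing near
`T` and, after a cut-off at negative times, of compact support. -/
theorem exists_time_cutoff (hT : 0 < T) {η : ℝ → ℝ} (hη : ContDiff ℝ ∞ η)
    (hs : tsupport η ⊆ Ioo 0 T) : ∃ θ : ℝ → ℝ, ContDiff ℝ ∞ θ ∧ HasCompactSupport θ ∧
      tsupport θ ⊆ Iio T ∧ (∀ t ∈ Icc 0 T, HasDerivAt θ (η t) t) ∧ θ T = 0 ∧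
      θ 0 = -∫ t in (0 : ℝ)..T, η t := by
  let χ : ℝ → ℝ := fun t => ∫ s in T..t, η s
  have hχd : ∀ t, HasDerivAt χ (η t) t := fun t =>
    intervalIntegral.integral_hasDerivAt_right (hη.continuous.intervalIntegrable _ _)
      (hη.continuous.stronglyMeasurableAtFilter _ _) hη.continuous.continuousAt
  have hχ : ContDiff ℝ ∞ χ := by
    refine contDiff_infty_iff_deriv.2 ⟨fun t => (hχd t).differentiableAt, ?_⟩
    rwa [show deriv χ = η from funext fun t => (hχd t).deriv]
  obtain ⟨ε, hε, hεη⟩ : ∃ ε > 0, ∀ t, T - ε < t → η t = 0 := by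
    have hTn : T ∉ tsupport η := fun h => lt_irrefl T (hs h).2
    obtain ⟨ε, hε, hb⟩ := Metric.isOpen_iff.1 (isClosed_tsupport η).isOpen_compl T hTn
    refine ⟨ε, hε, fun t ht => ?_⟩
    by_cases hTt : t < T
    · refine image_eq_zero_of_notMem_tsupport (hb ?_)
      rw [Metric.mem_ball, Real.dist_eq, abs_lt]
      constructor <;> linarith
    · exact image_eq_zero_of_notMem_tsupport fun h => hTt (hs h).2
  have hχ0 : ∀ t, T - ε < t → χ t = 0 := fun t ht => by
    refine intervalIntegral.integral_zero_ae (Eventually.of_forall fun s hs' => hεη s ?_)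
    rw [mem_uIoc] at hs'
    rcases hs' with h | h <;> linarith [h.1]
  let ρ : ContDiffBump (0 : ℝ) := ⟨T + 1, T + 2, by linarith, by linarith⟩
  have hρ : ∀ t ∈ Icc 0 T, ρ =ᶠ[𝓝 t] fun _ => (1 : ℝ) := fun t ht => by
    have hmem : t ∈ Metric.ball (0 : ℝ) (T + 1) := by
      rw [Metric.mem_ball, Real.dist_eq, sub_zero, abs_of_nonneg ht.1]; linarith [ht.2]
    filter_upwards [Metric.isOpen_ball.mem_nhds hmem] with s hs
    exact ρ.one_of_mem_closedBall (Metric.ball_subset_closedBall hs)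
  have hρ1 : ∀ t ∈ Icc 0 T, ρ t = 1 := fun t ht => (hρ t ht).self_of_nhds
  refine ⟨fun t => ρ t * χ t, ρ.contDiff.mul hχ, ρ.hasCompactSupport.mul_right, ?_,
    fun t ht => ?_, ?_, ?_⟩
  · have : Function.support (fun t => ρ t * χ t) ⊆ Iic (T - ε) := fun t ht => by
      by_contra hlt
      exact ht (by simp only [hχ0 t (not_le.1 hlt), mul_zero])
    exact (closure_minimal this isClosed_Iic).trans fun t ht => by
      simp only [mem_Iic] at ht
      simp only [mem_Iio]
      linarith
  · refine (hχd t).congr_of_eventuallyEq ?_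
    filter_upwards [hρ t ht] with s hs
    rw [hs, one_mul]
  · simp only [hχ0 T (by linarith), mul_zero]
  · simp only [hρ1 0 (left_mem_Icc.2 hT.le), one_mul]
    exact intervalIntegral.integral_symm _ _

/-- In integrated form, `d/dt ∫ g dμ_t = ∫ ∇g · v(μ_t,u_t) dμ_t`. -/
theorem IsWeakSolution.integral_eq (hT : 0 < T) (h : IsWeakSolution T K₁ K₂ μ₀ u μ)
    (h₁ : KernelBound k K₁) (h₂ : KernelBound k K₂) (hu : ContinuousOn u (Icc 0 T)) {L L' : ℝ}
    (hL' : 0 ≤ L') {g : Space d → ℝ} (hg : IsSpaceTest L L' g) :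
    ∀ t ∈ Icc 0 T, ∫ x, g x ∂(μ t) = ∫ x, g x ∂μ₀ + ∫ s in (0 : ℝ)..t, testRate K₁ K₂ u μ g s := by
  have hk := h₁.nonneg
  have hL : 0 ≤ L := (norm_nonneg _).trans (hg.norm_fderiv_le 0)
  have hA := h.curve.continuousOn_integral hL hg.lip
  have hB := h.curve.continuousOn_testRate h₁ h₂ hu hL' hg
  have hIB : ∀ t ∈ Icc 0 T, HasDerivWithinAt (fun t => ∫ s in (0 : ℝ)..t, testRate K₁ K₂ u μ g s)
      (testRate K₁ K₂ u μ g t) (Icc 0 T) t := fun t ht => hasDerivWithinAt_integral_Icc hB ht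
  set A₀ := ∫ x, g x ∂μ₀
  let r : ℝ → ℝ := fun t => ∫ x, g x ∂(μ t) - (A₀ + ∫ s in (0 : ℝ)..t, testRate K₁ K₂ u μ g s)
  have hr : ContinuousOn r (Icc 0 T) :=
    hA.sub (continuousOn_const.add fun t ht => (hIB t ht).continuousWithinAt)
  have key : ∀ η : ℝ → ℝ, ContDiff ℝ ∞ η → HasCompactSupport η → tsupport η ⊆ Ioo 0 T →
      ∫ t, η t • r t = 0 := by
    intro η hη _ hs
    obtain ⟨θ, hθ, hθc, hθs, hθd, hθT, hθ0⟩ := exists_time_cutoff hT hη hs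
    have hηc := hη.continuous.continuousOn (s := Icc 0 T)
    have htest : IsTestFunction T (fun p : ℝ × Space d => θ p.1 * g p.2) := by
      have hsub : tsupport (fun p : ℝ × Space d => θ p.1 * g p.2) ⊆ tsupport θ ×ˢ tsupport g := by
        refine closure_minimal (fun p hp => ?_)
          ((isClosed_tsupport θ).prod (isClosed_tsupport g))
        exact ⟨subset_tsupport θ (left_ne_zero_of_mul hp),
          subset_tsupport g (right_ne_zero_of_mul hp)⟩
      refine ⟨(hθ.comp contDiff_fst).mul (hg.smooth.comp contDiff_snd), ?_, ?_⟩
      · exact (hθc.isCompact.prod hg.compact.isCompact).of_isClosed_subset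
          (isClosed_tsupport _) hsub
      · exact hsub.trans (prod_mono hθs (subset_univ _))
    have hweak := h.weak _ htest
    have hinner : ∀ t ∈ Icc 0 T,
        ∫ x, fderiv ℝ (fun p : ℝ × Space d => θ p.1 * g p.2) (t, x)
          (1, velocity K₁ K₂ (μ t) (u t) x) ∂(μ t)
        = η t * ∫ x, g x ∂(μ t) + θ t * testRate K₁ K₂ u μ g t := by
      intro t ht
      have := (h.curve.isP2 t ht).prob
      have hd : ∀ x v, fderiv ℝ (fun p : ℝ × Space d => θ p.1 * g p.2) (t, x) (1, v)
          = η t * g x + θ t * fderiv ℝ g x v := by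
        intro x v
        have e1 : HasFDerivAt (fun p : ℝ × Space d => θ p.1) _ (t, x) :=
          ((hθd t ht).hasFDerivAt).comp (t, x) hasFDerivAt_fst
        have e2 : HasFDerivAt (fun p : ℝ × Space d => g p.2) _ (t, x) :=
          ((hg.smooth.differentiable (by norm_num) x).hasFDerivAt).comp (t, x) hasFDerivAt_snd
        have e3 : HasFDerivAt (fun p : ℝ × Space d => θ p.1 * g p.2) _ (t, x) := e1.mul e2
        rw [e3.fderiv]
        simp
        ring
      simp only [hd]
      rw [integral_add (((h.curve.isP2 t ht).integrable_of_lip hg.lip).const_mul _)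
        (((h.curve.isP2 t ht).integrable_of_lip (norm_fderiv_velocity_sub_le hg hL'
          (fun x => norm_velocity_le h₁ h₂ _ _ x)
          (norm_velocity_sub_le h₁ h₂ _ _))).const_mul _), integral_const_mul, integral_const_mul]
      rfl
    have e1 : (∫ t in (0 : ℝ)..T, (η t * ∫ x, g x ∂(μ t) + θ t * testRate K₁ K₂ u μ g t))
        - (∫ t in (0 : ℝ)..T, η t) * A₀ = 0 := by
      refine Eq.trans ?_ hweak
      simp only [integral_const_mul, hθ0]
      rw [neg_mul, ← sub_eq_add_neg]
      refine congrArg (fun z : ℝ => z - _)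
        (intervalIntegral.integral_congr fun t ht => (hinner t ?_).symm)
      rwa [uIcc_of_le hT.le] at ht
    have hθc' := hθ.continuous.continuousOn (s := Icc 0 T)
    have hIBc : ContinuousOn (fun t => ∫ s in (0 : ℝ)..t, testRate K₁ K₂ u μ g s) (Icc 0 T) :=
      fun t ht => (hIB t ht).continuousWithinAt
    have e2 : ∫ t in (0 : ℝ)..T, (η t * (∫ s in (0 : ℝ)..t, testRate K₁ K₂ u μ g s)
        + θ t * testRate K₁ K₂ u μ g t) = 0 := by
      rw [integral_eq_sub_of_hasDerivWithinAt_Icc hT.le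
        (fun t ht => ((hθd t ht).hasDerivWithinAt.mul (hIB t ht)))
        ((hηc.mul hIBc).add (hθc'.mul hB))]
      simp [hθT]
    have hii : ∀ {f : ℝ → ℝ}, ContinuousOn f (Icc 0 T) → IntervalIntegrable f volume 0 T :=
      fun hf => ContinuousOn.intervalIntegrable (by rwa [uIcc_of_le hT.le])
    have hf₁ : ContinuousOn (fun t => η t * ∫ x, g x ∂(μ t) + θ t * testRate K₁ K₂ u μ g t)
        (Icc 0 T) := (hηc.mul hA).add (hθc'.mul hB)
    have hf₂ : ContinuousOn (fun t => η t * (∫ s in (0 : ℝ)..t, testRate K₁ K₂ u μ g s)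
        + θ t * testRate K₁ K₂ u μ g t) (Icc 0 T) := (hηc.mul hIBc).add (hθc'.mul hB)
    have hf₃ : ContinuousOn (fun t => η t * A₀) (Icc 0 T) := hηc.mul continuousOn_const
    have e3 : ∫ t in (0 : ℝ)..T, η t * r t = 0 := by
      rw [← intervalIntegral.integral_mul_const,
        ← intervalIntegral.integral_sub (hii hf₁) (hii hf₃)] at e1
      refine Eq.trans ?_ (sub_eq_zero.2 (e1.trans e2.symm))
      have hf₄ : ContinuousOn (fun t => η t * ∫ x, g x ∂(μ t) + θ t * testRate K₁ K₂ u μ g t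
        - η t * A₀) (Icc 0 T) := hf₁.sub hf₃
      rw [← intervalIntegral.integral_sub (hii hf₄) (hii hf₂)]
      refine intervalIntegral.integral_congr fun t _ => ?_
      simp only [r]
      ring
    rw [← e3, intervalIntegral.integral_of_le hT.le]
    refine (setIntegral_eq_integral_of_forall_compl_eq_zero fun t ht => ?_).symm
    rw [image_eq_zero_of_notMem_tsupport fun hmem => ht (Ioo_subset_Ioc_self (hs hmem)), zero_smul]
  have hae := isOpen_Ioo.ae_eq_zero_of_integral_contDiff_smul_eq_zero (U := Ioo 0 T) (f := r)
    (μ := volume) ((hr.mono Ioo_subset_Icc_self).locallyIntegrableOn measurableSet_Ioo) key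
  have hae' : r =ᵐ[volume.restrict (Icc 0 T)] fun _ => 0 := by
    rw [← restrict_Ioo_eq_restrict_Icc]
    exact (ae_restrict_iff' measurableSet_Ioo).2 hae
  have := Measure.eqOn_Icc_of_ae_eq volume hT.ne hae' hr continuousOn_const
  exact fun t ht => sub_eq_zero.1 (this ht)

end weak

/-! ### Mollification -/

section mollify

variable {d : ℕ}

/-- The convolution of `φ` with the normalized bump function `ρ`. -/
noncomputable def mollify (ρ : ContDiffBump (0 : Space d)) (φ : Space d → ℝ) (x : Space d) : ℝ :=
  ∫ z, ρ.normed volume z * φ (x - z)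

variable {ρ : ContDiffBump (0 : Space d)} {φ : Space d → ℝ}

theorem integrable_mollify (hφ : Continuous φ) (x : Space d) :
    Integrable fun z => ρ.normed volume z * φ (x - z) :=
  (ρ.continuous_normed.mul (hφ.comp (continuous_const.sub continuous_id))).integrable_of_hasCompactSupport
    ρ.hasCompactSupport_normed.mul_right

theorem norm_mollify_sub_le {φ' : Space d → ℝ} (hφ : Continuous φ) (hφ' : Continuous φ') {C : ℝ}
    {x x' : Space d} (h : ∀ z, ‖z‖ ≤ ρ.rOut → ‖φ (x - z) - φ' (x' - z)‖ ≤ C) :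
    ‖mollify ρ φ x - mollify ρ φ' x'‖ ≤ C := by
  unfold mollify
  rw [← integral_sub (integrable_mollify hφ x) (integrable_mollify hφ' x')]
  have hb : ∀ z, ‖ρ.normed volume z * φ (x - z) - ρ.normed volume z * φ' (x' - z)‖
      ≤ ρ.normed volume z * C := fun z => by
    rw [← mul_sub, norm_mul, Real.norm_of_nonneg (ρ.nonneg_normed z)]
    by_cases hz : ‖z‖ ≤ ρ.rOut
    · exact mul_le_mul_of_nonneg_left (h z hz) (ρ.nonneg_normed z)
    · have : ρ.normed volume z = 0 := by
        have h0 : z ∉ Function.support (ρ.normed volume) := by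
          rw [ρ.support_normed_eq, Metric.mem_ball, dist_zero_right]
          exact fun h => hz h.le
        exact Function.notMem_support.1 h0
      rw [this, zero_mul, zero_mul]
  refine (norm_integral_le_of_norm_le (ρ.integrable_normed.mul_const C)
    (Eventually.of_forall hb)).trans_eq ?_
  rw [integral_mul_const, ρ.integral_normed, one_mul]

theorem norm_mollify_sub_self_le (hφ : Continuous φ) {C : ℝ} {x : Space d}
    (h : ∀ z, ‖z‖ ≤ ρ.rOut → ‖φ (x - z) - φ x‖ ≤ C) : ‖mollify ρ φ x - φ x‖ ≤ C := by
  have e : mollify ρ (fun _ => φ x) x = φ x := by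
    unfold mollify
    rw [integral_mul_const, ρ.integral_normed, one_mul]
  have := norm_mollify_sub_le (ρ := ρ) (x := x) (x' := x) hφ (continuous_const (y := φ x)) h
  rwa [e] at this

open ContinuousLinearMap in
/-- Mollifying a Lipschitz function gives a test function whose derivative is Lipschitz with a
constant depending only on the bump and on the Lipschitz constant. -/
theorem isSpaceTest_mollify (ρ : ContDiffBump (0 : Space d)) : ∃ C, 0 ≤ C ∧
    ∀ (φ : Space d → ℝ) (L : ℝ), 0 ≤ L → (∀ x y, ‖φ x - φ y‖ ≤ L * ‖x - y‖) →
      HasCompactSupport φ → IsSpaceTest L (C * L) (mollify ρ φ) := by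
  refine ⟨∫ z, ‖fderiv ℝ (ρ.normed volume) z‖, integral_nonneg fun _ => norm_nonneg _,
    fun φ L hL hlip hc => ?_⟩
  have hφ := continuous_of_norm_sub_le hlip
  have hρ : ContDiff ℝ ∞ (ρ.normed volume) := ρ.contDiff_normed
  have hρ1 : ContDiff ℝ 1 (ρ.normed volume) := ρ.contDiff_normed
  have e : mollify ρ φ = MeasureTheory.convolution (ρ.normed volume) φ (lsmul ℝ ℝ) volume := rfl
  have hd : ∀ x, HasFDerivAt (mollify ρ φ)
      (∫ z, (lsmul ℝ ℝ).precompL (Space d) (fderiv ℝ (ρ.normed volume) z) (φ (x - z))) x :=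
    ρ.hasCompactSupport_normed.hasFDerivAt_convolution_left (lsmul ℝ ℝ) hρ1 hφ.locallyIntegrable
  have hval : ∀ (A : Space d →L[ℝ] ℝ) (r : ℝ), (lsmul ℝ ℝ).precompL (Space d) A r = r • A :=
    fun A r => by ext v; simp [mul_comm]
  simp only [hval] at hd
  have hmlip : ∀ x y, ‖mollify ρ φ x - mollify ρ φ y‖ ≤ L * ‖x - y‖ := fun x y =>
    norm_mollify_sub_le hφ hφ fun z _ => (hlip _ _).trans_eq (by rw [sub_sub_sub_cancel_right])
  have hdc : Continuous (fderiv ℝ (ρ.normed volume)) := hρ1.continuous_fderiv (by norm_num)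
  have hdcs : HasCompactSupport (fderiv ℝ (ρ.normed volume)) :=
    ρ.hasCompactSupport_normed.fderiv (𝕜 := ℝ)
  refine ⟨e ▸ ρ.hasCompactSupport_normed.contDiff_convolution_left _ hρ hφ.locallyIntegrable,
    e ▸ ρ.hasCompactSupport_normed.convolution _ hc, fun x => ?_, fun x y => ?_⟩
  · have hl : LipschitzWith L.toNNReal (mollify ρ φ) := LipschitzWith.of_dist_le_mul fun x y => by
      rw [Real.coe_toNNReal _ hL, dist_eq_norm, dist_eq_norm]
      exact hmlip x y
    simpa [hL] using norm_fderiv_le_of_lipschitz ℝ hl (x₀ := x)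
  · have hi : ∀ x, Integrable fun z => φ (x - z) • fderiv ℝ (ρ.normed volume) z := fun x =>
      ((hφ.comp (continuous_const.sub continuous_id)).smul hdc).integrable_of_hasCompactSupport
        hdcs.smul_left
    rw [(hd x).fderiv, (hd y).fderiv, ← integral_sub (hi x) (hi y)]
    have hb : ∀ z, ‖φ (x - z) • fderiv ℝ (ρ.normed volume) z
        - φ (y - z) • fderiv ℝ (ρ.normed volume) z‖
        ≤ ‖fderiv ℝ (ρ.normed volume) z‖ * (L * ‖x - y‖) := fun z => by
      rw [← sub_smul, norm_smul, mul_comm]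
      refine mul_le_mul_of_nonneg_left ?_ (norm_nonneg _)
      exact (hlip _ _).trans_eq (by rw [sub_sub_sub_cancel_right])
    refine (norm_integral_le_of_norm_le ((hdc.norm.integrable_of_hasCompactSupport
      hdcs.norm).mul_const _) (Eventually.of_forall hb)).trans_eq ?_
    rw [integral_mul_const, mul_assoc]

end mollify

/-! ### Weak solutions are transported by the flow -/

theorem norm_sub_le_of_slope_le {f : ℝ → ℝ} {a τ : ℝ} (hτ : 0 ≤ τ)
    (hf : ContinuousOn f (Icc 0 τ))
    (h : ∀ t ∈ Ico 0 τ, ∀ κ > 0, ∀ᶠ s in 𝓝[>] t, ‖f s - f t‖ ≤ (s - t) * (a + κ)) :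
    ‖f τ - f 0‖ ≤ a * τ := by
  have key : ∀ κ > 0, ‖f τ - f 0‖ ≤ (a + κ) * τ := fun κ hκ => by
    refine image_norm_le_of_liminf_right_slope_norm_lt_deriv_boundary (f := fun t => f t - f 0)
      (f' := fun _ => a) (B := fun t => (a + κ) * t) (B' := fun _ => a + κ) (a := 0) (b := τ)
      (hf.sub continuousOn_const) (fun t ht r hr => ?_) (by simp) (by fun_prop)
      (fun t _ => by simpa using ((hasDerivAt_id t).const_mul (a + κ)).hasDerivWithinAt)
      (fun t _ _ => by linarith) (right_mem_Icc.2 hτ)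
    refine Eventually.frequently ?_
    filter_upwards [h t ht ((r - a) / 2) (by linarith), self_mem_nhdsWithin] with s hs hst
    have hst' : 0 < s - t := sub_pos.2 hst
    rw [slope_def_field, div_lt_iff₀ hst']
    have h1 := norm_sub_norm_le (f s - f 0) (f t - f 0)
    rw [sub_sub_sub_cancel_right] at h1
    simp only [Function.comp]
    nlinarith
  have hlim : Tendsto (fun κ : ℝ => (a + κ) * τ) (𝓝[>] 0) (𝓝 (a * τ)) := by
    have : Continuous fun κ : ℝ => (a + κ) * τ := by fun_prop
    simpa using (this.tendsto 0).mono_left nhdsWithin_le_nhds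
  exact ge_of_tendsto hlim (by filter_upwards [self_mem_nhdsWithin] with κ hκ using key κ hκ)

section transport

variable {d M : ℕ} {k T c : ℝ} {K₁ K₂ : Space d → Space d} {μ₀ : Measure (Space d)}
  {u : ℝ → ControlSpace d M} {μ : ℝ → Measure (Space d)} {b : ℝ → Space d → Space d}
  {Q : ℝ → ℝ → Space d → Space d}

theorem norm_test_flow_sub_le (hQ : IsFlow T b Q) {L L' δ : ℝ} (hc : 0 ≤ c) (hL' : 0 ≤ L')
    (hbc : ∀ t ∈ Icc 0 T, ∀ x, ‖b t x‖ ≤ c)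
    (hb : ∀ t ∈ Icc 0 T, ∀ x y, ‖b t x - b t y‖ ≤ c * ‖x - y‖) {g : Space d → ℝ}
    (hg : IsSpaceTest L L' g) {s t : ℝ} (hs : s ∈ Icc 0 T) (ht : t ∈ Icc s T)
    (hδ : ∀ r ∈ Icc s t, ∀ x, ‖b r x - b s x‖ ≤ δ) (hst : t - s ≤ δ) (x : Space d) :
    ‖g (Q t s x) - g x - (t - s) * fderiv ℝ g x (b s x)‖
      ≤ (t - s) * ((L + (L + L') * c * c) * δ) := by
  have hL : 0 ≤ L := (norm_nonneg _).trans (hg.norm_fderiv_le 0)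
  have hsub : Icc s t ⊆ Icc 0 T := Icc_subset_Icc hs.1 ht.2
  have hd : ∀ r ∈ Icc s t, HasDerivWithinAt
      (fun r => g (Q r s x) - (r - s) * fderiv ℝ g x (b s x))
      (fderiv ℝ g (Q r s x) (b r (Q r s x)) - 1 * fderiv ℝ g x (b s x)) (Icc s t) r := by
    intro r hr
    have h1 : HasDerivWithinAt (fun r => g (Q r s x)) _ (Icc s t) r :=
      (hg.smooth.differentiable (by norm_num) (Q r s x)).hasFDerivAt.comp_hasDerivWithinAt r
        (((hQ s hs x).2 r (hsub hr)).mono hsub)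
    exact h1.sub (((hasDerivWithinAt_id r _).sub_const s).mul_const _)
  have hbd : ∀ r ∈ Icc s t, ‖fderiv ℝ g (Q r s x) (b r (Q r s x)) - 1 * fderiv ℝ g x (b s x)‖
      ≤ (L + (L + L') * c * c) * δ := by
    intro r hr
    have e : fderiv ℝ g (Q r s x) (b r (Q r s x)) - 1 * fderiv ℝ g x (b s x)
        = (fderiv ℝ g (Q r s x) (b r (Q r s x)) - fderiv ℝ g x (b r x))
          + fderiv ℝ g x (b r x - b s x) := by
      rw [map_sub]; ring
    rw [e]
    refine (norm_add_le_of_le (?_ : _ ≤ (L + L') * c * (c * δ))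
      (?_ : _ ≤ L * δ)).trans_eq (by ring)
    · refine (norm_fderiv_velocity_sub_le hg hL' (hbc r (hsub hr)) (hb r (hsub hr)) _ _).trans ?_
      refine mul_le_mul_of_nonneg_left ?_ (by positivity)
      refine (hQ.displacement hbc hs (hsub hr) x).trans (mul_le_mul_of_nonneg_left ?_ hc)
      rw [abs_of_nonneg (sub_nonneg.2 hr.1)]
      linarith [hr.2]
    · exact (ContinuousLinearMap.le_opNorm _ _).trans
        (mul_le_mul (hg.norm_fderiv_le x) (hδ r hr x) (norm_nonneg _) hL)
  have h := (convex_Icc s t).norm_image_sub_le_of_norm_hasDerivWithin_le hd hbd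
    (left_mem_Icc.2 ht.1) (right_mem_Icc.2 ht.1)
  simp only [(hQ s hs x).1, sub_self, zero_mul, sub_zero, Real.norm_eq_abs,
    abs_of_nonneg (sub_nonneg.2 ht.1)] at h
  rw [sub_right_comm, mul_comm (t - s) (_ * δ)]
  exact h

theorem norm_flow_sub_sub_le (hQ : IsFlow T b Q) (hc : 0 ≤ c)
    (hb : ∀ t ∈ Icc 0 T, ∀ x y, ‖b t x - b t y‖ ≤ c * ‖x - y‖) {s t : ℝ} (hs : s ∈ Icc 0 T)
    (ht : t ∈ Icc s T) (x y : Space d) :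
    ‖(Q t s x - x) - (Q t s y - y)‖ ≤ (t - s) * (c * Real.exp (c * T) * ‖x - y‖) := by
  have hsub : Icc s t ⊆ Icc 0 T := Icc_subset_Icc hs.1 ht.2
  have h := (convex_Icc s t).norm_image_sub_le_of_norm_hasDerivWithin_le
    (f := fun r => Q r s x - Q r s y) (C := c * Real.exp (c * T) * ‖x - y‖)
    (fun r hr => (((hQ s hs x).2 r (hsub hr)).sub ((hQ s hs y).2 r (hsub hr))).mono hsub)
    (fun r hr => ((hb r (hsub hr) _ _).trans (mul_le_mul_of_nonneg_left
      (hQ.norm_sub_le hc hb hs ⟨hr.1, hr.2.trans ht.2⟩ x y) hc)).trans_eq (by ring))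
    (left_mem_Icc.2 ht.1) (right_mem_Icc.2 ht.1)
  simp only [(hQ s hs _).1, Real.norm_eq_abs, abs_of_nonneg (sub_nonneg.2 ht.1)] at h
  rw [mul_comm (t - s) _, sub_sub_sub_comm]
  exact h

/-- Approximate invariance of `t ↦ ∫ (ψ ∘ Q τ t) * ρ dμ_t`: the mollification is needed because
`ψ ∘ Q τ t` is only known to be Lipschitz, and it costs a commutator of the order of the radius of
the bump `ρ`. -/
theorem IsWeakSolution.norm_integral_mollify_sub_le (hT : 0 < T)
    (h : IsWeakSolution T K₁ K₂ μ₀ u μ) (h₁ : KernelBound k K₁) (h₂ : KernelBound k K₂)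
    (hu : ContinuousOn u (Icc 0 T))
    (hQ : IsFlow T (fun t => velocity K₁ K₂ (μ t) (u t)) Q) {τ : ℝ} (hτ : τ ∈ Icc 0 T)
    {ψ : Space d → ℝ} {L₀ : ℝ} (hL₀ : 0 ≤ L₀) (hψ : ∀ x y, ‖ψ x - ψ y‖ ≤ L₀ * ‖x - y‖)
    (hψc : HasCompactSupport ψ) (hc : c = (1 + M) * k) (ρ : ContDiffBump (0 : Space d)) :
    ‖∫ x, mollify ρ (fun x => ψ (Q τ τ x)) x ∂(μ τ) - ∫ x, mollify ρ (fun x => ψ (Q τ 0 x)) x ∂μ₀‖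
      ≤ L₀ * Real.exp (c * T) * c * Real.exp (c * T) * ρ.rOut * τ := by
  have hk := h₁.nonneg
  have hc0 : 0 ≤ c := by rw [hc]; positivity
  set b : ℝ → Space d → Space d := fun t => velocity K₁ K₂ (μ t) (u t) with hbdef
  have hbc : ∀ t ∈ Icc 0 T, ∀ x, ‖b t x‖ ≤ c := fun t ht x => by
    have := (h.curve.isP2 t ht).prob
    exact hc ▸ norm_velocity_le h₁ h₂ _ _ _
  have hb : ∀ t ∈ Icc 0 T, ∀ x y, ‖b t x - b t y‖ ≤ c * ‖x - y‖ := fun t ht x y => by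
    have := (h.curve.isP2 t ht).prob
    exact hc ▸ norm_velocity_sub_le h₁ h₂ _ _ _ _
  have hsub : Icc 0 τ ⊆ Icc 0 T := Icc_subset_Icc_right hτ.2
  set L := L₀ * Real.exp (c * T) with hLdef
  have hL : 0 ≤ L := by positivity
  let φ : ℝ → Space d → ℝ := fun t x => ψ (Q τ t x)
  have hφlip : ∀ t ∈ Icc 0 τ, ∀ x y, ‖φ t x - φ t y‖ ≤ L * ‖x - y‖ := fun t ht x y => by
    refine (hψ _ _).trans ((mul_le_mul_of_nonneg_left
      (hQ.norm_sub_le hc0 hb (hsub ht) ⟨ht.2, hτ.2⟩ x y) hL₀).trans_eq ?_)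
    rw [hLdef]; ring
  have hφc : ∀ t ∈ Icc 0 τ, HasCompactSupport (φ t) := fun t ht => by
    obtain ⟨r, hr⟩ := hψc.isCompact.isBounded.subset_closedBall (0 : Space d)
    refine HasCompactSupport.intro (isCompact_closedBall (0 : Space d) (r + c * |τ - t|))
      fun x hx => image_eq_zero_of_notMem_tsupport (f := ψ) (x := Q τ t x) fun hmem => hx ?_
    have h1 := hr hmem
    have h2 := hQ.displacement hbc (hsub ht) hτ x
    rw [mem_closedBall_zero_iff] at h1 ⊢
    have h3 := norm_sub_norm_le x (Q τ t x)
    rw [norm_sub_rev] at h3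
    linarith
  have hφcont : ∀ t ∈ Icc 0 τ, Continuous (φ t) := fun t ht =>
    continuous_of_norm_sub_le (hφlip t ht)
  have hφcomp : ∀ s ∈ Icc 0 τ, ∀ t ∈ Icc s τ, ∀ x, φ s x = φ t (Q t s x) := fun s hs t ht x =>
    congrArg ψ (hQ.comp hc0 hb (hsub hs) ⟨ht.1, ht.2.trans hτ.2⟩ ⟨ht.2, hτ.2⟩ x).symm
  obtain ⟨C, hC, hmoll⟩ := isSpaceTest_mollify ρ
  have hg : ∀ t ∈ Icc 0 τ, IsSpaceTest L (C * L) (mollify ρ (φ t)) := fun t ht =>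
    hmoll _ L hL (hφlip t ht) (hφc t ht)
  have hL' : 0 ≤ C * L := by positivity
  let f : ℝ → ℝ := fun t => ∫ x, mollify ρ (φ t) x ∂(μ t)
  have hint : ∀ s ∈ Icc 0 τ, ∀ t ∈ Icc 0 τ, Integrable (mollify ρ (φ t)) (μ s) :=
    fun s hs t ht => (h.curve.isP2 s (hsub hs)).integrable_of_lip (hg t ht).lip
  -- The evolution of a fixed test function between two times.
  have hevol : ∀ s ∈ Icc 0 τ, ∀ t ∈ Icc s τ, ∀ r ∈ Icc 0 τ,
      ∫ x, mollify ρ (φ r) x ∂(μ t) - ∫ x, mollify ρ (φ r) x ∂(μ s)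
        = ∫ a in s..t, testRate K₁ K₂ u μ (mollify ρ (φ r)) a := fun s hs t ht r hr => by
    have ht' : t ∈ Icc 0 τ := ⟨hs.1.trans ht.1, ht.2⟩
    have hcr := h.curve.continuousOn_testRate h₁ h₂ hu hL' (hg r hr)
    have hi : ∀ s ∈ Icc 0 τ,
        IntervalIntegrable (testRate K₁ K₂ u μ (mollify ρ (φ r))) volume 0 s := fun s hs =>
      ContinuousOn.intervalIntegrable (hcr.mono (by
        rw [uIcc_of_le hs.1]; exact Icc_subset_Icc_right (hs.2.trans hτ.2)))
    rw [h.integral_eq hT h₁ h₂ hu hL' (hg r hr) t (hsub ht'),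
      h.integral_eq hT h₁ h₂ hu hL' (hg r hr) s (hsub hs), add_sub_add_left_eq_sub,
      intervalIntegral.integral_interval_sub_left (hi t ht') (hi s hs)]
  have hcomm : ∀ s ∈ Icc 0 τ, ∀ t ∈ Icc s τ, ∀ x,
      ‖mollify ρ (φ s) x - mollify ρ (φ t) (Q t s x)‖
        ≤ (t - s) * (L * c * Real.exp (c * T) * ρ.rOut) := fun s hs t ht x => by
    have ht' : t ∈ Icc 0 τ := ⟨hs.1.trans ht.1, ht.2⟩
    refine norm_mollify_sub_le (hφcont s hs) (hφcont t ht') fun z hz => ?_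
    rw [hφcomp s hs t ht]
    refine (hφlip t ht' _ _).trans ?_
    have h1 := norm_flow_sub_sub_le hQ hc0 hb (hsub hs) ⟨ht.1, ht.2.trans hτ.2⟩ (x - z) x
    have e : Q t s (x - z) - (Q t s x - z) = (Q t s (x - z) - (x - z)) - (Q t s x - x) := by abel
    rw [e]
    refine (mul_le_mul_of_nonneg_left h1 hL).trans ?_
    rw [sub_sub_cancel_left, norm_neg]
    have h2 : c * Real.exp (c * T) * ‖z‖ ≤ c * Real.exp (c * T) * ρ.rOut :=
      mul_le_mul_of_nonneg_left hz (by positivity)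
    have h3 := mul_le_mul_of_nonneg_left h2 (mul_nonneg hL (sub_nonneg.2 ht.1))
    calc L * ((t - s) * (c * Real.exp (c * T) * ‖z‖))
        = L * (t - s) * (c * Real.exp (c * T) * ‖z‖) := by ring
      _ ≤ _ := h3
      _ = _ := by ring
  have hrate : ∀ s ∈ Icc 0 τ, ∀ r ∈ Icc 0 τ, ‖testRate K₁ K₂ u μ (mollify ρ (φ r)) s‖ ≤ L * c :=
    fun s hs r hr => by
      have := (h.curve.isP2 s (hsub hs)).prob
      exact norm_integral_le_of_bound fun x => (ContinuousLinearMap.le_opNorm _ _).trans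
        (mul_le_mul ((hg r hr).norm_fderiv_le x) (hbc s (hsub hs) x) (norm_nonneg _) hL)
  have hfLip : ∀ s ∈ Icc 0 τ, ∀ t ∈ Icc s τ, ‖f t - f s‖ ≤ 2 * (L * c) * (t - s) := by
    intro s hs t ht
    have ht' : t ∈ Icc 0 τ := ⟨hs.1.trans ht.1, ht.2⟩
    have := (h.curve.isP2 s (hsub hs)).prob
    have e : f t - f s = (∫ a in s..t, testRate K₁ K₂ u μ (mollify ρ (φ t)) a)
        + ∫ x, (mollify ρ (φ t) x - mollify ρ (φ s) x) ∂(μ s) := by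
      rw [← hevol s hs t ht t ht', integral_sub (hint s hs t ht') (hint s hs s hs)]
      simp only [f]
      ring
    rw [e]
    refine (norm_add_le_of_le (?_ : _ ≤ L * c * (t - s))
      (?_ : _ ≤ L * (c * (t - s)))).trans_eq (by ring)
    · rw [← abs_of_nonneg (sub_nonneg.2 ht.1)]
      refine intervalIntegral.norm_integral_le_of_norm_le_const fun a ha => ?_
      rw [uIoc_of_le ht.1] at ha
      exact hrate a ⟨hs.1.trans ha.1.le, ha.2.trans ht.2⟩ t ht'
    · refine norm_integral_le_of_bound fun x =>
        norm_mollify_sub_le (hφcont t ht') (hφcont s hs) fun z _ => ?_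
      rw [hφcomp s hs t ht]
      refine (hφlip t ht' _ _).trans (mul_le_mul_of_nonneg_left ?_ hL)
      have := hQ.displacement hbc (hsub hs) (hsub ht') (x - z)
      rwa [norm_sub_rev, abs_of_nonneg (sub_nonneg.2 ht.1)] at this
  have hfc : ContinuousOn f (Icc 0 τ) := by
    have : LipschitzOnWith (2 * (L * c)).toNNReal f (Icc 0 τ) := by
      refine LipschitzOnWith.of_dist_le_mul fun s hs t ht => ?_
      rw [Real.coe_toNNReal _ (by positivity), dist_eq_norm, Real.dist_eq]
      rcases le_total s t with hst | hst
      · rw [norm_sub_rev, abs_sub_comm, abs_of_nonneg (sub_nonneg.2 hst)]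
        exact hfLip s hs t ⟨hst, ht.2⟩
      · rw [abs_of_nonneg (sub_nonneg.2 hst)]
        exact hfLip t ht s ⟨hst, hs.2⟩
    exact this.continuousOn
  have hmain := norm_sub_le_of_slope_le (a := L * c * Real.exp (c * T) * ρ.rOut) hτ.1 hfc ?_
  · have e0 : f 0 = ∫ x, mollify ρ (fun x => ψ (Q τ 0 x)) x ∂μ₀ := by
      have h0 := left_mem_Icc.2 hτ.1
      have := h.integral_eq hT h₁ h₂ hu hL' (hg 0 h0) 0 (hsub h0)
      rwa [intervalIntegral.integral_same, add_zero] at this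
    rw [e0] at hmain
    exact hmain
  · intro s hs κ hκ
    have hs' : s ∈ Icc 0 τ := ⟨hs.1, hs.2.le⟩
    have hprob := (h.curve.isP2 s (hsub hs')).prob
    set A := 2 * L + (L + C * L) * c + (L + C * L) * c * c with hA
    have hA0 : 0 ≤ A := by positivity
    have hδ : 0 < κ / (A + 1) := by positivity
    set δ := κ / (A + 1) with hδdef
    have hAδ : A * δ ≤ κ := by
      rw [hδdef, mul_div_assoc', div_le_iff₀ (by positivity)]
      nlinarith
    have hev := (h.curve.eventually_testRate h₁ h₂ hu (hsub hs') hδ).and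
      (h.curve.eventually_norm_velocity_sub_le h₁ h₂ hu (hsub hs') hδ)
    obtain ⟨ε, hε, hball⟩ := Metric.mem_nhdsWithin_iff.1 hev
    have hnear : ∀ᶠ t in 𝓝[>] s, t < s + min ε (min δ (τ - s)) := by
      refine nhdsWithin_le_nhds (Iio_mem_nhds ?_)
      have : 0 < min ε (min δ (τ - s)) := lt_min hε (lt_min hδ (sub_pos.2 hs.2))
      linarith
    filter_upwards [hnear, self_mem_nhdsWithin] with t htlt hst
    have hst : s < t := hst
    have ht1 : t - s < ε := by linarith [min_le_left ε (min δ (τ - s))]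
    have ht2 : t - s < δ := by
      linarith [min_le_right ε (min δ (τ - s)), min_le_left δ (τ - s)]
    have ht3 : t < τ := by
      linarith [min_le_right ε (min δ (τ - s)), min_le_right δ (τ - s)]
    have ht' : t ∈ Icc 0 τ := ⟨hs.1.trans hst.le, ht3.le⟩
    have htt : t ∈ Icc s τ := ⟨hst.le, ht3.le⟩
    have hP : ∀ r ∈ Icc s t, _ := fun r hr => hball ⟨by
      rw [Metric.mem_ball, Real.dist_eq, abs_of_nonneg (sub_nonneg.2 hr.1)]
      linarith [hr.2], hsub ⟨hs.1.trans hr.1, hr.2.trans ht3.le⟩⟩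
    set G := mollify ρ (φ t) with hG
    have hGt := hg t ht'
    have e : f t - f s = (∫ a in s..t, (testRate K₁ K₂ u μ G a - testRate K₁ K₂ u μ G s))
        - ∫ x, (mollify ρ (φ s) x - G x - (t - s) * fderiv ℝ G x (b s x)) ∂(μ s) := by
      have hi1 : IntervalIntegrable (testRate K₁ K₂ u μ G) volume s t :=
        ContinuousOn.intervalIntegrable ((h.curve.continuousOn_testRate h₁ h₂ hu hL' hGt).mono (by
          rw [uIcc_of_le hst.le]
          exact Icc_subset_Icc hs.1 (ht3.le.trans hτ.2)))
      have hi2 : Integrable (fun x => fderiv ℝ G x (b s x)) (μ s) :=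
        (h.curve.isP2 s (hsub hs')).integrable_of_lip
          (norm_fderiv_velocity_sub_le hGt hL' (hbc s (hsub hs')) (hb s (hsub hs')))
      have hi3 : Integrable (fun x => mollify ρ (φ s) x - G x) (μ s) :=
        (hint s hs' s hs').sub (hint s hs' t ht')
      rw [intervalIntegral.integral_sub hi1 intervalIntegrable_const, ← hevol s hs' t htt t ht',
        integral_sub hi3 (hi2.const_mul _), integral_sub (hint s hs' s hs') (hint s hs' t ht'),
        intervalIntegral.integral_const, integral_const_mul]
      simp only [f, testRate, smul_eq_mul, hbdef, ← hG]
      ring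
    rw [e]
    refine (norm_sub_le_of_le (?_ : _ ≤ (L + (L + C * L) * c) * δ * (t - s))
      (?_ : _ ≤ (t - s) * (L * c * Real.exp (c * T) * ρ.rOut)
        + (t - s) * ((L + (L + C * L) * c * c) * δ))).trans ?_
    · rw [← abs_of_nonneg (sub_nonneg.2 hst.le)]
      refine intervalIntegral.norm_integral_le_of_norm_le_const fun a ha => ?_
      rw [uIoc_of_le hst.le] at ha
      rw [hc]
      exact (hP a ⟨ha.1.le, ha.2⟩).1 G L (C * L) hL' hGt
    · refine norm_integral_le_of_bound fun x => ?_
      have e' : mollify ρ (φ s) x - G x - (t - s) * fderiv ℝ G x (b s x)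
          = (mollify ρ (φ s) x - G (Q t s x))
            + (G (Q t s x) - G x - (t - s) * fderiv ℝ G x (b s x)) := by ring
      rw [e']
      exact norm_add_le_of_le (hcomm s hs' t htt x)
        (norm_test_flow_sub_le hQ hc0 hL' hbc hb hGt (hsub hs') ⟨hst.le, ht3.le.trans hτ.2⟩
          (fun r hr => (hP r hr).2) ht2.le x)
    · have : (L + (L + C * L) * c) * δ * (t - s) + (t - s) * ((L + (L + C * L) * c * c) * δ)
          = (t - s) * (A * δ) := by rw [hA]; ring
      nlinarith [mul_le_mul_of_nonneg_left hAδ (sub_pos.2 hst).le]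

/-- A weak solution is the image of its initial datum under the characteristics of its own
velocity field. -/
theorem IsWeakSolution.eq_map (hT : 0 < T) [IsProbabilityMeasure μ₀]
    (h : IsWeakSolution T K₁ K₂ μ₀ u μ) (h₁ : KernelBound k K₁) (h₂ : KernelBound k K₂)
    (hu : ContinuousOn u (Icc 0 T))
    (hQ : IsFlow T (fun t => velocity K₁ K₂ (μ t) (u t)) Q) {τ : ℝ} (hτ : τ ∈ Icc 0 T) :
    μ τ = μ₀.map (Q τ 0) := by
  have hk := h₁.nonneg
  have h0 : (0 : ℝ) ∈ Icc 0 T := left_mem_Icc.2 hT.le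
  have hprob := (h.curve.isP2 τ hτ).prob
  obtain ⟨c, hc⟩ : ∃ c, c = (1 + M) * k := ⟨_, rfl⟩
  have hc0 : 0 ≤ c := by rw [hc]; positivity
  have hb : ∀ t ∈ Icc 0 T, ∀ x y, ‖velocity K₁ K₂ (μ t) (u t) x - velocity K₁ K₂ (μ t) (u t) y‖
      ≤ c * ‖x - y‖ := fun t ht x y => by
    have := (h.curve.isP2 t ht).prob
    exact hc ▸ norm_velocity_sub_le h₁ h₂ _ _ _ _
  have hQc : Continuous (Q τ 0) :=
    continuous_of_norm_sub_le (hQ.norm_sub_le hc0 hb h0 ⟨hτ.1, hτ.2⟩)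
  have := Measure.isProbabilityMeasure_map (μ := μ₀) hQc.aemeasurable
  -- Lipschitz test functions: let the radius of the mollifier tend to zero.
  have hlip : ∀ (ψ : Space d → ℝ) (L₀ : ℝ), 0 ≤ L₀ → (∀ x y, ‖ψ x - ψ y‖ ≤ L₀ * ‖x - y‖) →
      HasCompactSupport ψ → ∫ x, ψ x ∂(μ τ) = ∫ x, ψ (Q τ 0 x) ∂μ₀ := by
    intro ψ L₀ hL₀ hψ hψc
    have hψcont := continuous_of_norm_sub_le hψ
    obtain ⟨B, hB⟩ := hψcont.bounded_above_of_compact_support hψc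
    set A := L₀ + L₀ * Real.exp (c * T) * c * Real.exp (c * T) * τ + L₀ * Real.exp (c * T) with hA
    have hA0 : 0 ≤ A := by have := hτ.1; positivity
    have key : ∀ ε > 0, ‖∫ x, ψ x ∂(μ τ) - ∫ x, ψ (Q τ 0 x) ∂μ₀‖ ≤ A * ε := by
      intro ε hε
      let ρ : ContDiffBump (0 : Space d) := ⟨ε / 2, ε, by linarith, by linarith⟩
      have h3 := h.norm_integral_mollify_sub_le hT h₁ h₂ hu hQ hτ hL₀ hψ hψc hc ρ
      have hQτ : (fun x => ψ (Q τ τ x)) = ψ := funext fun x => by rw [(hQ τ hτ x).1]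
      rw [hQτ] at h3
      have hψQ : ∀ x y, ‖ψ (Q τ 0 x) - ψ (Q τ 0 y)‖ ≤ L₀ * Real.exp (c * T) * ‖x - y‖ :=
        fun x y => (hψ _ _).trans ((mul_le_mul_of_nonneg_left
          (hQ.norm_sub_le hc0 hb h0 ⟨hτ.1, hτ.2⟩ x y) hL₀).trans_eq (by ring))
      have hm : ∀ {χ : Space d → ℝ} {l : ℝ}, 0 ≤ l → (∀ x y, ‖χ x - χ y‖ ≤ l * ‖x - y‖) → ∀ x,
          ‖mollify ρ χ x - χ x‖ ≤ l * ε := fun {χ l} hl hχ x =>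
        norm_mollify_sub_self_le (continuous_of_norm_sub_le hχ) fun z hz =>
          (hχ _ _).trans (mul_le_mul_of_nonneg_left (by simpa using hz) hl)
      have hmc : ∀ {χ : Space d → ℝ} {l : ℝ}, 0 ≤ l → (∀ x y, ‖χ x - χ y‖ ≤ l * ‖x - y‖) →
          Continuous (mollify ρ χ) := fun {χ l} hl hχ =>
        continuous_of_norm_sub_le (c := l) fun x y =>
          norm_mollify_sub_le (continuous_of_norm_sub_le hχ) (continuous_of_norm_sub_le hχ)
            fun z _ => (hχ _ _).trans_eq (by rw [sub_sub_sub_cancel_right])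
      have hbd : ∀ {χ : Space d → ℝ} {l : ℝ}, 0 ≤ l → (∀ x y, ‖χ x - χ y‖ ≤ l * ‖x - y‖) →
          (∀ x, ‖χ x‖ ≤ B) → ∀ (ν : Measure (Space d)) [IsProbabilityMeasure ν],
          ‖∫ x, mollify ρ χ x ∂ν - ∫ x, χ x ∂ν‖ ≤ l * ε := fun {χ l} hl hχ hχB ν _ => by
        have hi1 : Integrable χ ν := integrable_of_continuous_of_norm_le
          (continuous_of_norm_sub_le hχ).aestronglyMeasurable hχB
        have hi2 : Integrable (mollify ρ χ) ν := integrable_of_continuous_of_norm_le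
          (hmc hl hχ).aestronglyMeasurable fun x => by
            have := norm_mollify_sub_le (ρ := ρ) (x := x) (x' := x) (C := B)
              (continuous_of_norm_sub_le hχ) (continuous_const (y := (0 : ℝ)))
              (fun z _ => by rw [sub_zero]; exact hχB _)
            have e0 : mollify ρ (fun _ => (0 : ℝ)) x = 0 := by simp [mollify]
            rwa [e0, sub_zero] at this
        rw [← integral_sub hi2 hi1]
        exact norm_integral_le_of_bound (hm hl hχ)
      have h4 := hbd hL₀ hψ hB (μ τ)
      have h5 := hbd (by positivity) hψQ (fun x => hB _) μ₀
      have h6 := norm_sub_le_of_le (norm_sub_le_of_le h3 h4) ((norm_neg _).trans_le h5)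
      have e : (∫ x, mollify ρ ψ x ∂(μ τ) - ∫ x, mollify ρ (fun x => ψ (Q τ 0 x)) x ∂μ₀)
          - (∫ x, mollify ρ ψ x ∂(μ τ) - ∫ x, ψ x ∂(μ τ))
          - -(∫ x, mollify ρ (fun x => ψ (Q τ 0 x)) x ∂μ₀ - ∫ x, ψ (Q τ 0 x) ∂μ₀)
          = ∫ x, ψ x ∂(μ τ) - ∫ x, ψ (Q τ 0 x) ∂μ₀ := by ring
      rw [e] at h6
      refine h6.trans_eq ?_
      simp only [ρ, hA]
      ring
    have hlim : Tendsto (fun ε : ℝ => A * ε) (𝓝[>] 0) (𝓝 0) := by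
      have : Continuous fun ε : ℝ => A * ε := by fun_prop
      simpa using (this.tendsto 0).mono_left nhdsWithin_le_nhds
    have := ge_of_tendsto hlim (by filter_upwards [self_mem_nhdsWithin] with ε hε using key ε hε)
    exact sub_eq_zero.1 (norm_le_zero_iff.1 this)
  -- General test functions are uniform limits of Lipschitz ones.
  suffices hcc : ∀ χ : Space d → ℝ, Continuous χ → HasCompactSupport χ →
      ∫ x, χ x ∂(μ τ) = ∫ x, χ (Q τ 0 x) ∂μ₀ by
    refine Measure.ext_of_integral_eq_on_compactlySupported fun χ => ?_
    rw [integral_map (f := χ) hQc.aemeasurable (map_continuous χ).aestronglyMeasurable]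
    exact hcc χ (map_continuous χ) χ.hasCompactSupport
  intro χ hχ hχs
  have hχu := hχs.uniformContinuous_of_continuous hχ
  obtain ⟨B, hB⟩ := hχ.bounded_above_of_compact_support hχs
  have key : ∀ ε > 0, ‖∫ x, χ x ∂(μ τ) - ∫ x, χ (Q τ 0 x) ∂μ₀‖ ≤ 2 * ε := by
    intro ε hε
    obtain ⟨δ, hδ, hχδ⟩ := Metric.uniformContinuous_iff.1 hχu ε hε
    let ρ : ContDiffBump (0 : Space d) := ⟨δ / 4, δ / 2, by linarith, by linarith⟩
    have hm : ∀ x, ‖mollify ρ χ x - χ x‖ ≤ ε := fun x =>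
      norm_mollify_sub_self_le hχ fun z hz => by
        rw [← dist_eq_norm]
        refine (hχδ ?_).le
        rw [dist_eq_norm, sub_sub_cancel_left, norm_neg]
        have : ρ.rOut = δ / 2 := rfl
        linarith
    have hsm : ContDiff ℝ ∞ (mollify ρ χ) :=
      ρ.hasCompactSupport_normed.contDiff_convolution_left (ContinuousLinearMap.lsmul ℝ ℝ)
        ρ.contDiff_normed hχ.locallyIntegrable
    have hsc : HasCompactSupport (mollify ρ χ) :=
      ρ.hasCompactSupport_normed.convolution (ContinuousLinearMap.lsmul ℝ ℝ) hχs
    obtain ⟨L, L', hL, -, hmt⟩ := IsSpaceTest.exists_of_smooth hsm hsc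
    have he := hlip _ L hL hmt.lip hsc
    obtain ⟨B', hB'⟩ := hsm.continuous.bounded_above_of_compact_support hsc
    have h4 : ‖∫ x, mollify ρ χ x ∂(μ τ) - ∫ x, χ x ∂(μ τ)‖ ≤ ε := by
      rw [← integral_sub
        (integrable_of_continuous_of_norm_le hsm.continuous.aestronglyMeasurable hB')
        (integrable_of_continuous_of_norm_le hχ.aestronglyMeasurable hB)]
      exact norm_integral_le_of_bound hm
    have h5 : ‖∫ x, mollify ρ χ (Q τ 0 x) ∂μ₀ - ∫ x, χ (Q τ 0 x) ∂μ₀‖ ≤ ε := by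
      rw [← integral_sub (f := fun x => mollify ρ χ (Q τ 0 x)) (g := fun x => χ (Q τ 0 x))
        (integrable_of_continuous_of_norm_le (hsm.continuous.comp hQc).aestronglyMeasurable
          fun x => hB' _)
        (integrable_of_continuous_of_norm_le (hχ.comp hQc).aestronglyMeasurable
          fun x => hB _)]
      exact norm_integral_le_of_bound fun x => hm _
    have h6 := norm_sub_le_of_le h5 h4
    rw [he, sub_sub_sub_cancel_left] at h6
    linarith
  have hlim : Tendsto (fun ε : ℝ => 2 * ε) (𝓝[>] 0) (𝓝 0) := by
    have : Continuous fun ε : ℝ => 2 * ε := by fun_prop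
    simpa using (this.tendsto 0).mono_left nhdsWithin_le_nhds
  have := ge_of_tendsto hlim (by filter_upwards [self_mem_nhdsWithin] with ε hε using key ε hε)
  exact sub_eq_zero.1 (norm_le_zero_iff.1 this)

end transport

/-! ### The potential of an adjoint velocity -/

section potential

variable {d : ℕ} {T c B Λ : ℝ} {b : ℝ → Space d → Space d}
  {Db : ℝ → Space d → Space d →L[ℝ] Space d} {Q : ℝ → ℝ → Space d → Space d}
  {H : ℝ → Space d → ℝ} {h : ℝ → Space d → Space d} {ξ : ℝ → Space d → Space d}

/-- A field `ξ` solving `∂_t ξ + Dξ b = -(Db)ᵀ ξ + h`, `ξ_T = 0`, along the characteristics `Q` of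
`b`, where `h = ∇H`. The function `H` is only continuously differentiable in space. -/
structure IsAdjointSystem (T c B Λ : ℝ) (b : ℝ → Space d → Space d)
    (Db : ℝ → Space d → Space d →L[ℝ] Space d) (Q : ℝ → ℝ → Space d → Space d)
    (H : ℝ → Space d → ℝ) (h : ℝ → Space d → Space d) (ξ : ℝ → Space d → Space d) : Prop where
  c_nonneg : 0 ≤ c
  norm_le : ∀ t ∈ Icc 0 T, ∀ x, ‖b t x‖ ≤ c
  lip : ∀ t ∈ Icc 0 T, ∀ x y, ‖b t x - b t y‖ ≤ c * ‖x - y‖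
  taylor : ∀ t ∈ Icc 0 T, ∀ x y, ‖b t x - b t y - Db t y (x - y)‖ ≤ c * ‖x - y‖ ^ 2
  flow : IsFlow T b Q
  continuousOn_b : ContinuousOn (fun p : ℝ × Space d => b p.1 p.2) (Icc 0 T ×ˢ univ)
  continuousOn_H : ContinuousOn (fun p : ℝ × Space d => H p.1 p.2) (Icc 0 T ×ˢ univ)
  taylor_H : ∀ r, ∀ ε > 0, ∃ δ > 0, ∀ t ∈ Icc 0 T, ∀ x y : Space d, ‖x‖ ≤ r → ‖y‖ ≤ r →
    ‖x - y‖ ≤ δ → ‖H t x - H t y - inner ℝ (h t y) (x - y)‖ ≤ ε * ‖x - y‖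
  continuousOn_ξ : ContinuousOn (fun p : ℝ × Space d => ξ p.1 p.2) (Icc 0 T ×ˢ univ)
  continuousOn_rhs : ContinuousOn (fun p : ℝ × Space d =>
    -(ContinuousLinearMap.adjoint (Db p.1 p.2) (ξ p.1 p.2)) + h p.1 p.2) (Icc 0 T ×ˢ univ)
  norm_ξ_le : ∀ t ∈ Icc 0 T, ∀ x, ‖ξ t x‖ ≤ B
  lip_ξ : ∀ t ∈ Icc 0 T, ∀ x y, ‖ξ t x - ξ t y‖ ≤ Λ * ‖x - y‖
  representation : ∀ t ∈ Icc 0 T, ∀ x, ξ t x = -∫ s in t..T,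
    (-(ContinuousLinearMap.adjoint (Db s (Q s t x)) (ξ s (Q s t x))) + h s (Q s t x))

/-- The potential `φ_t(x) = ∫_t^T H_s(Q_s(x,t)) ds`, the cost collected along a characteristic. -/
noncomputable def potential (T : ℝ) (Q : ℝ → ℝ → Space d → Space d) (H : ℝ → Space d → ℝ)
    (t : ℝ) (x : Space d) : ℝ :=
  ∫ s in t..T, H s (Q s t x)

namespace IsAdjointSystem

theorem continuousOn_comp {E : Type*} [TopologicalSpace E] {F : ℝ → Space d → E}
    (hF : ContinuousOn (fun p : ℝ × Space d => F p.1 p.2) (Icc 0 T ×ˢ univ)) {q : ℝ → Space d}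
    (hq : ContinuousOn q (Icc 0 T)) : ContinuousOn (fun t => F t (q t)) (Icc 0 T) :=
  hF.comp (continuousOn_id.prodMk hq) fun _ ht => ⟨ht, mem_univ _⟩

theorem continuousOn_flow (S : IsAdjointSystem T c B Λ b Db Q H h ξ) {t : ℝ} (ht : t ∈ Icc 0 T)
    (x : Space d) : ContinuousOn (fun s => Q s t x) (Icc 0 T) := fun s hs =>
  ((S.flow t ht x).2 s hs).continuousWithinAt

theorem potential_flow (S : IsAdjointSystem T c B Λ b Db Q H h ξ) {t : ℝ} (ht : t ∈ Icc 0 T)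
    (x : Space d) {s : ℝ} (hs : s ∈ Icc t T) :
    potential T Q H s (Q s t x) = ∫ r in s..T, H r (Q r t x) := by
  refine intervalIntegral.integral_congr fun r hr => ?_
  rw [uIcc_of_le hs.2] at hr
  simp only [S.flow.comp S.c_nonneg S.lip ht hs hr]

theorem ξ_flow (S : IsAdjointSystem T c B Λ b Db Q H h ξ) {t : ℝ} (ht : t ∈ Icc 0 T)
    (x : Space d) {s : ℝ} (hs : s ∈ Icc t T) :
    ξ s (Q s t x) = -∫ r in s..T, (-(ContinuousLinearMap.adjoint (Db r (Q r t x))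
      (ξ r (Q r t x))) + h r (Q r t x)) := by
  rw [S.representation s ⟨ht.1.trans hs.1, hs.2⟩]
  refine congrArg Neg.neg (intervalIntegral.integral_congr fun r hr => ?_)
  rw [uIcc_of_le hs.2] at hr
  simp only [S.flow.comp S.c_nonneg S.lip ht hs hr]

theorem hasDerivWithinAt_potential_flow (S : IsAdjointSystem T c B Λ b Db Q H h ξ) {t : ℝ}
    (ht : t ∈ Icc 0 T) (x : Space d) {s : ℝ} (hs : s ∈ Icc t T) :
    HasDerivWithinAt (fun s => potential T Q H s (Q s t x)) (-H s (Q s t x)) (Icc t T) s := by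
  have h1 := (hasDerivWithinAt_integral_Icc_left
    (continuousOn_comp S.continuousOn_H (S.continuousOn_flow ht x))
    ⟨ht.1.trans hs.1, hs.2⟩).mono (Icc_subset_Icc_left ht.1)
  exact h1.congr (fun r hr => S.potential_flow ht x hr) (S.potential_flow ht x hs)

theorem hasDerivWithinAt_ξ_flow (S : IsAdjointSystem T c B Λ b Db Q H h ξ) {t : ℝ}
    (ht : t ∈ Icc 0 T) (x : Space d) {s : ℝ} (hs : s ∈ Icc t T) :
    HasDerivWithinAt (fun s => ξ s (Q s t x))
      (-(ContinuousLinearMap.adjoint (Db s (Q s t x)) (ξ s (Q s t x))) + h s (Q s t x))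
      (Icc t T) s := by
  have h1 := (hasDerivWithinAt_integral_Icc_left
    (f := fun s => -(ContinuousLinearMap.adjoint (Db s (Q s t x)) (ξ s (Q s t x))) + h s (Q s t x))
    (continuousOn_comp (F := fun s y => -(ContinuousLinearMap.adjoint (Db s y) (ξ s y)) + h s y)
      S.continuousOn_rhs (S.continuousOn_flow ht x))
    ⟨ht.1.trans hs.1, hs.2⟩).neg.mono (Icc_subset_Icc_left ht.1)
  rw [neg_neg] at h1
  exact h1.congr (fun r hr => S.ξ_flow ht x hr) (S.ξ_flow ht x hs)

theorem norm_flow_le (S : IsAdjointSystem T c B Λ b Db Q H h ξ) {t : ℝ} (ht : t ∈ Icc 0 T)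
    {s : ℝ} (hs : s ∈ Icc 0 T) (x : Space d) : ‖Q s t x‖ ≤ ‖x‖ + c * T := by
  have h1 := S.flow.displacement S.norm_le ht hs x
  have h2 := norm_sub_norm_le (Q s t x) x
  have h3 : c * |s - t| ≤ c * T := mul_le_mul_of_nonneg_left
    (abs_le.2 ⟨by linarith [ht.2, hs.1], by linarith [ht.1, hs.2]⟩) S.c_nonneg
  linarith

/-- The adjoint field is minus the gradient of the potential. Along two characteristics `q`, `q'`
the derivative of `φ_s(q') - φ_s(q) + ⟨ξ_s(q), q' - q⟩` consists of two Taylor remainders, so the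
flow need not be differentiated in space. -/
theorem hasFDerivAt_potential (S : IsAdjointSystem T c B Λ b Db Q H h ξ) {t : ℝ}
    (ht : t ∈ Icc 0 T) (x : Space d) :
    HasFDerivAt (potential T Q H t) (-(innerSL ℝ (ξ t x))) x := by
  have hc := S.c_nonneg
  have hT : 0 ≤ T := ht.1.trans ht.2
  have hB : 0 ≤ B := (norm_nonneg _).trans (S.norm_ξ_le t ht x)
  set e := Real.exp (c * T) with he
  have he0 : 0 < e := Real.exp_pos _
  rw [hasFDerivAt_iff_isLittleO, Asymptotics.isLittleO_iff]
  intro ε hε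
  -- Half of `ε` absorbs the remainder of `H`, the other half the remainder of `b`.
  obtain ⟨δ, hδ, hH⟩ := S.taylor_H (‖x‖ + 1 + c * T) (ε / 2 / (T + 1) / e) (by positivity)
  have hnear : ∀ᶠ y in 𝓝 x, ‖y - x‖ < min 1 (min (δ / e) (ε / 2 / ((T + 1) * (B * c + 1) * e ^ 2))) := by
    have : Tendsto (fun y => ‖y - x‖) (𝓝 x) (𝓝 0) := by
      have : Continuous fun y : Space d => ‖y - x‖ := by fun_prop
      simpa using this.tendsto x
    exact this.eventually_lt_const (by positivity)
  filter_upwards [hnear] with y hy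
  have hy1 : ‖y - x‖ < 1 := hy.trans_le (min_le_left _ _)
  have hy2 : ‖y - x‖ < δ / e := hy.trans_le ((min_le_right _ _).trans (min_le_left _ _))
  have hy3 : ‖y - x‖ < ε / 2 / ((T + 1) * (B * c + 1) * e ^ 2) :=
    hy.trans_le ((min_le_right _ _).trans (min_le_right _ _))
  rw [lt_div_iff₀ he0] at hy2
  rw [lt_div_iff₀ (by positivity)] at hy3
  have hyx : ‖y‖ ≤ ‖x‖ + 1 := by
    have := norm_sub_norm_le y x
    linarith
  have hd : ∀ s ∈ Icc t T, HasDerivWithinAt (fun s => potential T Q H s (Q s t y)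
      - potential T Q H s (Q s t x) + inner ℝ (ξ s (Q s t x)) (Q s t y - Q s t x))
      (-(H s (Q s t y) - H s (Q s t x) - inner ℝ (h s (Q s t x)) (Q s t y - Q s t x))
        + inner ℝ (ξ s (Q s t x)) (b s (Q s t y) - b s (Q s t x)
          - Db s (Q s t x) (Q s t y - Q s t x))) (Icc t T) s := by
    intro s hs
    have hs' : s ∈ Icc 0 T := ⟨ht.1.trans hs.1, hs.2⟩
    have h1 := ((S.hasDerivWithinAt_potential_flow ht y hs).sub
      (S.hasDerivWithinAt_potential_flow ht x hs)).add
      ((S.hasDerivWithinAt_ξ_flow ht x hs).inner ℝ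
        (((S.flow t ht y).2 s hs').sub ((S.flow t ht x).2 s hs') |>.mono
          (Icc_subset_Icc_left ht.1)))
    refine h1.congr_deriv ?_
    simp only [Pi.sub_apply, inner_add_left, inner_neg_left, inner_sub_right,
      ContinuousLinearMap.adjoint_inner_left, map_sub]
    ring
  have hbound : ∀ s ∈ Icc t T,
      ‖-(H s (Q s t y) - H s (Q s t x) - inner ℝ (h s (Q s t x)) (Q s t y - Q s t x))
        + inner ℝ (ξ s (Q s t x)) (b s (Q s t y) - b s (Q s t x)
          - Db s (Q s t x) (Q s t y - Q s t x))‖ ≤ ε / (T + 1) * ‖y - x‖ := by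
    intro s hs
    have hs' : s ∈ Icc 0 T := ⟨ht.1.trans hs.1, hs.2⟩
    have hq := S.flow.norm_sub_le hc S.lip ht hs y x
    rw [← he] at hq
    have h1 := hH s hs' (Q s t y) (Q s t x) ((S.norm_flow_le ht hs' y).trans (by linarith))
      ((S.norm_flow_le ht hs' x).trans (by linarith)) (hq.trans (by linarith))
    have h2 := S.taylor s hs' (Q s t y) (Q s t x)
    have h3 : ‖inner ℝ (ξ s (Q s t x)) (b s (Q s t y) - b s (Q s t x)
          - Db s (Q s t x) (Q s t y - Q s t x))‖ ≤ B * (c * (e * ‖y - x‖) ^ 2) := by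
      refine (norm_inner_le_norm _ _).trans
        (mul_le_mul (S.norm_ξ_le s hs' _) (h2.trans ?_) (norm_nonneg _) hB)
      exact mul_le_mul_of_nonneg_left (pow_le_pow_left₀ (norm_nonneg _) hq 2) hc
    have h4 : ε / 2 / (T + 1) / e * ‖Q s t y - Q s t x‖ ≤ ε / 2 / (T + 1) * ‖y - x‖ := by
      refine (mul_le_mul_of_nonneg_left hq (by positivity)).trans_eq ?_
      field_simp
    have h5 : B * (c * (e * ‖y - x‖) ^ 2) ≤ ε / 2 / (T + 1) * ‖y - x‖ := by
      have h6 : B * c * e ^ 2 * ‖y - x‖ ≤ ε / 2 / (T + 1) := by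
        rw [le_div_iff₀ (by positivity)]
        have : 0 ≤ ‖y - x‖ * (T + 1) * e ^ 2 := by positivity
        nlinarith
      calc B * (c * (e * ‖y - x‖) ^ 2) = B * c * e ^ 2 * ‖y - x‖ * ‖y - x‖ := by ring
        _ ≤ _ := mul_le_mul_of_nonneg_right h6 (norm_nonneg _)
    refine (norm_add_le_of_le ((norm_neg _).trans_le (h1.trans h4)) (h3.trans h5)).trans_eq ?_
    ring
  have hfin := (convex_Icc t T).norm_image_sub_le_of_norm_hasDerivWithin_le hd hbound
    (right_mem_Icc.2 ht.2) (left_mem_Icc.2 ht.2)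
  have hξT : ξ T (Q T t x) = 0 := by
    rw [S.ξ_flow ht x (right_mem_Icc.2 ht.2), intervalIntegral.integral_same, neg_zero]
  have hφT : ∀ z, potential T Q H T z = 0 := fun z => intervalIntegral.integral_same
  rw [hξT, hφT, hφT, inner_zero_left, (S.flow t ht x).1, (S.flow t ht y).1, sub_zero, add_zero,
    sub_zero] at hfin
  have e1 : potential T Q H t y - potential T Q H t x - (-(innerSL ℝ (ξ t x))) (y - x)
      = potential T Q H t y - potential T Q H t x + inner ℝ (ξ t x) (y - x) := by
    simp
  rw [e1]
  refine hfin.trans ?_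
  rw [Real.norm_eq_abs, abs_sub_comm, abs_of_nonneg (sub_nonneg.2 ht.2)]
  have h7 : ε / (T + 1) * ‖y - x‖ * (T - t) ≤ ε / (T + 1) * ‖y - x‖ * (T + 1) :=
    mul_le_mul_of_nonneg_left (by linarith [ht.1]) (by positivity)
  refine h7.trans_eq ?_
  field_simp

theorem potential_taylor (S : IsAdjointSystem T c B Λ b Db Q H h ξ) (hΛ : 0 ≤ Λ) {t : ℝ}
    (ht : t ∈ Icc 0 T) (x y : Space d) :
    ‖potential T Q H t x - potential T Q H t y + inner ℝ (ξ t y) (x - y)‖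
      ≤ Λ * ‖x - y‖ ^ 2 := by
  have h1 := norm_taylor_le_of_hasFDerivAt hΛ (S.hasFDerivAt_potential ht) (fun x y => by
    rw [← neg_sub', norm_neg, ← map_sub, innerSL_apply_norm]
    exact S.lip_ξ t ht x y) x y
  simpa using h1

theorem potential_lip (S : IsAdjointSystem T c B Λ b Db Q H h ξ) {t : ℝ}
    (ht : t ∈ Icc 0 T) (x y : Space d) :
    ‖potential T Q H t x - potential T Q H t y‖ ≤ B * ‖x - y‖ :=
  norm_sub_le_of_hasFDerivAt (S.hasFDerivAt_potential ht) (fun x => by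
    rw [norm_neg, innerSL_apply_norm]
    exact S.norm_ξ_le t ht x) x y

/-- The potential along a curve that is not a characteristic. -/
theorem hasDerivWithinAt_potential_curve (S : IsAdjointSystem T c B Λ b Db Q H h ξ) (hΛ : 0 ≤ Λ)
    {X w : ℝ → Space d} (hX : ∀ t ∈ Icc 0 T, HasDerivWithinAt X (w t) (Icc 0 T) t) {t : ℝ}
    (ht : t ∈ Icc 0 T) :
    HasDerivWithinAt (fun s => potential T Q H s (X s))
      (-(H t (X t) + inner ℝ (ξ t (X t)) (w t - b t (X t)))) (Icc t T) t := by
  have htt : t ∈ Icc t T := left_mem_Icc.2 ht.2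
  have hsub : Icc t T ⊆ Icc 0 T := Icc_subset_Icc_left ht.1
  set q : ℝ → Space d := fun s => Q s t (X t) with hq
  have hqt : q t = X t := (S.flow t ht (X t)).1
  have hD : HasDerivWithinAt (fun s => X s - q s) (w t - b t (X t)) (Icc t T) t := by
    have := ((hX t ht).sub ((S.flow t ht (X t)).2 t ht)).mono hsub
    rwa [(S.flow t ht (X t)).1] at this
  have h1 := S.hasDerivWithinAt_potential_flow ht (X t) htt
  have h2 := (S.hasDerivWithinAt_ξ_flow ht (X t) htt).inner ℝ hD
  have h3 : HasDerivWithinAt (fun s => potential T Q H s (X s) - potential T Q H s (q s)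
      + inner ℝ (ξ s (q s)) (X s - q s)) 0 (Icc t T) t := by
    have hsq := hD.inner ℝ hD
    rw [hqt, sub_self, inner_zero_left, inner_zero_right, add_zero] at hsq
    rw [hasDerivWithinAt_iff_isLittleO] at hsq ⊢
    simp only [hqt, sub_self, inner_zero_right, sub_zero, smul_zero, add_zero] at hsq ⊢
    refine Asymptotics.IsBigO.trans_isLittleO (Asymptotics.IsBigO.of_bound Λ ?_) hsq
    filter_upwards [self_mem_nhdsWithin] with s hs
    have := S.potential_taylor hΛ (hsub hs) (X s) (q s)
    rwa [real_inner_self_eq_norm_sq, norm_pow, norm_norm]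
  have h4 := (h3.sub h2).add h1
  refine (h4.congr_deriv ?_).congr_of_mem (fun s hs => ?_) htt
  · simp only [hqt, sub_self, inner_zero_right, add_zero, (S.flow t ht (X t)).1]
    ring
  · simp only [Pi.sub_apply, Pi.add_apply, hq]
    ring

theorem continuousOn_potential_curve (S : IsAdjointSystem T c B Λ b Db Q H h ξ)
    {X w : ℝ → Space d} (hX : ∀ t ∈ Icc 0 T, HasDerivWithinAt X (w t) (Icc 0 T) t)
    (hw : ContinuousOn w (Icc 0 T)) :
    ContinuousOn (fun s => potential T Q H s (X s)) (Icc 0 T) := by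
  rcases lt_or_ge T 0 with hT | hT
  · simp [Icc_eq_empty hT.not_ge]
  have hc := S.c_nonneg
  obtain ⟨W, hW⟩ := isCompact_Icc.exists_bound_of_continuousOn hw
  obtain ⟨r, hr⟩ := isCompact_Icc.exists_bound_of_continuousOn
    (fun t ht => (hX t ht).continuousWithinAt : ContinuousOn X (Icc 0 T))
  obtain ⟨A, hA⟩ := (isCompact_Icc.prod (isCompact_closedBall (0 : Space d)
    (r + c * T))).exists_bound_of_continuousOn
    (S.continuousOn_H.mono (prod_mono_right (subset_univ _)))
  have h0 : (0 : ℝ) ∈ Icc 0 T := left_mem_Icc.2 hT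
  have hB : 0 ≤ B := (norm_nonneg _).trans (S.norm_ξ_le 0 h0 0)
  have hW0 : 0 ≤ W := (norm_nonneg _).trans (hW 0 h0)
  have hA0 : 0 ≤ A := by
    refine (norm_nonneg _).trans (hA (0, X 0) ⟨h0, mem_closedBall_zero_iff.2 ?_⟩)
    have := hr 0 h0
    nlinarith
  have key : ∀ s ∈ Icc 0 T, ∀ t ∈ Icc s T,
      ‖potential T Q H s (X s) - potential T Q H t (X t)‖ ≤ (A + B * (c + W)) * (t - s) := by
    intro s hs t ht
    have ht' : t ∈ Icc 0 T := ⟨hs.1.trans ht.1, ht.2⟩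
    have hcont := continuousOn_comp S.continuousOn_H (S.continuousOn_flow hs (X s))
    have hi : ∀ a ∈ Icc 0 T, ∀ a' ∈ Icc 0 T,
        IntervalIntegrable (fun r => H r (Q r s (X s))) volume a a' := fun a ha a' ha' =>
      ContinuousOn.intervalIntegrable (hcont.mono (uIcc_subset_Icc ha ha'))
    have e : potential T Q H s (X s) - potential T Q H t (X t)
        = (∫ r in s..t, H r (Q r s (X s)))
          + (potential T Q H t (Q t s (X s)) - potential T Q H t (X t)) := by
      rw [S.potential_flow hs (X s) ht, ← add_sub_assoc,
        intervalIntegral.integral_add_adjacent_intervals (hi s hs t ht')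
          (hi t ht' T (right_mem_Icc.2 hT))]
      rfl
    rw [e]
    refine (norm_add_le_of_le (?_ : _ ≤ A * (t - s))
      (?_ : _ ≤ B * ((c + W) * (t - s)))).trans_eq (by ring)
    · rw [← abs_of_nonneg (sub_nonneg.2 ht.1)]
      refine intervalIntegral.norm_integral_le_of_norm_le_const fun a ha => ?_
      rw [uIoc_of_le ht.1] at ha
      have ha' : a ∈ Icc 0 T := ⟨hs.1.trans ha.1.le, ha.2.trans ht.2⟩
      refine hA (a, Q a s (X s)) ⟨ha', mem_closedBall_zero_iff.2 ?_⟩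
      exact (S.norm_flow_le hs ha' _).trans (by linarith [hr s hs])
    · refine (S.potential_lip ht' _ _).trans (mul_le_mul_of_nonneg_left ?_ hB)
      have h1 := S.flow.displacement S.norm_le hs ht' (X s)
      have h2 := norm_sub_le_of_hasDerivWithinAt_Icc hX hW hs ht'
      rw [abs_of_nonneg (sub_nonneg.2 ht.1)] at h1 h2
      have h3 := norm_sub_le_of_le h1 h2
      rw [sub_sub_sub_cancel_right] at h3
      linarith
  have : LipschitzOnWith (A + B * (c + W)).toNNReal (fun s => potential T Q H s (X s))
      (Icc 0 T) := by
    refine LipschitzOnWith.of_dist_le_mul fun s hs t ht => ?_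
    rw [Real.coe_toNNReal _ (by positivity), dist_eq_norm, Real.dist_eq]
    rcases le_total s t with hst | hst
    · rw [abs_sub_comm, abs_of_nonneg (sub_nonneg.2 hst)]
      exact key s hs t ⟨hst, ht.2⟩
    · rw [norm_sub_rev, abs_of_nonneg (sub_nonneg.2 hst)]
      exact key t ht s ⟨hst, hs.2⟩
  exact this.continuousOn

/-- Along any curve, the cost `H` corrected by the adjoint field paired with the deviation of the
speed from the field `b` integrates to a quantity that depends on the initial point only. -/
theorem integral_curve_eq (S : IsAdjointSystem T c B Λ b Db Q H h ξ) (hT : 0 ≤ T) (hΛ : 0 ≤ Λ)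
    {X w : ℝ → Space d} (hX : ∀ t ∈ Icc 0 T, HasDerivWithinAt X (w t) (Icc 0 T) t)
    (hw : ContinuousOn w (Icc 0 T)) :
    ∫ t in (0 : ℝ)..T, (H t (X t) + inner ℝ (ξ t (X t)) (w t - b t (X t)))
      = potential T Q H 0 (X 0) := by
  have hXc : ContinuousOn X (Icc 0 T) := fun t ht => (hX t ht).continuousWithinAt
  have hc : ContinuousOn (fun t => -(H t (X t) + inner ℝ (ξ t (X t)) (w t - b t (X t))))
      (Icc 0 T) :=
    ((continuousOn_comp S.continuousOn_H hXc).add ((continuousOn_comp S.continuousOn_ξ hXc).inner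
      (hw.sub (continuousOn_comp S.continuousOn_b hXc)))).neg
  have h1 := intervalIntegral.integral_eq_sub_of_hasDeriv_right_of_le hT
    (S.continuousOn_potential_curve hX hw) (fun t ht => ?_)
    (ContinuousOn.intervalIntegrable (by rwa [uIcc_of_le hT]) :
      IntervalIntegrable (fun t => -(H t (X t) + inner ℝ (ξ t (X t)) (w t - b t (X t))))
        volume 0 T)
  · have hφT : potential T Q H T (X T) = 0 := intervalIntegral.integral_same
    rw [hφT, zero_sub, intervalIntegral.integral_neg] at h1
    exact neg_injective h1
  · have h2 := S.hasDerivWithinAt_potential_curve hΛ hX (Ioo_subset_Icc_self ht)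
    exact (h2.mono_of_mem_nhdsWithin (Icc_mem_nhdsGE ht.2)).mono Ioi_subset_Ici_self

end IsAdjointSystem

end potential

/-! ### Bounds for the cost functional -/

section cost

variable {d m : ℕ} {a : ℝ} {g : Fin m → Space d → ℝ}

/-- Quantitative form, with constant `a`, of the growth assumption on the functions `g_l`. -/
structure MomentBound (a : ℝ) (g : Fin m → Space d → ℝ) : Prop where
  nonneg : 0 ≤ a
  contDiff : ∀ l, ContDiff ℝ 1 (g l)
  norm_gradient_le : ∀ l x, ‖gradient (g l) x‖ ≤ a * (1 + ‖x‖)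
  abs_sub_le : ∀ l x y, |g l x - g l y| ≤ a * (1 + ‖x‖ + ‖y‖) * ‖x - y‖
  abs_le : ∀ l x, |g l x| ≤ a * (1 + ‖x‖ ^ 2)

theorem hasFDerivAt_of_contDiff_one {f : Space d → ℝ} (hf : ContDiff ℝ 1 f) (x : Space d) :
    HasFDerivAt f (innerSL ℝ (gradient f x)) x := by
  have h := (hf.differentiable (by norm_num) x).hasGradientAt
  exact h.hasFDerivAt

theorem continuous_gradient_of_contDiff_one {f : Space d → ℝ} (hf : ContDiff ℝ 1 f) :
    Continuous (gradient f) :=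
  (InnerProductSpace.toDual ℝ (Space d)).symm.continuous.comp
    (hf.continuous_fderiv (by norm_num))

theorem exists_momentBound (hg : ∀ l, ContDiff ℝ 1 (g l))
    (hg' : ∃ C : ℝ, ∀ l x, ‖gradient (g l) x‖ ≤ C * (1 + ‖x‖)) : ∃ a, MomentBound a g := by
  obtain ⟨C, hC⟩ := hg'
  set c := max C 0 with hc
  have hc0 : 0 ≤ c := le_max_right _ _
  have hb : ∀ l x, ‖gradient (g l) x‖ ≤ c * (1 + ‖x‖) := fun l x => (hC l x).trans
    (mul_le_mul_of_nonneg_right (le_max_left _ _) (by positivity))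
  have hs : ∀ l x y, |g l x - g l y| ≤ c * (1 + ‖x‖ + ‖y‖) * ‖x - y‖ := fun l x y => by
    refine (convex_segment y x).norm_image_sub_le_of_norm_hasFDerivWithin_le (f := g l)
      (fun z _ => (hasFDerivAt_of_contDiff_one (hg l) z).hasFDerivWithinAt) (fun z hz => ?_)
      (left_mem_segment ℝ y x) (right_mem_segment ℝ y x)
    rw [innerSL_apply_norm]
    refine (hb l z).trans (mul_le_mul_of_nonneg_left ?_ hc0)
    obtain ⟨α, β, hα, hβ, hαβ, rfl⟩ := hz
    have h1 : ‖α • y + β • x‖ ≤ α * ‖y‖ + β * ‖x‖ := by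
      refine (norm_add_le _ _).trans_eq ?_
      rw [norm_smul, norm_smul, Real.norm_of_nonneg hα, Real.norm_of_nonneg hβ]
    have hα1 : α ≤ 1 := by linarith
    have hβ1 : β ≤ 1 := by linarith
    have h2 := mul_le_of_le_one_left (norm_nonneg y) hα1
    have h3 := mul_le_of_le_one_left (norm_nonneg x) hβ1
    linarith
  have hsum : ∀ l, |g l 0| ≤ ∑ l, |g l 0| := fun l =>
    Finset.single_le_sum (f := fun l => |g l 0|) (fun _ _ => abs_nonneg _) (Finset.mem_univ l)
  have hs0 : 0 ≤ ∑ l, |g l 0| := Finset.sum_nonneg fun _ _ => abs_nonneg _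
  refine ⟨2 * c + ∑ l, |g l 0|, by positivity, hg, fun l x => (hb l x).trans ?_,
    fun l x y => (hs l x y).trans ?_, fun l x => ?_⟩
  · gcongr; linarith
  · gcongr; linarith
  · have h1 := hs l x 0
    rw [norm_zero, sub_zero, add_zero] at h1
    have h2 : |g l x| ≤ |g l x - g l 0| + |g l 0| := by
      have := abs_add_le (g l x - g l 0) (g l 0)
      rwa [sub_add_cancel] at this
    have h3 : c * (1 + ‖x‖) * ‖x‖ ≤ 2 * c * (1 + ‖x‖ ^ 2) := by
      have : (1 + ‖x‖) * ‖x‖ ≤ 2 * (1 + ‖x‖ ^ 2) := by nlinarith [sq_nonneg (‖x‖ - 1)]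
      nlinarith
    have h4 : |g l 0| ≤ (∑ l, |g l 0|) * (1 + ‖x‖ ^ 2) := by
      nlinarith [hsum l, sq_nonneg ‖x‖]
    linarith

/-- A twice continuously differentiable function has a bounded derivative and a quadratic Taylor
remainder on every ball. -/
theorem exists_taylor_bound_closedBall {j : (Fin m → ℝ) → ℝ} (hj : ContDiff ℝ 2 j) (ρ : ℝ) :
    ∃ C, 0 ≤ C ∧ ∀ p q : Fin m → ℝ, ‖p‖ ≤ ρ → ‖q‖ ≤ ρ →
      ‖fderiv ℝ j q‖ ≤ C ∧ |j p - j q - fderiv ℝ j q (p - q)| ≤ C * ‖p - q‖ ^ 2 := by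
  have hj' : ContDiff ℝ 1 (fderiv ℝ j) := hj.fderiv_right (by norm_num)
  have hK : IsCompact (Metric.closedBall (0 : Fin m → ℝ) ρ) := isCompact_closedBall _ _
  obtain ⟨C₁, h₁⟩ := hK.exists_bound_of_continuousOn hj'.continuous.continuousOn
  obtain ⟨C₂, h₂⟩ := hK.exists_bound_of_continuousOn
    (hj'.continuous_fderiv (by norm_num)).continuousOn
  refine ⟨max 0 (max C₁ C₂), le_max_left _ _, fun p q hp hq => ?_⟩
  have hp' : p ∈ Metric.closedBall (0 : Fin m → ℝ) ρ := by simpa using hp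
  have hq' : q ∈ Metric.closedBall (0 : Fin m → ℝ) ρ := by simpa using hq
  refine ⟨(h₁ q hq').trans ((le_max_left _ _).trans (le_max_right _ _)), ?_⟩
  have hlip : ∀ z ∈ Metric.closedBall (0 : Fin m → ℝ) ρ,
      ‖fderiv ℝ j z - fderiv ℝ j q‖ ≤ C₂ * ‖z - q‖ := fun z hz =>
    (convex_closedBall (0 : Fin m → ℝ) ρ).norm_image_sub_le_of_norm_hasFDerivWithin_le
      (fun y _ => (hj'.differentiable (by norm_num) y).hasFDerivAt.hasFDerivWithinAt)
      (fun y hy => h₂ y hy) hq' hz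
  have hC₂ : 0 ≤ C₂ := (norm_nonneg _).trans (h₂ q hq')
  have hseg : segment ℝ q p ⊆ Metric.closedBall (0 : Fin m → ℝ) ρ :=
    (convex_closedBall _ _).segment_subset hq' hp'
  have h := (convex_segment q p).norm_image_sub_le_of_norm_hasFDerivWithin_le'
    (f := j) (φ := fderiv ℝ j q) (C := C₂ * ‖p - q‖)
    (fun z _ => (hj.differentiable (by norm_num) z).hasFDerivAt.hasFDerivWithinAt)
    (fun z hz => (hlip z (hseg hz)).trans ?_)
    (left_mem_segment ℝ q p) (right_mem_segment ℝ q p)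
  · refine h.trans ?_
    rw [mul_assoc, ← sq]
    gcongr
    exact (le_max_right _ _).trans (le_max_right _ _)
  · gcongr
    exact norm_sub_le_of_mem_segment hz

end cost

/-! ### Random trajectories -/

/-- `X` is a square integrable solution on the probability space `P` of the McKean-Vlasov equation
`X' = v(law X, w)(X)` on `[0,T]`. -/
structure IsMcKean {d M : ℕ} {Ω : Type*} [MeasurableSpace Ω] (P : Measure Ω) (T : ℝ)
    (K₁ K₂ : Space d → Space d) (w : ℝ → ControlSpace d M) (X : ℝ → Ω → Space d) : Prop where
  measurable : ∀ t ∈ Icc 0 T, StronglyMeasurable (X t)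
  memLp_zero : MemLp (X 0) 2 P
  ode : ∀ t ∈ Icc 0 T, ∀ η, HasDerivWithinAt (fun s => X s η)
    (velocity K₁ K₂ (P.map (X t)) (w t) (X t η)) (Icc 0 T) t

namespace IsMcKean

variable {d M m : ℕ} {k T a : ℝ} {K₁ K₂ : Space d → Space d} {Ω : Type*} [MeasurableSpace Ω]
  {P : Measure Ω} {w : ℝ → ControlSpace d M} {X : ℝ → Ω → Space d}
  {g : Fin m → Space d → ℝ} {t : ℝ}

theorem continuousOn (h : IsMcKean P T K₁ K₂ w X) (η : Ω) :
    ContinuousOn (fun t => X t η) (Icc 0 T) := fun t ht => (h.ode t ht η).continuousWithinAt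

theorem moments_eq (h : IsMcKean P T K₁ K₂ w X) (hg : MomentBound a g) (ht : t ∈ Icc 0 T)
    (l : Fin m) : moments g (P.map (X t)) l = ∫ η, g l (X t η) ∂P :=
  integral_map (h.measurable t ht).aestronglyMeasurable.aemeasurable
    (hg.contDiff l).continuous.aestronglyMeasurable

variable [IsProbabilityMeasure P]

theorem isProbabilityMeasure_map (h : IsMcKean P T K₁ K₂ w X) (ht : t ∈ Icc 0 T) :
    IsProbabilityMeasure (P.map (X t)) :=
  Measure.isProbabilityMeasure_map (h.measurable t ht).aestronglyMeasurable.aemeasurable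

theorem norm_le (h : IsMcKean P T K₁ K₂ w X) (h₁ : KernelBound k K₁) (h₂ : KernelBound k K₂)
    (ht : t ∈ Icc 0 T) (η : Ω) : ‖X t η‖ ≤ ‖X 0 η‖ + (1 + M) * k * T := by
  have hk := h₁.nonneg
  have h0 : ‖X t η - X 0 η‖ ≤ (1 + M) * k * |t - 0| :=
    norm_sub_le_of_hasDerivWithinAt_Icc (fun t ht => h.ode t ht η) (fun t ht => by
      have := h.isProbabilityMeasure_map ht
      exact norm_velocity_le h₁ h₂ _ _ _) ⟨le_rfl, ht.1.trans ht.2⟩ ht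
  have h2 : (1 + M) * k * |t - 0| ≤ (1 + M) * k * T := by
    rw [sub_zero, abs_of_nonneg ht.1]
    exact mul_le_mul_of_nonneg_left ht.2 (by positivity)
  have := norm_sub_norm_le (X t η) (X 0 η)
  linarith

theorem memLp (h : IsMcKean P T K₁ K₂ w X) (h₁ : KernelBound k K₁) (h₂ : KernelBound k K₂)
    (ht : t ∈ Icc 0 T) : MemLp (X t) 2 P := by
  have hk := h₁.nonneg
  have hT : 0 ≤ T := ht.1.trans ht.2
  refine (h.memLp_zero.norm.add (memLp_const ((1 + M) * k * T))).mono
    (h.measurable t ht).aestronglyMeasurable (Eventually.of_forall fun η => ?_)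
  simp only [Pi.add_apply]
  rw [Real.norm_of_nonneg (by positivity)]
  exact h.norm_le h₁ h₂ ht η

theorem norm_sq_le (h : IsMcKean P T K₁ K₂ w X) (h₁ : KernelBound k K₁) (h₂ : KernelBound k K₂)
    (ht : t ∈ Icc 0 T) (η : Ω) :
    ‖X t η‖ ^ 2 ≤ 2 * ‖X 0 η‖ ^ 2 + 2 * ((1 + M) * k * T) ^ 2 := by
  have h1 := h.norm_le h₁ h₂ ht η
  have h2 : ‖X t η‖ ^ 2 ≤ (‖X 0 η‖ + (1 + M) * k * T) ^ 2 := by gcongr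
  nlinarith [sq_nonneg (‖X 0 η‖ - (1 + M) * k * T)]

theorem integral_norm_sq_le (h : IsMcKean P T K₁ K₂ w X) (h₁ : KernelBound k K₁)
    (h₂ : KernelBound k K₂) (ht : t ∈ Icc 0 T) :
    ∫ η, ‖X t η‖ ^ 2 ∂P ≤ 2 * ∫ η, ‖X 0 η‖ ^ 2 ∂P + 2 * ((1 + M) * k * T) ^ 2 := by
  have hi := h.memLp_zero.norm.integrable_sq
  refine (integral_mono (h.memLp h₁ h₂ ht).norm.integrable_sq
    ((hi.const_mul 2).add (integrable_const _)) (h.norm_sq_le h₁ h₂ ht)).trans_eq ?_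
  refine (integral_add (hi.const_mul 2) (integrable_const _)).trans ?_
  rw [integral_const_mul]
  simp

/-- Functions of at most quadratic growth may be integrated along the trajectories. -/
theorem timeDominated_comp {E : Type*} [NormedAddCommGroup E] (h : IsMcKean P T K₁ K₂ w X)
    (h₁ : KernelBound k K₁) (h₂ : KernelBound k K₂) {F : ℝ → Space d → E} {A : ℝ}
    (hF : ContinuousOn (fun p : ℝ × Space d => F p.1 p.2) (Icc 0 T ×ˢ univ))
    (hA : ∀ t ∈ Icc 0 T, ∀ x, ‖F t x‖ ≤ A * (1 + ‖x‖ ^ 2)) :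
    TimeDominated P T fun t η => F t (X t η) := by
  refine ⟨fun η => hF.comp (continuousOn_id.prodMk (h.continuousOn η))
    fun t ht => ⟨ht, mem_univ _⟩, fun t ht => ?_, ?_⟩
  · have hc : Continuous (F t) := by
      rw [← continuousOn_univ]
      exact hF.comp (continuousOn_const.prodMk continuousOn_id) fun x _ => ⟨ht, mem_univ _⟩
    exact hc.comp_stronglyMeasurable (h.measurable t ht)
  · refine ⟨fun η => |A| * (1 + (2 * ‖X 0 η‖ ^ 2 + 2 * ((1 + M) * k * T) ^ 2)),
      (((integrable_const _).add
        ((h.memLp_zero.norm.integrable_sq.const_mul 2).add (integrable_const _))).const_mul _),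
      fun t ht η => (hA t ht _).trans ?_⟩
    have := h.norm_sq_le h₁ h₂ ht η
    exact mul_le_mul (le_abs_self A) (by linarith) (by positivity) (abs_nonneg A)

theorem continuousOn_moments (h : IsMcKean P T K₁ K₂ w X) (h₁ : KernelBound k K₁)
    (h₂ : KernelBound k K₂) (hg : MomentBound a g) :
    ContinuousOn (fun t => moments g (P.map (X t))) (Icc 0 T) := by
  refine continuousOn_pi.2 fun l => ContinuousOn.congr ?_ fun t ht => h.moments_eq hg ht l
  exact (h.timeDominated_comp h₁ h₂ (F := fun _ => g l)
    ((hg.contDiff l).continuous.comp continuous_snd).continuousOn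
    fun t _ x => hg.abs_le l x).continuousOn_integral

theorem norm_moments_le (h : IsMcKean P T K₁ K₂ w X) (h₁ : KernelBound k K₁)
    (h₂ : KernelBound k K₂) (hg : MomentBound a g) (ht : t ∈ Icc 0 T) {r : ℝ}
    (hr : ∫ η, ‖X t η‖ ^ 2 ∂P ≤ r) : ‖moments g (P.map (X t))‖ ≤ a * (1 + r) := by
  have ha := hg.nonneg
  have hr0 : 0 ≤ r := (integral_nonneg fun _ => sq_nonneg _).trans hr
  refine (pi_norm_le_iff_of_nonneg (by positivity)).2 fun l => ?_
  have hi := (h.memLp h₁ h₂ ht).norm.integrable_sq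
  rw [h.moments_eq hg ht]
  refine (norm_integral_le_of_norm_le (((integrable_const 1).add hi).const_mul a)
    (Eventually.of_forall fun η => hg.abs_le l (X t η))).trans ?_
  rw [integral_const_mul]
  refine mul_le_mul_of_nonneg_left ?_ ha
  refine (integral_add (integrable_const 1) hi).trans_le ?_
  simpa using hr

end IsMcKean

/-! ### Stability of the McKean-Vlasov equation -/

theorem TimeDominated.mono {Ω E : Type*} [MeasurableSpace Ω] [NormedAddCommGroup E]
    {P : Measure Ω} {T : ℝ} {F : ℝ → Ω → E} (h : TimeDominated P T F) {t : ℝ} (ht : t ≤ T) :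
    TimeDominated P t F := by
  obtain ⟨D, hD, hb⟩ := h.dominated
  exact ⟨fun η => (h.continuousOn η).mono (Icc_subset_Icc_right ht),
    fun s hs => h.measurable s ⟨hs.1, hs.2.trans ht⟩, D, hD, fun s hs => hb s ⟨hs.1, hs.2.trans ht⟩⟩

/-- Differentiation of an expectation in time. -/
theorem TimeDominated.hasDerivWithinAt_integral {Ω : Type*} [MeasurableSpace Ω] {P : Measure Ω}
    [IsProbabilityMeasure P] {T : ℝ} {f f' : ℝ → Ω → ℝ} (hf : TimeDominated P T f)
    (hf' : TimeDominated P T f')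
    (hd : ∀ t ∈ Icc 0 T, ∀ η, HasDerivWithinAt (fun s => f s η) (f' t η) (Icc 0 T) t) {t : ℝ}
    (ht : t ∈ Icc 0 T) :
    HasDerivWithinAt (fun s => ∫ η, f s η ∂P) (∫ η, f' t η ∂P) (Icc 0 T) t := by
  have h0 : (0 : ℝ) ∈ Icc 0 T := ⟨le_rfl, ht.1.trans ht.2⟩
  have e : ∀ s ∈ Icc 0 T, ∫ η, f s η ∂P
      = (∫ r in (0 : ℝ)..s, (∫ η, f' r η ∂P)) + ∫ η, f 0 η ∂P := fun s hs => by
    rw [(hf'.mono hs.2).integral_swap hs.1, ← integral_add ?_ (hf.integrable h0)]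
    · refine integral_congr_ae (Eventually.of_forall fun η => ?_)
      have := integral_eq_sub_of_hasDerivWithinAt_Icc hs.1 (fun r hr =>
        (hd r ⟨hr.1, hr.2.trans hs.2⟩ η).mono (Icc_subset_Icc_right hs.2))
        ((hf'.continuousOn η).mono (Icc_subset_Icc_right hs.2))
      simp only [this]
      ring
    · have : (fun η => ∫ r in (0 : ℝ)..s, f' r η) = fun η => f s η - f 0 η := funext fun η =>
        integral_eq_sub_of_hasDerivWithinAt_Icc hs.1 (fun r hr =>
          (hd r ⟨hr.1, hr.2.trans hs.2⟩ η).mono (Icc_subset_Icc_right hs.2))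
          ((hf'.continuousOn η).mono (Icc_subset_Icc_right hs.2))
      rw [this]
      exact (hf.integrable hs).sub (hf.integrable h0)
  exact ((hasDerivWithinAt_integral_Icc hf'.continuousOn_integral ht).add_const _).congr e (e t ht)

/-- Grönwall's inequality with a forcing term. -/
theorem le_exp_mul_of_hasDerivWithinAt_le {T L : ℝ} (hL : 0 ≤ L) {e e' f : ℝ → ℝ}
    (hd : ∀ t ∈ Icc 0 T, HasDerivWithinAt e (e' t) (Icc 0 T) t)
    (hf : ContinuousOn f (Icc 0 T)) (hf0 : ∀ t ∈ Icc 0 T, 0 ≤ f t)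
    (hle : ∀ t ∈ Icc 0 T, e' t ≤ L * e t + f t) {t : ℝ} (ht : t ∈ Icc 0 T) :
    e t ≤ Real.exp (L * T) * (max (e 0) 0 + ∫ s in (0 : ℝ)..T, f s) := by
  have hT : 0 ≤ T := ht.1.trans ht.2
  have hG : ∀ t ∈ Icc 0 T, HasDerivWithinAt
      (fun t => Real.exp (-(L * t)) * e t - ∫ s in (0 : ℝ)..t, f s)
      (Real.exp (-(L * t)) * (-L) * e t + Real.exp (-(L * t)) * e' t - f t) (Icc 0 T) t := by
    intro t ht
    have h1 : HasDerivAt (fun t : ℝ => Real.exp (-(L * t))) (Real.exp (-(L * t)) * (-L)) t := by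
      have := ((hasDerivAt_id t).const_mul L).neg.exp
      simpa using this
    exact (h1.hasDerivWithinAt.mul (hd t ht)).sub (hasDerivWithinAt_integral_Icc hf ht)
  have hanti : AntitoneOn (fun t => Real.exp (-(L * t)) * e t - ∫ s in (0 : ℝ)..t, f s)
      (Icc 0 T) := by
    refine antitoneOn_of_hasDerivWithinAt_nonpos (convex_Icc 0 T)
      (fun t ht => (hG t ht).continuousWithinAt)
      (fun t ht => (hG t (interior_subset ht)).mono interior_subset) fun t ht => ?_
    have ht' := interior_subset ht
    have h1 : Real.exp (-(L * t)) * (e' t - L * e t) ≤ 1 * f t :=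
      (mul_le_mul_of_nonneg_left (by linarith [hle t ht'] : e' t - L * e t ≤ f t)
        (Real.exp_nonneg _)).trans (mul_le_mul_of_nonneg_right
        (Real.exp_le_one_iff.2 (by nlinarith [ht'.1])) (hf0 t ht'))
    nlinarith
  have h := hanti ⟨le_rfl, hT⟩ ht ht.1
  simp only [mul_zero, neg_zero, Real.exp_zero, one_mul, intervalIntegral.integral_same,
    sub_zero] at h
  have hmono : ∫ s in (0 : ℝ)..t, f s ≤ ∫ s in (0 : ℝ)..T, f s :=
    intervalIntegral.integral_mono_interval le_rfl ht.1 ht.2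
      ((ae_restrict_iff' measurableSet_Ioc).2 (Eventually.of_forall fun s hs =>
        hf0 s (Ioc_subset_Icc_self hs)))
      (ContinuousOn.intervalIntegrable (by rwa [uIcc_of_le hT]))
  have hI : 0 ≤ ∫ s in (0 : ℝ)..T, f s := intervalIntegral.integral_nonneg hT hf0
  have h2 : Real.exp (-(L * t)) * e t ≤ max (e 0) 0 + ∫ s in (0 : ℝ)..T, f s := by
    linarith [le_max_left (e 0) 0]
  have h3 : e t = Real.exp (L * t) * (Real.exp (-(L * t)) * e t) := by
    rw [← mul_assoc, ← Real.exp_add]; simp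
  rw [h3]
  refine (mul_le_mul_of_nonneg_left h2 (Real.exp_nonneg _)).trans ?_
  exact mul_le_mul_of_nonneg_right (Real.exp_le_exp.2 (mul_le_mul_of_nonneg_left ht.2 hL))
    (add_nonneg (le_max_right _ _) hI)

section stability

variable {d M : ℕ} {k T : ℝ} {K₁ K₂ : Space d → Space d} {Ω : Type*} [MeasurableSpace Ω]
  {P : Measure Ω} [IsProbabilityMeasure P] {w u : ℝ → ControlSpace d M} {X Y : ℝ → Ω → Space d}

theorem norm_velocity_map_sub_le (h₁ : KernelBound k K₁) (h₂ : KernelBound k K₂)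
    {Z Z' : Ω → Space d} (hZ : MemLp Z 2 P) (hZ' : MemLp Z' 2 P) (w u : ControlSpace d M)
    (x y : Space d) :
    ‖velocity K₁ K₂ (P.map Z) w x - velocity K₁ K₂ (P.map Z') u y‖
      ≤ (1 + M) * k * ‖x - y‖ + k * (∫ η, ‖Z η - Z' η‖ ∂P) + M * k * ‖w - u‖ := by
  have hZp : IsProbabilityMeasure (P.map Z) :=
    Measure.isProbabilityMeasure_map hZ.aestronglyMeasurable.aemeasurable
  have h1 := norm_velocity_sub_le h₁ h₂ (P.map Z) w x y
  have h2 := norm_velocity_control_sub_le (K₁ := K₁) h₂ (P.map Z') u w y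
  have h3 : ‖velocity K₁ K₂ (P.map Z) w y - velocity K₁ K₂ (P.map Z') w y‖
      ≤ k * (∫ η, ‖Z η - Z' η‖ ∂P) := by
    rw [velocity_map_sub hZ.aestronglyMeasurable hZ'.aestronglyMeasurable h₁]
    simp only [sub_self, Finset.sum_const_zero, sub_zero, norm_neg]
    rw [← integral_const_mul]
    refine norm_integral_le_of_norm_le
      (((hZ.sub hZ').norm.integrable (by norm_num)).const_mul k)
      (Eventually.of_forall fun η => (h₁.lip _ _).trans_eq ?_)
    rw [sub_sub_sub_cancel_left, norm_sub_rev]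
  have e : velocity K₁ K₂ (P.map Z) w x - velocity K₁ K₂ (P.map Z') u y
      = (velocity K₁ K₂ (P.map Z) w x - velocity K₁ K₂ (P.map Z) w y)
        + (velocity K₁ K₂ (P.map Z) w y - velocity K₁ K₂ (P.map Z') w y)
        + (velocity K₁ K₂ (P.map Z') w y - velocity K₁ K₂ (P.map Z') u y) := by abel
  rw [e]
  exact norm_add_le_of_le (norm_add_le_of_le h1 h3) h2

theorem continuousOn_velocity_uncurry (h : IsMcKean P T K₁ K₂ w X) (h₁ : KernelBound k K₁)
    (h₂ : KernelBound k K₂) (hw : ContinuousOn w (Icc 0 T)) :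
    ContinuousOn (fun p : ℝ × Space d => velocity K₁ K₂ (P.map (X p.1)) (w p.1) p.2)
      (Icc 0 T ×ˢ univ) :=
  continuousOn_velocity h₁ h₂ (Z := fun p : ℝ × Space d => X p.1)
    (fun η => (h.continuousOn η).comp continuousOn_fst fun _ hp => hp.1)
    (fun p hp => (h.measurable p.1 hp.1).aestronglyMeasurable)
    (hw.comp continuousOn_fst fun _ hp => hp.1) continuousOn_snd

/-- Two solutions stay close in mean square if their initial states and their controls do. -/
theorem IsMcKean.integral_norm_sub_sq_le (hX : IsMcKean P T K₁ K₂ w X)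
    (hY : IsMcKean P T K₁ K₂ u Y) (h₁ : KernelBound k K₁) (h₂ : KernelBound k K₂)
    (hw : ContinuousOn w (Icc 0 T)) (hu : ContinuousOn u (Icc 0 T)) {t : ℝ} (ht : t ∈ Icc 0 T) :
    ∫ η, ‖X t η - Y t η‖ ^ 2 ∂P ≤ Real.exp ((4 + 4 * M) * k * T)
      * ((∫ η, ‖X 0 η - Y 0 η‖ ^ 2 ∂P) + M * k * ∫ s in (0 : ℝ)..T, ‖w s - u s‖ ^ 2) := by
  have hk := h₁.nonneg
  have hmem : ∀ t ∈ Icc 0 T, MemLp (fun η => X t η - Y t η) 2 P := fun t ht =>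
    (hX.memLp h₁ h₂ ht).sub (hY.memLp h₁ h₂ ht)
  set V := (1 + M) * k with hV
  have hV0 : 0 ≤ V := by positivity
  have hT : 0 ≤ T := ht.1.trans ht.2
  let D : Ω → ℝ := fun η => ‖X 0 η‖ + V * T + (‖Y 0 η‖ + V * T)
  have hDm : MemLp D 2 P := (hX.memLp_zero.norm.add (memLp_const _)).add
    (hY.memLp_zero.norm.add (memLp_const _))
  have hD : ∀ t ∈ Icc 0 T, ∀ η, ‖X t η - Y t η‖ ≤ D η := fun t ht η =>
    norm_sub_le_of_le (hX.norm_le h₁ h₂ ht η) (hY.norm_le h₁ h₂ ht η)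
  have hf : TimeDominated P T fun t η => ‖X t η - Y t η‖ ^ 2 := by
    refine ⟨fun η => ((hX.continuousOn η).sub (hY.continuousOn η)).norm.pow 2, fun t ht =>
      ((hX.measurable t ht).sub (hY.measurable t ht)).norm.pow 2, fun η => D η ^ 2,
      hDm.integrable_sq, fun t ht η => ?_⟩
    rw [Real.norm_of_nonneg (by positivity)]
    exact pow_le_pow_left₀ (norm_nonneg _) (hD t ht η) 2
  let v : ℝ → Ω → Space d := fun t η => velocity K₁ K₂ (P.map (X t)) (w t) (X t η)
    - velocity K₁ K₂ (P.map (Y t)) (u t) (Y t η)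
  have hv : ∀ t ∈ Icc 0 T, ∀ η, ‖v t η‖ ≤ V + V := fun t ht η => by
    have := hX.isProbabilityMeasure_map ht
    have := hY.isProbabilityMeasure_map ht
    exact norm_sub_le_of_le (norm_velocity_le h₁ h₂ _ _ _) (norm_velocity_le h₁ h₂ _ _ _)
  have hf' : TimeDominated P T fun t η => 2 * inner ℝ (X t η - Y t η) (v t η) := by
    have hvc : ∀ η, ContinuousOn (fun t => v t η) (Icc 0 T) := fun η =>
      (continuousOn_velocity h₁ h₂ hX.continuousOn
        (fun t ht => (hX.measurable t ht).aestronglyMeasurable) hw (hX.continuousOn η)).sub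
      (continuousOn_velocity h₁ h₂ hY.continuousOn
        (fun t ht => (hY.measurable t ht).aestronglyMeasurable) hu (hY.continuousOn η))
    have hvm : ∀ t ∈ Icc 0 T, StronglyMeasurable (v t) := fun t ht => by
      have := hX.isProbabilityMeasure_map ht
      have := hY.isProbabilityMeasure_map ht
      exact ((continuous_of_norm_sub_le (norm_velocity_sub_le h₁ h₂ _ _)).comp_stronglyMeasurable
        (hX.measurable t ht)).sub
        ((continuous_of_norm_sub_le (norm_velocity_sub_le h₁ h₂ _ _)).comp_stronglyMeasurable
        (hY.measurable t ht))
    refine ⟨fun η => continuousOn_const.mul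
      (((hX.continuousOn η).sub (hY.continuousOn η)).inner (𝕜 := ℝ) (hvc η)), fun t ht =>
      ((((hX.measurable t ht).sub (hY.measurable t ht))).inner (𝕜 := ℝ) (hvm t ht)).const_mul 2,
      fun η => 2 * (D η * (V + V)), ((hDm.integrable (by norm_num)).mul_const _).const_mul 2,
      fun t ht η => ?_⟩
    rw [norm_mul, Real.norm_of_nonneg (by norm_num : (0 : ℝ) ≤ 2)]
    refine mul_le_mul_of_nonneg_left ((norm_inner_le_norm _ _).trans ?_) (by norm_num)
    exact mul_le_mul (hD t ht η) (hv t ht η) (norm_nonneg _) ((norm_nonneg _).trans (hD t ht η))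
  have hd : ∀ t ∈ Icc 0 T, ∀ η, HasDerivWithinAt (fun s => ‖X s η - Y s η‖ ^ 2)
      (2 * inner ℝ (X t η - Y t η) (v t η)) (Icc 0 T) t := fun t ht η =>
    ((hX.ode t ht η).sub (hY.ode t ht η)).norm_sq
  have hcont : ContinuousOn (fun t => M * k * ‖w t - u t‖ ^ 2) (Icc 0 T) :=
    continuousOn_const.mul ((hw.sub hu).norm.pow 2)
  have h := le_exp_mul_of_hasDerivWithinAt_le (L := (4 + 4 * M) * k) (by positivity)
    (fun t ht => hf.hasDerivWithinAt_integral hf' hd ht) hcont (fun t _ => by positivity)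
    (fun t ht => ?_) ht
  · rwa [max_eq_left (integral_nonneg fun _ => sq_nonneg _),
      intervalIntegral.integral_const_mul] at h
  · -- The derivative is estimated with `(E|X-Y|)² ≤ E|X-Y|²` and Young's inequality.
    set δ := ∫ η, ‖X t η - Y t η‖ ∂P with hδ
    have hδ0 : 0 ≤ δ := integral_nonneg fun _ => norm_nonneg _
    have hJ : δ ^ 2 ≤ ∫ η, ‖X t η - Y t η‖ ^ 2 ∂P := sq_integral_le (hmem t ht).norm
    have hI1 := (hmem t ht).norm.integrable (by norm_num : (1 : ℝ≥0∞) ≤ 2)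
    have hI2 := (hmem t ht).norm.integrable_sq
    have hp : ∀ η, 2 * inner ℝ (X t η - Y t η) (v t η)
        ≤ (2 * V + M * k) * ‖X t η - Y t η‖ ^ 2 + 2 * k * δ * ‖X t η - Y t η‖
          + M * k * ‖w t - u t‖ ^ 2 := fun η => by
      have h3 := norm_velocity_map_sub_le h₁ h₂ (hX.memLp h₁ h₂ ht) (hY.memLp h₁ h₂ ht)
        (w t) (u t) (X t η) (Y t η)
      have h4 := real_inner_le_norm (X t η - Y t η) (v t η)
      have h5 : inner ℝ (X t η - Y t η) (v t η) ≤ ‖X t η - Y t η‖ *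
          ((1 + M) * k * ‖X t η - Y t η‖ + k * δ + M * k * ‖w t - u t‖) :=
        h4.trans (mul_le_mul_of_nonneg_left h3 (norm_nonneg _))
      have h6 : 0 ≤ M * k * (‖X t η - Y t η‖ - ‖w t - u t‖) ^ 2 := by positivity
      rw [hV]
      nlinarith
    have hi1 : Integrable (fun η => (2 * V + M * k) * ‖X t η - Y t η‖ ^ 2) P := hI2.const_mul _
    have hi2 : Integrable (fun η => 2 * k * δ * ‖X t η - Y t η‖) P := hI1.const_mul _
    have hle : ∫ η, 2 * inner ℝ (X t η - Y t η) (v t η) ∂P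
        ≤ ∫ η, ((2 * V + M * k) * ‖X t η - Y t η‖ ^ 2 + 2 * k * δ * ‖X t η - Y t η‖
          + M * k * ‖w t - u t‖ ^ 2) ∂P :=
      integral_mono (hf'.integrable ht) ((hi1.add hi2).add (integrable_const _)) hp
    rw [integral_add (f := fun η => (2 * V + M * k) * ‖X t η - Y t η‖ ^ 2
      + 2 * k * δ * ‖X t η - Y t η‖) (hi1.add hi2) (integrable_const _), integral_add hi1 hi2,
      integral_const_mul (2 * V + M * k), integral_const_mul (2 * k * δ), ← hδ,
      integral_const] at hle
    simp only [probReal_univ, one_smul] at hle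
    refine hle.trans ?_
    have hE : 0 ≤ ∫ η, ‖X t η - Y t η‖ ^ 2 ∂P := integral_nonneg fun _ => sq_nonneg _
    have hk2 : 2 * k * δ * δ ≤ 2 * k * ∫ η, ‖X t η - Y t η‖ ^ 2 ∂P := by nlinarith
    have hMk : 0 ≤ M * k * ∫ η, ‖X t η - Y t η‖ ^ 2 ∂P := by positivity
    rw [hV]
    linarith

end stability

/-! ### The adjoint velocity along a random trajectory -/

section adjoint

variable {d M m : ℕ} {k T a B Λ : ℝ} {K₁ K₂ : Space d → Space d} {Ω : Type*} [MeasurableSpace Ω]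
  {P : Measure Ω} [IsProbabilityMeasure P] {j : (Fin m → ℝ) → ℝ} {g : Fin m → Space d → ℝ}

/-- The function `H = ∑_l ∂_l j g_l + E⟨ξ(Z), K₁(Z - ·)⟩`, for `Z` with law `μ`, whose gradient is
the part of `Ψ(μ,u)[ξ]` that does not involve the value of `ξ` at the point. -/
noncomputable def adjointSource (P : Measure Ω) (K₁ : Space d → Space d) (j : (Fin m → ℝ) → ℝ)
    (g : Fin m → Space d → ℝ) (Z : Ω → Space d) (ξ : Space d → Space d) (x : Space d) : ℝ :=
  ∑ l, fderiv ℝ j (moments g (P.map Z)) (Pi.single l 1) * g l x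
    + ∫ η, inner ℝ (ξ (Z η)) (K₁ (Z η - x)) ∂P

/-- The gradient of `adjointSource`. -/
noncomputable def adjointForce (P : Measure Ω) (K₁ : Space d → Space d) (j : (Fin m → ℝ) → ℝ)
    (g : Fin m → Space d → ℝ) (Z : Ω → Space d) (ξ : Space d → Space d) (x : Space d) : Space d :=
  deltaJ₁ j g (P.map Z) x
    - ∫ η, ContinuousLinearMap.adjoint (fderiv ℝ K₁ (Z η - x)) (ξ (Z η)) ∂P

theorem norm_adjoint_apply_le {A : Space d →L[ℝ] Space d} {y : Space d} {c b : ℝ} (hA : ‖A‖ ≤ c)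
    (hy : ‖y‖ ≤ b) : ‖ContinuousLinearMap.adjoint A y‖ ≤ c * b := by
  refine ((ContinuousLinearMap.adjoint A).le_opNorm y).trans ?_
  rw [LinearIsometryEquiv.norm_map]
  exact mul_le_mul hA hy (norm_nonneg _) ((norm_nonneg _).trans hA)

theorem norm_deltaJ₁_le (hg : MomentBound a g) {μ : Measure (Space d)} {c : ℝ}
    (hc : ‖fderiv ℝ j (moments g μ)‖ ≤ c) (x : Space d) :
    ‖deltaJ₁ j g μ x‖ ≤ m * (c * (a * (1 + ‖x‖))) := by
  refine norm_sum_fin_le fun l => ?_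
  rw [norm_smul]
  refine mul_le_mul ?_ (hg.norm_gradient_le l x) (norm_nonneg _) ((norm_nonneg _).trans hc)
  refine (ContinuousLinearMap.le_opNorm _ _).trans ?_
  rw [Pi.norm_single, norm_one, mul_one]
  exact hc

theorem adjointRHS_map (h₁ : KernelBound k K₁) (h₂ : KernelBound k K₂) {Z : Ω → Space d}
    (hZ : AEStronglyMeasurable Z P) {ξ : Space d → Space d} (hξ : Continuous ξ)
    (u : ControlSpace d M) (x : Space d) :
    adjointRHS K₁ K₂ j g (P.map Z) u ξ x
      = -(ContinuousLinearMap.adjoint (velocityDeriv K₁ K₂ (P.map Z) u x) (ξ x))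
        + adjointForce P K₁ j g Z ξ x := by
  have : IsProbabilityMeasure (P.map Z) := Measure.isProbabilityMeasure_map hZ.aemeasurable
  have hc : Continuous fun y => ContinuousLinearMap.adjoint (fderiv ℝ K₁ (y - x)) (ξ y) :=
    (ContinuousLinearMap.adjoint.continuous.comp
      (h₁.continuous_fderiv.comp (continuous_id.sub continuous_const))).clm_apply hξ
  unfold adjointRHS adjointForce
  rw [(hasFDerivAt_velocity h₁ h₂ (P.map Z) u x).fderiv,
    integral_map hZ.aemeasurable hc.aestronglyMeasurable]
  abel

theorem IsAdjointVelocity.congr {μ ν : ℝ → Measure (Space d)} {u : ℝ → ControlSpace d M}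
    {ξ : ℝ → Space d → Space d} (h : IsAdjointVelocity T K₁ K₂ j g μ u ξ)
    (hμ : ∀ t ∈ Icc 0 T, μ t = ν t) : IsAdjointVelocity T K₁ K₂ j g ν u ξ := by
  obtain ⟨Q, hQ, hr⟩ := h.representation
  refine ⟨h.continuousOn, Q, fun s hs x => ⟨(hQ s hs x).1, fun t ht => ?_⟩, fun t ht x => ?_⟩
  · simp only [← hμ t ht]
    exact (hQ s hs x).2 t ht
  · rw [hr t ht x]
    refine congrArg Neg.neg (intervalIntegral.integral_congr fun s hs => ?_)
    rw [uIcc_of_le ht.2] at hs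
    simp only [hμ s ⟨ht.1.trans hs.1, hs.2⟩]

theorem integrable_inner_kernel (h₁ : KernelBound k K₁) {Z : Ω → Space d}
    (hZ : AEStronglyMeasurable Z P) {ξ : Space d → Space d} (hξ : Continuous ξ)
    (hB : ∀ x, ‖ξ x‖ ≤ B) (x : Space d) :
    Integrable (fun η => inner ℝ (ξ (Z η)) (K₁ (Z η - x))) P :=
  integrable_of_continuous_of_norm_le (c := B * k)
    ((hξ.comp_aestronglyMeasurable hZ).inner (𝕜 := ℝ)
      (h₁.continuous.comp_aestronglyMeasurable (hZ.sub aestronglyMeasurable_const)))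
    fun _ => (norm_inner_le_norm _ _).trans
      (mul_le_mul (hB _) (h₁.norm_le _) (norm_nonneg _) ((norm_nonneg _).trans (hB 0)))

theorem integrable_adjoint_kernel (h₁ : KernelBound k K₁) {Z : Ω → Space d}
    (hZ : AEStronglyMeasurable Z P) {ξ : Space d → Space d} (hξ : Continuous ξ)
    (hB : ∀ x, ‖ξ x‖ ≤ B) (x : Space d) :
    Integrable (fun η => ContinuousLinearMap.adjoint (fderiv ℝ K₁ (Z η - x)) (ξ (Z η))) P := by
  refine integrable_of_continuous_of_norm_le (c := k * B) ?_
    fun η => norm_adjoint_apply_le (h₁.norm_fderiv_le _) (hB _)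
  have hc : Continuous fun y => ContinuousLinearMap.adjoint (fderiv ℝ K₁ (y - x)) (ξ y) :=
    (ContinuousLinearMap.adjoint.continuous.comp
      (h₁.continuous_fderiv.comp (continuous_id.sub continuous_const))).clm_apply hξ
  exact hc.comp_aestronglyMeasurable hZ

theorem abs_adjointSource_interaction_sub_le (h₁ : KernelBound k K₁) {Z : Ω → Space d}
    (hZ : AEStronglyMeasurable Z P) {ξ : Space d → Space d} (hξ : Continuous ξ)
    (hB : ∀ x, ‖ξ x‖ ≤ B) (x y : Space d) :
    |(∫ η, inner ℝ (ξ (Z η)) (K₁ (Z η - x)) ∂P) - (∫ η, inner ℝ (ξ (Z η)) (K₁ (Z η - y)) ∂P)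
      + inner ℝ (∫ η, ContinuousLinearMap.adjoint (fderiv ℝ K₁ (Z η - y)) (ξ (Z η)) ∂P) (x - y)|
      ≤ B * (k * ‖x - y‖ ^ 2) := by
  have hi := integrable_adjoint_kernel h₁ hZ hξ hB y
  have hx := integrable_inner_kernel h₁ hZ hξ hB x
  have hy := integrable_inner_kernel h₁ hZ hξ hB y
  have e : (∫ η, inner ℝ (ξ (Z η)) (K₁ (Z η - x)) ∂P)
      - (∫ η, inner ℝ (ξ (Z η)) (K₁ (Z η - y)) ∂P)
      + inner ℝ (∫ η, ContinuousLinearMap.adjoint (fderiv ℝ K₁ (Z η - y)) (ξ (Z η)) ∂P) (x - y)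
      = ∫ η, inner ℝ (ξ (Z η)) (K₁ (Z η - x) - K₁ (Z η - y)
        - fderiv ℝ K₁ (Z η - y) ((Z η - x) - (Z η - y))) ∂P := by
    rw [real_inner_comm, ← integral_inner hi, ← integral_sub hx hy,
      ← integral_add (f := fun η => inner ℝ (ξ (Z η)) (K₁ (Z η - x))
        - inner ℝ (ξ (Z η)) (K₁ (Z η - y))) (hx.sub hy) (hi.const_inner _)]
    refine integral_congr_ae (Eventually.of_forall fun η => ?_)
    simp only
    rw [real_inner_comm _ (x - y), ContinuousLinearMap.adjoint_inner_left, sub_sub_sub_cancel_left,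
      inner_sub_right, inner_sub_right, ← neg_sub x y, map_neg, inner_neg_right]
    ring
  rw [e, ← Real.norm_eq_abs]
  refine norm_integral_le_of_bound fun η => (norm_inner_le_norm _ _).trans
    (mul_le_mul (hB _) ((h₁.taylor _ _).trans_eq ?_) (norm_nonneg _)
      ((norm_nonneg _).trans (hB 0)))
  rw [sub_sub_sub_cancel_left, norm_sub_rev]

/-- Uniform first-order Taylor expansion of the functions `g_l` on bounded sets. -/
theorem MomentBound.exists_taylor (hg : MomentBound a g) (r : ℝ) {ε : ℝ} (hε : 0 < ε) :
    ∃ δ > 0, ∀ l, ∀ x y : Space d, ‖x‖ ≤ r → ‖y‖ ≤ r → ‖x - y‖ ≤ δ →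
      |g l x - g l y - inner ℝ (gradient (g l) y) (x - y)| ≤ ε * ‖x - y‖ := by
  have hK : IsCompact (Metric.closedBall (0 : Space d) r) := isCompact_closedBall _ _
  have hc : Continuous fun x l => gradient (g l) x :=
    continuous_pi fun l => continuous_gradient_of_contDiff_one (hg.contDiff l)
  obtain ⟨δ, hδ, h⟩ := Metric.uniformContinuousOn_iff.1
    (hK.uniformContinuousOn_of_continuous hc.continuousOn) ε hε
  refine ⟨δ / 2, by positivity, fun l x y hx hy hxy => ?_⟩
  have hx' : x ∈ Metric.closedBall (0 : Space d) r := by simpa using hx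
  have hy' : y ∈ Metric.closedBall (0 : Space d) r := by simpa using hy
  refine (convex_segment y x).norm_image_sub_le_of_norm_hasFDerivWithin_le'
    (f := g l) (φ := innerSL ℝ (gradient (g l) y)) (C := ε)
    (fun z _ => (hasFDerivAt_of_contDiff_one (hg.contDiff l) z).hasFDerivWithinAt)
    (fun z hz => ?_) (left_mem_segment ℝ y x) (right_mem_segment ℝ y x)
  rw [← map_sub, innerSL_apply_norm]
  have hz' : z ∈ Metric.closedBall (0 : Space d) r :=
    (convex_closedBall (0 : Space d) r).segment_subset hy' hx' hz
  have hzy : dist z y < δ := by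
    rw [dist_eq_norm]
    exact (norm_sub_le_of_mem_segment hz).trans_lt (by linarith)
  have := (dist_le_pi_dist _ _ l).trans_lt (h z hz' y hy' hzy)
  rw [dist_eq_norm] at this
  exact this.le

variable {u : ℝ → ControlSpace d M} {Y : ℝ → Ω → Space d} {ξ : ℝ → Space d → Space d}

theorem IsMcKean.continuousOn_fderiv_moments (hY : IsMcKean P T K₁ K₂ u Y)
    (h₁ : KernelBound k K₁) (h₂ : KernelBound k K₂) (hg : MomentBound a g)
    (hj : ContDiff ℝ 2 j) :
    ContinuousOn (fun t => fderiv ℝ j (moments g (P.map (Y t)))) (Icc 0 T) :=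
  (hj.continuous_fderiv (by norm_num)).comp_continuousOn (hY.continuousOn_moments h₁ h₂ hg)

theorem IsMcKean.continuousOn_adjointSource (hY : IsMcKean P T K₁ K₂ u Y)
    (h₁ : KernelBound k K₁) (h₂ : KernelBound k K₂) (hg : MomentBound a g) (hj : ContDiff ℝ 2 j)
    (hξc : ContinuousOn (fun p : ℝ × Space d => ξ p.1 p.2) (Icc 0 T ×ˢ univ))
    (hξ : ∀ t ∈ Icc 0 T, Continuous (ξ t)) (hB : ∀ t ∈ Icc 0 T, ∀ x, ‖ξ t x‖ ≤ B) :
    ContinuousOn (fun p : ℝ × Space d => adjointSource P K₁ j g (Y p.1) (ξ p.1) p.2)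
      (Icc 0 T ×ˢ univ) := by
  have hfst : ∀ {p : ℝ × Space d}, p ∈ Icc 0 T ×ˢ (univ : Set (Space d)) → p.1 ∈ Icc 0 T :=
    fun hp => hp.1
  have hYc : ∀ η, ContinuousOn (fun p : ℝ × Space d => Y p.1 η) (Icc 0 T ×ˢ univ) := fun η =>
    (hY.continuousOn η).comp continuousOn_fst fun _ hp => hp.1
  unfold adjointSource
  refine ContinuousOn.add (continuousOn_finsetSum _ fun l _ => ?_) ?_
  · exact (((hY.continuousOn_fderiv_moments h₁ h₂ hg hj).comp continuousOn_fst
      fun _ hp => hp.1).clm_apply continuousOn_const).mul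
      ((hg.contDiff l).continuous.comp continuous_snd).continuousOn
  · refine continuousOn_of_dominated (bound := fun _ => B * k)
      (fun p hp => (integrable_inner_kernel h₁ (hY.measurable _ (hfst hp)).aestronglyMeasurable
        (hξ _ (hfst hp)) (hB _ (hfst hp)) p.2).aestronglyMeasurable)
      (fun p hp => Eventually.of_forall fun η => (norm_inner_le_norm _ _).trans
        (mul_le_mul (hB _ (hfst hp) _) (h₁.norm_le _) (norm_nonneg _)
          ((norm_nonneg _).trans (hB _ (hfst hp) 0))))
      (integrable_const _) (Eventually.of_forall fun η => ?_)
    refine ContinuousOn.inner (𝕜 := ℝ) ?_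
      (h₁.continuous.comp_continuousOn ((hYc η).sub continuousOn_snd))
    exact hξc.comp (continuousOn_fst.prodMk (hYc η)) fun p hp => ⟨hp.1, mem_univ _⟩

theorem IsMcKean.continuousOn_adjointForce (hY : IsMcKean P T K₁ K₂ u Y)
    (h₁ : KernelBound k K₁) (h₂ : KernelBound k K₂) (hg : MomentBound a g) (hj : ContDiff ℝ 2 j)
    (hξc : ContinuousOn (fun p : ℝ × Space d => ξ p.1 p.2) (Icc 0 T ×ˢ univ))
    (hξ : ∀ t ∈ Icc 0 T, Continuous (ξ t)) (hB : ∀ t ∈ Icc 0 T, ∀ x, ‖ξ t x‖ ≤ B) :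
    ContinuousOn (fun p : ℝ × Space d => adjointForce P K₁ j g (Y p.1) (ξ p.1) p.2)
      (Icc 0 T ×ˢ univ) := by
  have hfst : ∀ {p : ℝ × Space d}, p ∈ Icc 0 T ×ˢ (univ : Set (Space d)) → p.1 ∈ Icc 0 T :=
    fun hp => hp.1
  have hYc : ∀ η, ContinuousOn (fun p : ℝ × Space d => Y p.1 η) (Icc 0 T ×ˢ univ) := fun η =>
    (hY.continuousOn η).comp continuousOn_fst fun _ hp => hp.1
  unfold adjointForce deltaJ₁
  refine ContinuousOn.sub (continuousOn_finsetSum _ fun l _ => ?_) ?_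
  · exact (((hY.continuousOn_fderiv_moments h₁ h₂ hg hj).comp continuousOn_fst
      fun _ hp => hp.1).clm_apply continuousOn_const).smul
      ((continuous_gradient_of_contDiff_one (hg.contDiff l)).comp continuous_snd).continuousOn
  · refine continuousOn_of_dominated (bound := fun _ => k * B)
      (fun p hp => (integrable_adjoint_kernel h₁ (hY.measurable _ (hfst hp)).aestronglyMeasurable
        (hξ _ (hfst hp)) (hB _ (hfst hp)) p.2).aestronglyMeasurable)
      (fun p hp => Eventually.of_forall fun η =>
        norm_adjoint_apply_le (h₁.norm_fderiv_le _) (hB _ (hfst hp) _))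
      (integrable_const _) (Eventually.of_forall fun η => ?_)
    refine ContinuousOn.clm_apply (ContinuousLinearMap.adjoint.continuous.comp_continuousOn
      (h₁.continuous_fderiv.comp_continuousOn ((hYc η).sub continuousOn_snd))) ?_
    exact hξc.comp (continuousOn_fst.prodMk (hYc η)) fun p hp => ⟨hp.1, mem_univ _⟩

/-- The adjoint velocity of a pair whose measure is the law of a random trajectory. -/
theorem IsMcKean.exists_isAdjointSystem (hY : IsMcKean P T K₁ K₂ u Y)
    (hu : ContinuousOn u (Icc 0 T)) (h₁ : KernelBound k K₁) (h₂ : KernelBound k K₂)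
    (hg : MomentBound a g) (hj : ContDiff ℝ 2 j)
    (h : IsAdjointVelocity T K₁ K₂ j g (fun t => P.map (Y t)) u ξ)
    (hB : ∀ t ∈ Icc 0 T, ∀ x, ‖ξ t x‖ ≤ B)
    (hΛ : ∀ t ∈ Icc 0 T, ∀ x y, ‖ξ t x - ξ t y‖ ≤ Λ * ‖x - y‖) :
    ∃ Q, IsAdjointSystem T ((1 + M) * k) B Λ (fun t => velocity K₁ K₂ (P.map (Y t)) (u t))
      (fun t => velocityDeriv K₁ K₂ (P.map (Y t)) (u t)) Q
      (fun t => adjointSource P K₁ j g (Y t) (ξ t)) (fun t => adjointForce P K₁ j g (Y t) (ξ t))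
      ξ := by
  have hk := h₁.nonneg
  obtain ⟨Q, hQ, hr⟩ := h.representation
  have hξ : ∀ t ∈ Icc 0 T, Continuous (ξ t) := fun t ht => continuous_of_norm_sub_le (hΛ t ht)
  have hm : ∀ t ∈ Icc 0 T, AEStronglyMeasurable (Y t) P := fun t ht =>
    (hY.measurable t ht).aestronglyMeasurable
  refine ⟨Q, ?_⟩
  constructor
  case c_nonneg => positivity
  case norm_le =>
    intro t ht
    have := hY.isProbabilityMeasure_map ht
    exact norm_velocity_le h₁ h₂ _ _
  case lip =>
    intro t ht
    have := hY.isProbabilityMeasure_map ht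
    exact norm_velocity_sub_le h₁ h₂ _ _
  case taylor =>
    intro t ht
    have := hY.isProbabilityMeasure_map ht
    exact velocity_taylor h₁ h₂ _ _
  case flow => exact hQ
  case continuousOn_b => exact continuousOn_velocity_uncurry hY h₁ h₂ hu
  case continuousOn_H => exact hY.continuousOn_adjointSource h₁ h₂ hg hj h.continuousOn hξ hB
  case taylor_H =>
    intro r ε hε
    obtain ⟨c, hc⟩ := isCompact_Icc.exists_bound_of_continuousOn
      (hY.continuousOn_fderiv_moments h₁ h₂ hg hj)
    obtain ⟨δ, hδ, hgδ⟩ := hg.exists_taylor r (ε := ε / 2 / (m * |c| + 1)) (by positivity)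
    refine ⟨min δ (ε / 2 / (|B| * k + 1)), by positivity, fun t ht x y hx hy hxy => ?_⟩
    have h1 := abs_adjointSource_interaction_sub_le h₁ (hm t ht) (hξ t ht) (hB t ht) x y
    set θ := fun l => fderiv ℝ j (moments g (P.map (Y t))) (Pi.single l 1) with hθ
    have hθc : ∀ l, |θ l| ≤ |c| := fun l => by
      refine (ContinuousLinearMap.le_opNorm (fderiv ℝ j (moments g (P.map (Y t)))) _).trans ?_
      rw [Pi.norm_single, norm_one, mul_one]
      exact (hc t ht).trans (le_abs_self c)
    have h2 : ‖∑ l, θ l * (g l x - g l y - inner ℝ (gradient (g l) y) (x - y))‖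
        ≤ m * (|c| * (ε / 2 / (m * |c| + 1) * ‖x - y‖)) := norm_sum_fin_le fun l => by
      rw [norm_mul]
      exact mul_le_mul (hθc l) (hgδ l x y hx hy (hxy.trans (min_le_left _ _))) (norm_nonneg _)
        (abs_nonneg c)
    have e : adjointSource P K₁ j g (Y t) (ξ t) x - adjointSource P K₁ j g (Y t) (ξ t) y
        - inner ℝ (adjointForce P K₁ j g (Y t) (ξ t) y) (x - y)
        = (∑ l, θ l * (g l x - g l y - inner ℝ (gradient (g l) y) (x - y)))
        + ((∫ η, inner ℝ (ξ t (Y t η)) (K₁ (Y t η - x)) ∂P)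
          - (∫ η, inner ℝ (ξ t (Y t η)) (K₁ (Y t η - y)) ∂P)
          + inner ℝ (∫ η, ContinuousLinearMap.adjoint (fderiv ℝ K₁ (Y t η - y))
            (ξ t (Y t η)) ∂P) (x - y)) := by
      unfold adjointSource adjointForce deltaJ₁
      simp only [inner_sub_left, sum_inner, real_inner_smul_left, mul_sub,
        Finset.sum_sub_distrib, hθ]
      ring
    have hxy0 := norm_nonneg (x - y)
    have h3 : m * (|c| * (ε / 2 / (m * |c| + 1) * ‖x - y‖)) ≤ ε / 2 * ‖x - y‖ := by
      have : m * |c| * (ε / 2 / (m * |c| + 1)) ≤ ε / 2 := by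
        rw [mul_div_assoc', div_le_iff₀ (by positivity)]
        nlinarith [abs_nonneg c, mul_nonneg (Nat.cast_nonneg (α := ℝ) m) (abs_nonneg c)]
      nlinarith
    have h4 : B * (k * ‖x - y‖ ^ 2) ≤ ε / 2 * ‖x - y‖ := by
      have h5 : ‖x - y‖ ≤ ε / 2 / (|B| * k + 1) := hxy.trans (min_le_right _ _)
      rw [le_div_iff₀ (by positivity)] at h5
      have h6 : B * k ≤ |B| * k := mul_le_mul_of_nonneg_right (le_abs_self B) hk
      have h7 : B * k * ‖x - y‖ ≤ ε / 2 := by nlinarith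
      nlinarith
    rw [e]
    refine (norm_add_le_of_le h2 h1).trans ?_
    linarith
  case continuousOn_ξ => exact h.continuousOn
  case continuousOn_rhs =>
    refine ContinuousOn.add (ContinuousOn.neg (ContinuousOn.clm_apply
      (ContinuousLinearMap.adjoint.continuous.comp_continuousOn ?_) h.continuousOn))
      (hY.continuousOn_adjointForce h₁ h₂ hg hj h.continuousOn hξ hB)
    exact continuousOn_velocityDeriv h₁ h₂ (Z := fun p : ℝ × Space d => Y p.1)
      (fun η => (hY.continuousOn η).comp continuousOn_fst fun _ hp => hp.1)
      (fun p hp => hm p.1 hp.1) (hu.comp continuousOn_fst fun _ hp => hp.1) continuousOn_snd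
  case norm_ξ_le => exact hB
  case lip_ξ => exact hΛ
  case representation =>
    intro t ht x
    rw [hr t ht x]
    refine congrArg Neg.neg (intervalIntegral.integral_congr fun s hs => ?_)
    rw [uIcc_of_le ht.2] at hs
    have hs' : s ∈ Icc 0 T := ⟨ht.1.trans hs.1, hs.2⟩
    exact adjointRHS_map h₁ h₂ (hm s hs') (hξ s hs') (u s) _

end adjoint

/-! ### A growth bound for the adjoint velocity -/

section growth

variable {d M m : ℕ} {k T a A B Λ c r : ℝ} {K₁ K₂ : Space d → Space d} {Ω : Type*}
  [MeasurableSpace Ω] {P : Measure Ω} [IsProbabilityMeasure P] {j : (Fin m → ℝ) → ℝ}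
  {g : Fin m → Space d → ℝ}

/-- A backward Grönwall argument for fields of linear growth. The a priori bound `B` does not enter
the conclusion: it only ensures that the set of admissible constants is nonempty, and that set is
stable under `S ↦ S / 2 + A * T`. -/
theorem norm_le_of_backward_growth {ξ : ℝ → Space d → Space d} {f : ℝ → ℝ → Space d → Space d}
    (hT : 0 ≤ T) (hA : 0 ≤ A) (hB : ∀ t ∈ Icc 0 T, ∀ x, ‖ξ t x‖ ≤ B)
    (hξ : ∀ t ∈ Icc 0 T, ∀ x, ξ t x = -∫ s in t..T, f t s x)
    (hf : ∀ s ∈ Icc 0 T, ∀ σ : ℝ, 0 ≤ σ → (∀ x, ‖ξ s x‖ ≤ σ * (1 + ‖x‖)) →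
      ∀ t ∈ Icc 0 T, ∀ x, ‖f t s x‖ ≤ A * (σ + 1) * (1 + ‖x‖)) :
    ∀ t ∈ Icc 0 T, ∀ x, ‖ξ t x‖ ≤ (2 * A * T + 1) * Real.exp (2 * A * T) * (1 + ‖x‖) := by
  let 𝒮 : Set ℝ := {S | 0 ≤ S ∧ ∀ t ∈ Icc 0 T, ∀ x,
    ‖ξ t x‖ ≤ S * Real.exp (2 * A * (T - t)) * (1 + ‖x‖)}
  have hB0 : 0 ≤ B := (norm_nonneg _).trans (hB 0 ⟨le_rfl, hT⟩ 0)
  have hne : B ∈ 𝒮 := ⟨hB0, fun t ht x => (hB t ht x).trans (by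
    have h1 : 1 ≤ Real.exp (2 * A * (T - t)) :=
      Real.one_le_exp (mul_nonneg (by positivity) (sub_nonneg.2 ht.2))
    have h2 : 1 ≤ Real.exp (2 * A * (T - t)) * (1 + ‖x‖) :=
      one_le_mul_of_one_le_of_one_le h1 (by linarith [norm_nonneg x])
    nlinarith)⟩
  have hbdd : BddBelow 𝒮 := ⟨0, fun S hS => hS.1⟩
  have hstep : ∀ S ∈ 𝒮, S / 2 + A * T ∈ 𝒮 := by
    rintro S ⟨hS0, hS⟩
    refine ⟨by positivity, fun t ht x => ?_⟩
    have hd : ∀ s ∈ uIcc t T, HasDerivAt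
        (fun s => (-(S / 2 * Real.exp (2 * A * (T - s))) + A * s) * (1 + ‖x‖))
        (A * (S * Real.exp (2 * A * (T - s)) + 1) * (1 + ‖x‖)) s := fun s _ => by
      have h1 : HasDerivAt (fun s : ℝ => Real.exp (2 * A * (T - s)))
          (Real.exp (2 * A * (T - s)) * (2 * A * (-1))) s :=
        (((hasDerivAt_id s).const_sub T).const_mul (2 * A)).exp
      have h2 := (((h1.const_mul (S / 2)).neg.add ((hasDerivAt_id s).const_mul A)).mul_const
        (1 + ‖x‖))
      refine h2.congr_deriv ?_
      ring
    have hcont : Continuous fun s : ℝ => A * (S * Real.exp (2 * A * (T - s)) + 1) * (1 + ‖x‖) := by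
      fun_prop
    have hI := intervalIntegral.integral_eq_sub_of_hasDerivAt hd (hcont.intervalIntegrable t T)
    rw [hξ t ht x, norm_neg]
    refine (intervalIntegral.norm_integral_le_of_norm_le ht.2
      (g := fun s => A * (S * Real.exp (2 * A * (T - s)) + 1) * (1 + ‖x‖))
      (Eventually.of_forall fun s hs => ?_) (hcont.intervalIntegrable t T)).trans ?_
    · exact hf s ⟨ht.1.trans hs.1.le, hs.2⟩ _ (by positivity)
        (hS s ⟨ht.1.trans hs.1.le, hs.2⟩) t ht x
    · rw [hI, sub_self, mul_zero, Real.exp_zero, ← sub_mul]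
      refine mul_le_mul_of_nonneg_right ?_ (by positivity)
      have h1 : 1 ≤ Real.exp (2 * A * (T - t)) :=
        Real.one_le_exp (mul_nonneg (by positivity) (sub_nonneg.2 ht.2))
      have h2 : A * T * 1 ≤ A * T * Real.exp (2 * A * (T - t)) := by gcongr
      have h3 : 0 ≤ A * t := mul_nonneg hA ht.1
      linarith
  have hinf : sInf 𝒮 ≤ 2 * A * T := by
    have h1 : 2 * (sInf 𝒮 - A * T) ≤ sInf 𝒮 := le_csInf ⟨B, hne⟩ fun S hS => by
      have := csInf_le hbdd (hstep S hS)
      linarith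
    linarith
  obtain ⟨S, ⟨hS0, hS⟩, hlt⟩ :=
    exists_lt_of_csInf_lt ⟨B, hne⟩ (hinf.trans_lt (lt_add_one (2 * A * T)))
  intro t ht x
  refine (hS t ht x).trans (mul_le_mul_of_nonneg_right ?_ (by positivity))
  refine mul_le_mul hlt.le (Real.exp_le_exp.2 ?_) (Real.exp_nonneg _) (by positivity)
  exact mul_le_mul_of_nonneg_left (by linarith [ht.1]) (by positivity)

variable {u : ℝ → ControlSpace d M} {Y : ℝ → Ω → Space d} {ξ : ℝ → Space d → Space d}
  {Q : ℝ → ℝ → Space d → Space d}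

theorem integral_norm_le_one_add {Z : Ω → Space d} (hZ : MemLp Z 2 P)
    (hr : ∫ η, ‖Z η‖ ^ 2 ∂P ≤ r) : ∫ η, ‖Z η‖ ∂P ≤ 1 + r := by
  have hi := hZ.norm.integrable_sq
  have h : ∫ η, ‖Z η‖ ∂P ≤ ∫ η, (1 + ‖Z η‖ ^ 2) ∂P :=
    integral_mono (hZ.norm.integrable (by norm_num)) ((integrable_const _).add hi) fun η => by
      have := sq_nonneg (‖Z η‖ - 1)
      simp only
      nlinarith [norm_nonneg (Z η)]
  rw [integral_add (integrable_const _) hi] at h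
  simp only [integral_const, probReal_univ, one_smul] at h
  linarith

/-- The growth constant of the adjoint velocity: `c` bounds the derivative of `j` on the relevant
moments and `r` the second moments of the mean-field trajectory. -/
noncomputable def adjointRate (M m : ℕ) (k T a c r : ℝ) : ℝ :=
  ((1 + M) * k + m * (c * a)) * (1 + (1 + M) * k * T) + k * (2 + r)

/-- The adjoint velocity grows at most linearly, with a constant that does not depend on its
supremum. -/
theorem IsMcKean.norm_adjoint_le (hT : 0 ≤ T) (hY : IsMcKean P T K₁ K₂ u Y)
    (h₁ : KernelBound k K₁) (h₂ : KernelBound k K₂) (hg : MomentBound a g)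
    (S : IsAdjointSystem T ((1 + M) * k) B Λ (fun t => velocity K₁ K₂ (P.map (Y t)) (u t))
      (fun t => velocityDeriv K₁ K₂ (P.map (Y t)) (u t)) Q
      (fun t => adjointSource P K₁ j g (Y t) (ξ t)) (fun t => adjointForce P K₁ j g (Y t) (ξ t)) ξ)
    (hr : ∀ t ∈ Icc 0 T, ∫ η, ‖Y t η‖ ^ 2 ∂P ≤ r)
    (hc : ∀ t ∈ Icc 0 T, ‖fderiv ℝ j (moments g (P.map (Y t)))‖ ≤ c) {t : ℝ} (ht : t ∈ Icc 0 T)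
    (x : Space d) :
    ‖ξ t x‖ ≤ (2 * adjointRate M m k T a c r * T + 1)
      * Real.exp (2 * adjointRate M m k T a c r * T) * (1 + ‖x‖) := by
  have hk := h₁.nonneg
  have ha := hg.nonneg
  have hc0 : 0 ≤ c := (norm_nonneg _).trans (hc t ht)
  have hr0 : 0 ≤ r := (integral_nonneg fun _ => sq_nonneg _).trans (hr t ht)
  have hV0 : 0 ≤ (1 + M) * k := by positivity
  refine norm_le_of_backward_growth hT (by unfold adjointRate; positivity) S.norm_ξ_le
    (f := fun t s x => -(ContinuousLinearMap.adjoint (velocityDeriv K₁ K₂ (P.map (Y s)) (u s)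
      (Q s t x)) (ξ s (Q s t x))) + adjointForce P K₁ j g (Y s) (ξ s) (Q s t x))
    S.representation (fun s hs σ hσ hξσ t ht x => ?_) t ht x
  have hp := hY.isProbabilityMeasure_map hs
  have hq : 1 + ‖Q s t x‖ ≤ (1 + (1 + M) * k * T) * (1 + ‖x‖) := by
    have h1 := S.norm_flow_le ht hs x
    have h2 : 0 ≤ (1 + M) * k * T * ‖x‖ := by positivity
    linarith
  have h1 : ‖ContinuousLinearMap.adjoint (velocityDeriv K₁ K₂ (P.map (Y s)) (u s) (Q s t x))
      (ξ s (Q s t x))‖ ≤ (1 + M) * k * (σ * (1 + ‖Q s t x‖)) :=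
    norm_adjoint_apply_le (norm_velocityDeriv_le h₁ h₂ _ _ _) (hξσ _)
  have h2 := norm_deltaJ₁_le hg (hc s hs) (Q s t x)
  have hYs := (hY.memLp h₁ h₂ hs).norm.integrable (by norm_num : (1 : ℝ≥0∞) ≤ 2)
  have h3 : ‖∫ η, ContinuousLinearMap.adjoint (fderiv ℝ K₁ (Y s η - Q s t x)) (ξ s (Y s η)) ∂P‖
      ≤ k * (σ * (2 + r)) := by
    refine (norm_integral_le_of_norm_le ((((integrable_const 1).add hYs).const_mul σ).const_mul k)
      (Eventually.of_forall fun η =>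
        norm_adjoint_apply_le (h₁.norm_fderiv_le _) (hξσ (Y s η)))).trans ?_
    rw [integral_const_mul, integral_const_mul]
    gcongr
    refine (integral_add (integrable_const 1) hYs).trans_le ?_
    have := integral_norm_le_one_add (hY.memLp h₁ h₂ hs) (hr s hs)
    simp only [integral_const, probReal_univ, one_smul]
    linarith
  unfold adjointForce adjointRate
  refine (norm_add_le_of_le ((norm_neg _).trans_le h1) (norm_sub_le_of_le h2 h3)).trans ?_
  have h4 : ((1 + M) * k * σ + m * (c * a)) * (1 + ‖Q s t x‖)
      ≤ ((1 + M) * k * σ + m * (c * a)) * ((1 + (1 + M) * k * T) * (1 + ‖x‖)) :=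
    mul_le_mul_of_nonneg_left hq (by positivity)
  have h5 : ((1 + M) * k * σ + m * (c * a)) * ((1 + (1 + M) * k * T) * (1 + ‖x‖))
      ≤ ((1 + M) * k + m * (c * a)) * (σ + 1) * ((1 + (1 + M) * k * T) * (1 + ‖x‖)) := by
    refine mul_le_mul_of_nonneg_right ?_ (by positivity)
    have : 0 ≤ m * (c * a) * σ := by positivity
    linarith
  have h6 : k * (σ * (2 + r)) ≤ k * (2 + r) * (σ + 1) * (1 + ‖x‖) := by
    have e : k * (σ * (2 + r)) = k * (2 + r) * σ * 1 := by ring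
    rw [e]
    gcongr
    · linarith
    · linarith [norm_nonneg x]
  linarith

end growth

/-! ### Second-order expansion of the running cost -/

/-- The Cauchy-Schwarz inequality. -/
theorem sq_integral_mul_le {Ω : Type*} [MeasurableSpace Ω] {P : Measure Ω} {f h : Ω → ℝ} (hf : MemLp f 2 P)
    (hh : MemLp h 2 P) :
    (∫ η, f η * h η ∂P) ^ 2 ≤ (∫ η, f η ^ 2 ∂P) * ∫ η, h η ^ 2 ∂P := by
  have hi1 := hf.integrable_sq
  have hi2 := hh.integrable_sq
  have hi3 : Integrable (fun η => f η * h η) P := hf.integrable_mul hh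
  have hq : ∀ s : ℝ, 0 ≤ (∫ η, h η ^ 2 ∂P) * (s * s) + (-2 * ∫ η, f η * h η ∂P) * s
      + ∫ η, f η ^ 2 ∂P := fun s => by
    have h1 : 0 ≤ ∫ η, (s ^ 2 * h η ^ 2 + -2 * s * (f η * h η) + f η ^ 2) ∂P :=
      integral_nonneg fun η => by
        have := sq_nonneg (f η - s * h η)
        simp only [Pi.zero_apply]
        linarith
    rw [integral_add (f := fun η => s ^ 2 * h η ^ 2 + -2 * s * (f η * h η))
      ((hi2.const_mul _).add (hi3.const_mul _)) hi1,
      integral_add (hi2.const_mul _) (hi3.const_mul _), integral_const_mul,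
      integral_const_mul] at h1
    linarith
  have := discrim_le_zero hq
  unfold discrim at this
  linarith

section expansion

variable {d M m : ℕ} {k a A B Λ c r : ℝ} {K₁ K₂ : Space d → Space d} {Ω : Type*}
  [MeasurableSpace Ω] {P : Measure Ω} [IsProbabilityMeasure P] {j : (Fin m → ℝ) → ℝ}
  {g : Fin m → Space d → ℝ} {X Y : Ω → Space d} {ξ : Space d → Space d}

theorem integrable_inner_comp (hX : StronglyMeasurable X) (hξ : Continuous ξ)
    (hB : ∀ x, ‖ξ x‖ ≤ B) {f : Space d → Space d} {σ : ℝ} (hf : Continuous f)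
    (hσ : ∀ x, ‖f x‖ ≤ σ) : Integrable (fun η => inner ℝ (ξ (X η)) (f (X η))) P :=
  integrable_of_continuous_of_norm_le (c := B * σ)
    ((hξ.comp_stronglyMeasurable hX).inner (𝕜 := ℝ)
      (hf.comp_stronglyMeasurable hX)).aestronglyMeasurable
    fun _ => (norm_inner_le_norm _ _).trans
      (mul_le_mul (hB _) (hσ _) (norm_nonneg _) ((norm_nonneg _).trans (hB 0)))

/-- If `f` and its Lipschitz constant are of first order `q * β`, then replacing `Y` by `X` in
`E⟨ξ(Y), f(Y)⟩` makes an error of second order. -/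
theorem abs_integral_inner_comp_sub_le (hX : StronglyMeasurable X) (hY : StronglyMeasurable Y)
    (hX2 : MemLp X 2 P) (hY2 : MemLp Y 2 P) (hr : ∫ η, ‖Y η‖ ^ 2 ∂P ≤ r)
    (hΛ : ∀ x y, ‖ξ x - ξ y‖ ≤ Λ * ‖x - y‖) (hA : ∀ x, ‖ξ x‖ ≤ A * (1 + ‖x‖))
    (hB : ∀ x, ‖ξ x‖ ≤ B) {f : Space d → Space d} {q β : ℝ} (hq : 0 ≤ q)
    (hf : ∀ x, ‖f x‖ ≤ q * β) (hfl : ∀ x y, ‖f x - f y‖ ≤ q * β * ‖x - y‖) :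
    |(∫ η, inner ℝ (ξ (X η)) (f (X η)) ∂P) - ∫ η, inner ℝ (ξ (Y η)) (f (Y η)) ∂P|
      ≤ q * ((∫ η, ‖X η - Y η‖ ^ 2 ∂P) + β ^ 2 * (2 * (Λ + A) ^ 2 + 2 * A ^ 2 * r)) := by
  have hξ := continuous_of_norm_sub_le hΛ
  have hfc := continuous_of_norm_sub_le hfl
  have hi := (hX2.sub hY2).norm.integrable_sq
  have hiY := hY2.norm.integrable_sq
  rw [← integral_sub (integrable_inner_comp hX hξ hB hfc hf)
    (integrable_inner_comp hY hξ hB hfc hf), ← Real.norm_eq_abs]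
  refine (norm_integral_le_of_norm_le ((hi.add (((integrable_const (2 * (Λ + A) ^ 2)).add
    (hiY.const_mul (2 * A ^ 2))).const_mul (β ^ 2))).const_mul q)
    (Eventually.of_forall fun η => ?_)).trans ?_
  · have e : inner ℝ (ξ (X η)) (f (X η)) - inner ℝ (ξ (Y η)) (f (Y η))
        = inner ℝ (ξ (X η) - ξ (Y η)) (f (X η)) + inner ℝ (ξ (Y η)) (f (X η) - f (Y η)) := by
      rw [inner_sub_left, inner_sub_right]; ring
    have h1 : ‖inner ℝ (ξ (X η) - ξ (Y η)) (f (X η))‖ ≤ Λ * ‖X η - Y η‖ * (q * β) :=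
      (norm_inner_le_norm _ _).trans (mul_le_mul (hΛ _ _) (hf _) (norm_nonneg _)
        ((norm_nonneg _).trans (hΛ _ _)))
    have h2 : ‖inner ℝ (ξ (Y η)) (f (X η) - f (Y η))‖
        ≤ A * (1 + ‖Y η‖) * (q * β * ‖X η - Y η‖) :=
      (norm_inner_le_norm _ _).trans (mul_le_mul (hA _) (hfl _ _) (norm_nonneg _)
        ((norm_nonneg _).trans (hA _)))
    rw [e]
    refine (norm_add_le_of_le h1 h2).trans ?_
    simp only [Pi.add_apply, Pi.sub_apply]
    have e2 : Λ * ‖X η - Y η‖ * (q * β) + A * (1 + ‖Y η‖) * (q * β * ‖X η - Y η‖)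
        = q * (‖X η - Y η‖ * (β * (Λ + A + A * ‖Y η‖))) := by ring
    rw [e2]
    refine mul_le_mul_of_nonneg_left ?_ hq
    have h3 := two_mul_le_add_sq ‖X η - Y η‖ (β * (Λ + A + A * ‖Y η‖))
    have h4 : (Λ + A + A * ‖Y η‖) ^ 2 ≤ 2 * (Λ + A) ^ 2 + 2 * A ^ 2 * ‖Y η‖ ^ 2 := by
      nlinarith [sq_nonneg (Λ + A - A * ‖Y η‖)]
    have h5 := mul_le_mul_of_nonneg_left h4 (sq_nonneg β)
    have h6 : 0 ≤ (β * (Λ + A + A * ‖Y η‖)) ^ 2 := sq_nonneg _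
    have h7 := sq_nonneg ‖X η - Y η‖
    rw [mul_pow] at h3 h6
    linarith
  · rw [integral_const_mul]
    refine mul_le_mul_of_nonneg_left ?_ hq
    refine (integral_add hi (((integrable_const (2 * (Λ + A) ^ 2)).add
      (hiY.const_mul (2 * A ^ 2))).const_mul (β ^ 2))).trans_le ?_
    refine add_le_add le_rfl ?_
    rw [integral_const_mul]
    refine mul_le_mul_of_nonneg_left ?_ (sq_nonneg β)
    refine (integral_add (integrable_const (2 * (Λ + A) ^ 2))
      (hiY.const_mul (2 * A ^ 2))).trans_le ?_
    rw [integral_const_mul (2 * A ^ 2), integral_const]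
    simp only [probReal_univ, one_smul]
    have := mul_le_mul_of_nonneg_left hr (by positivity : 0 ≤ 2 * A ^ 2)
    linarith

theorem norm_moments_sub_sq_le (hg : MomentBound a g) (hX2 : MemLp X 2 P) (hY2 : MemLp Y 2 P)
    (hrX : ∫ η, ‖X η‖ ^ 2 ∂P ≤ r) (hrY : ∫ η, ‖Y η‖ ^ 2 ∂P ≤ r) :
    ‖moments g (P.map X) - moments g (P.map Y)‖ ^ 2
      ≤ 3 * a ^ 2 * (1 + 2 * r) * ∫ η, ‖X η - Y η‖ ^ 2 ∂P := by
  have ha := hg.nonneg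
  have hr0 : 0 ≤ r := (integral_nonneg fun _ => sq_nonneg _).trans hrX
  have he0 : 0 ≤ ∫ η, ‖X η - Y η‖ ^ 2 ∂P := integral_nonneg fun _ => sq_nonneg _
  have hgi : ∀ l, ∀ Z : Ω → Space d, MemLp Z 2 P → Integrable (fun η => g l (Z η)) P :=
    fun l Z hZ => (((integrable_const (1 : ℝ)).add hZ.norm.integrable_sq).const_mul a).mono'
      ((hg.contDiff l).continuous.comp_aestronglyMeasurable hZ.aestronglyMeasurable)
      (Eventually.of_forall fun η => hg.abs_le l _)
  have hm : ∀ l, ∀ Z : Ω → Space d, MemLp Z 2 P →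
      moments g (P.map Z) l = ∫ η, g l (Z η) ∂P := fun l Z hZ =>
    integral_map hZ.aestronglyMeasurable.aemeasurable
      (hg.contDiff l).continuous.aestronglyMeasurable
  have hG : MemLp (fun η => a * (1 + ‖X η‖ + ‖Y η‖)) 2 P :=
    (((memLp_const (1 : ℝ)).add hX2.norm).add hY2.norm).const_mul a
  have hGi : ∫ η, (a * (1 + ‖X η‖ + ‖Y η‖)) ^ 2 ∂P ≤ 3 * a ^ 2 * (1 + 2 * r) := by
    have hi := ((integrable_const (1 : ℝ)).add hX2.norm.integrable_sq).add hY2.norm.integrable_sq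
    refine (integral_mono hG.integrable_sq (hi.const_mul (3 * a ^ 2)) fun η => ?_).trans ?_
    · simp only [Pi.add_apply]
      have : (1 + ‖X η‖ + ‖Y η‖) ^ 2 ≤ 3 * (1 + ‖X η‖ ^ 2 + ‖Y η‖ ^ 2) := by
        nlinarith [sq_nonneg (‖X η‖ - 1), sq_nonneg (‖Y η‖ - 1), sq_nonneg (‖X η‖ - ‖Y η‖)]
      nlinarith [mul_le_mul_of_nonneg_left this (sq_nonneg a)]
    · rw [integral_const_mul]
      refine mul_le_mul_of_nonneg_left ?_ (by positivity)
      refine (integral_add ((integrable_const (1 : ℝ)).add hX2.norm.integrable_sq)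
        hY2.norm.integrable_sq).trans_le ?_
      refine (add_le_add_left (integral_add (integrable_const (1 : ℝ))
        hX2.norm.integrable_sq).le _).trans ?_
      simp only [integral_const, probReal_univ, one_smul]
      linarith
  have hl : ∀ l, (moments g (P.map X) l - moments g (P.map Y) l) ^ 2
      ≤ 3 * a ^ 2 * (1 + 2 * r) * ∫ η, ‖X η - Y η‖ ^ 2 ∂P := fun l => by
    have h1 : |moments g (P.map X) l - moments g (P.map Y) l|
        ≤ ∫ η, a * (1 + ‖X η‖ + ‖Y η‖) * ‖X η - Y η‖ ∂P := by
      rw [hm l X hX2, hm l Y hY2, ← integral_sub (hgi l X hX2) (hgi l Y hY2),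
        ← Real.norm_eq_abs]
      exact norm_integral_le_of_norm_le (hG.integrable_mul (hX2.sub hY2).norm)
        (Eventually.of_forall fun η => hg.abs_sub_le l _ _)
    rw [← sq_abs]
    refine (pow_le_pow_left₀ (abs_nonneg _) h1 2).trans
      ((sq_integral_mul_le hG (hX2.sub hY2).norm).trans ?_)
    exact mul_le_mul_of_nonneg_right hGi he0
  have hn : ‖moments g (P.map X) - moments g (P.map Y)‖
      ≤ √(3 * a ^ 2 * (1 + 2 * r) * ∫ η, ‖X η - Y η‖ ^ 2 ∂P) :=
    (pi_norm_le_iff_of_nonneg (Real.sqrt_nonneg _)).2 fun l => Real.abs_le_sqrt (hl l)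
  refine (pow_le_pow_left₀ (norm_nonneg _) hn 2).trans_eq (Real.sq_sqrt ?_)
  positivity

/-- The expectation of the adjoint source along `X`. The order of the two expectations in its
interaction part is exchanged. -/
theorem integral_adjointSource (hX : StronglyMeasurable X) (hY : StronglyMeasurable Y)
    (hX2 : MemLp X 2 P) (h₁ : KernelBound k K₁) (hg : MomentBound a g) (hξ : Continuous ξ)
    (hB : ∀ x, ‖ξ x‖ ≤ B) :
    Integrable (fun η => adjointSource P K₁ j g Y ξ (X η)) P ∧
    ∫ η, adjointSource P K₁ j g Y ξ (X η) ∂P = fderiv ℝ j (moments g (P.map Y))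
      (moments g (P.map X)) + ∫ η', inner ℝ (ξ (Y η')) (∫ η, K₁ (Y η' - X η) ∂P) ∂P := by
  have hk := h₁.nonneg
  have hgi : ∀ l, Integrable (fun η => g l (X η)) P :=
    fun l => (((integrable_const (1 : ℝ)).add hX2.norm.integrable_sq).const_mul a).mono'
      ((hg.contDiff l).continuous.comp_aestronglyMeasurable hX.aestronglyMeasurable)
      (Eventually.of_forall fun η => hg.abs_le l _)
  have hprod : Integrable (Function.uncurry fun η η' => inner ℝ (ξ (Y η')) (K₁ (Y η' - X η)))
      (P.prod P) := by
    refine integrable_of_continuous_of_norm_le (c := B * k) ?_ fun p =>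
      (norm_inner_le_norm _ _).trans
      (mul_le_mul (hB _) (h₁.norm_le _) (norm_nonneg _) ((norm_nonneg _).trans (hB 0)))
    exact ((hξ.comp_stronglyMeasurable (hY.comp_measurable measurable_snd)).inner (𝕜 := ℝ)
      (h₁.continuous.comp_stronglyMeasurable ((hY.comp_measurable measurable_snd).sub
        (hX.comp_measurable measurable_fst)))).aestronglyMeasurable
  have hs : Integrable (fun η => ∑ l, fderiv ℝ j (moments g (P.map Y)) (Pi.single l 1)
      * g l (X η)) P := integrable_finsetSum _ fun l _ => (hgi l).const_mul _
  have hs' : Integrable (fun η => ∫ η', inner ℝ (ξ (Y η')) (K₁ (Y η' - X η)) ∂P) P :=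
    hprod.integral_prod_left
  refine ⟨hs.add hs', ?_⟩
  unfold adjointSource
  rw [integral_add hs hs', integral_integral_swap hprod]
  congr 1
  · rw [integral_finsetSum _ fun l _ => (hgi l).const_mul _]
    have := LinearMap.pi_apply_eq_sum_univ
      (fderiv ℝ j (moments g (P.map Y))).toLinearMap (moments g (P.map X))
    rw [ContinuousLinearMap.coe_coe] at this
    rw [this]
    refine Finset.sum_congr rfl fun l _ => ?_
    rw [integral_const_mul, smul_eq_mul, mul_comm]
    have e1 : moments g (P.map X) l = ∫ η, g l (X η) ∂P :=
      integral_map hX.aestronglyMeasurable.aemeasurable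
        (hg.contDiff l).continuous.aestronglyMeasurable
    have e2 : (Pi.single l 1 : Fin m → ℝ) = fun i => if l = i then 1 else 0 := by
      ext i
      simp [Pi.single_apply, eq_comm]
    rw [e1, e2]
  · refine integral_congr_ae (Eventually.of_forall fun η' => ?_)
    have := integrable_of_continuous_of_norm_le (P := P) (f := fun η => K₁ (Y η' - X η))
      (h₁.continuous.comp_aestronglyMeasurable
        (aestronglyMeasurable_const.sub hX.aestronglyMeasurable)) fun _ => h₁.norm_le _
    exact integral_inner this _

/-- The constant of the second-order expansion of the running cost. -/
noncomputable def expansionConst (M : ℕ) (k a A Λ c r : ℝ) : ℝ :=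
  c * (3 * a ^ 2 * (1 + 2 * r)) + (1 + M) * k * (1 + (2 * (Λ + A) ^ 2 + 2 * A ^ 2 * r))

/-- Up to second order, the running cost at the law of `X` differs from the one at the law of `Y`
by the increment of the adjoint functional and the first-order effect of the controls. -/
theorem abs_cost_sub_le (hX : StronglyMeasurable X) (hY : StronglyMeasurable Y)
    (hX2 : MemLp X 2 P) (hY2 : MemLp Y 2 P) (hrX : ∫ η, ‖X η‖ ^ 2 ∂P ≤ r)
    (hrY : ∫ η, ‖Y η‖ ^ 2 ∂P ≤ r) (h₁ : KernelBound k K₁) (h₂ : KernelBound k K₂)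
    (hg : MomentBound a g) (hc : 0 ≤ c)
    (hj : |j (moments g (P.map X)) - j (moments g (P.map Y)) - fderiv ℝ j (moments g (P.map Y))
      (moments g (P.map X) - moments g (P.map Y))|
      ≤ c * ‖moments g (P.map X) - moments g (P.map Y)‖ ^ 2)
    (hΛ : ∀ x y, ‖ξ x - ξ y‖ ≤ Λ * ‖x - y‖) (hA : ∀ x, ‖ξ x‖ ≤ A * (1 + ‖x‖))
    (hB : ∀ x, ‖ξ x‖ ≤ B) (w u : ControlSpace d M) :
    |J₁ j g (P.map X) - J₁ j g (P.map Y)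
      - ((∫ η, (adjointSource P K₁ j g Y ξ (X η) + inner ℝ (ξ (X η))
          (velocity K₁ K₂ (P.map X) w (X η) - velocity K₁ K₂ (P.map Y) u (X η))) ∂P)
        - ∫ η, adjointSource P K₁ j g Y ξ (Y η) ∂P)
      - ∫ η, inner ℝ (ξ (Y η)) (∑ l, (K₂ (Y η - w l) - K₂ (Y η - u l))) ∂P|
      ≤ expansionConst M k a A Λ c r * ((∫ η, ‖X η - Y η‖ ^ 2 ∂P) + ‖w - u‖ ^ 2) := by
  have hk := h₁.nonneg
  have hξ := continuous_of_norm_sub_le hΛ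
  have hr0 : 0 ≤ r := (integral_nonneg fun _ => sq_nonneg _).trans hrX
  set e := ∫ η, ‖X η - Y η‖ ^ 2 ∂P with he
  have he0 : 0 ≤ e := integral_nonneg fun _ => sq_nonneg _
  set β := ∫ η, ‖X η - Y η‖ ∂P with hβ
  have hβ0 : 0 ≤ β := integral_nonneg fun _ => norm_nonneg _
  have hβe : β ^ 2 ≤ e := sq_integral_le (hX2.sub hY2).norm
  have hi1 : Integrable (fun η => ‖X η - Y η‖) P :=
    (hX2.sub hY2).norm.integrable (by norm_num)
  have hKX : ∀ x, Integrable (fun η => K₁ (x - X η)) P :=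
    integrable_kernel_comp hX.aestronglyMeasurable h₁
  have hKY : ∀ x, Integrable (fun η => K₁ (x - Y η)) P :=
    integrable_kernel_comp hY.aestronglyMeasurable h₁
  -- The change of the velocity splits into the parts `κ`, due to the measure, and `-S`, due to the
  -- control.
  let κ : Space d → Space d := fun x => -∫ η, (K₁ (x - X η) - K₁ (x - Y η)) ∂P
  let S : Space d → Space d := fun x => ∑ l, (K₂ (x - w l) - K₂ (x - u l))
  have hv : ∀ x, velocity K₁ K₂ (P.map X) w x - velocity K₁ K₂ (P.map Y) u x = κ x - S x :=
    fun x => velocity_map_sub hX.aestronglyMeasurable hY.aestronglyMeasurable h₁ w u x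
  have hκb : ∀ x, ‖κ x‖ ≤ k * β := fun x => by
    rw [norm_neg, ← integral_const_mul]
    refine norm_integral_le_of_norm_le (hi1.const_mul k)
      (Eventually.of_forall fun η => (h₁.lip _ _).trans_eq ?_)
    rw [sub_sub_sub_cancel_left, norm_sub_rev]
  have hκl : ∀ x y, ‖κ x - κ y‖ ≤ k * β * ‖x - y‖ := fun x y => by
    have e1 : κ x - κ y = -∫ η, ((K₁ (x - X η) - K₁ (x - Y η))
        - (K₁ (y - X η) - K₁ (y - Y η))) ∂P := by
      rw [integral_sub (f := fun η => K₁ (x - X η) - K₁ (x - Y η))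
        (g := fun η => K₁ (y - X η) - K₁ (y - Y η)) ((hKX x).sub (hKY x)) ((hKX y).sub (hKY y))]
      simp only [κ]
      abel
    have e2 : k * β * ‖x - y‖ = ∫ η, k * ‖X η - Y η‖ * ‖x - y‖ ∂P := by
      rw [integral_mul_const, integral_const_mul]
    rw [e1, norm_neg, e2]
    exact norm_integral_le_of_norm_le ((hi1.const_mul k).mul_const _)
      (Eventually.of_forall fun η => h₁.second_difference _ _ _ _)
  have hwu : ∀ l, ‖w l - u l‖ ≤ ‖w - u‖ := fun l => PiLp.norm_apply_le (w - u) l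
  have hSb : ∀ x, ‖S x‖ ≤ M * k * ‖w - u‖ := fun x => by
    rw [mul_assoc]
    refine norm_sum_fin_le fun l => (h₂.lip _ _).trans ?_
    rw [sub_sub_sub_cancel_left, norm_sub_rev]
    exact mul_le_mul_of_nonneg_left (hwu l) hk
  have hSl : ∀ x y, ‖S x - S y‖ ≤ M * k * ‖w - u‖ * ‖x - y‖ := fun x y => by
    simp only [S]
    rw [← Finset.sum_sub_distrib, mul_assoc, mul_assoc]
    refine norm_sum_fin_le fun l => (h₂.second_difference _ _ _ _).trans ?_
    rw [mul_assoc]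
    exact mul_le_mul_of_nonneg_left (mul_le_mul_of_nonneg_right (hwu l) (norm_nonneg _)) hk
  have h1 := abs_integral_inner_comp_sub_le hX hY hX2 hY2 hrY hΛ hA hB hk hκb hκl
  have h2 := abs_integral_inner_comp_sub_le hX hY hX2 hY2 hrY hΛ hA hB
    (by positivity : 0 ≤ M * k) hSb hSl
  have h3 := hj.trans (mul_le_mul_of_nonneg_left
    (norm_moments_sub_sq_le hg hX2 hY2 hrX hrY) hc)
  obtain ⟨hiX, hEX⟩ := integral_adjointSource (j := j) hX hY hX2 h₁ hg hξ hB
  obtain ⟨-, hEY⟩ := integral_adjointSource (j := j) hY hY hY2 h₁ hg hξ hB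
  have hκX := integrable_inner_comp (P := P) hX hξ hB (continuous_of_norm_sub_le hκl) hκb
  have hSX := integrable_inner_comp (P := P) hX hξ hB (continuous_of_norm_sub_le hSl) hSb
  have hinner : ∫ η, inner ℝ (ξ (Y η)) (κ (Y η)) ∂P
      = (∫ η', inner ℝ (ξ (Y η')) (∫ η, K₁ (Y η' - Y η) ∂P) ∂P)
        - ∫ η', inner ℝ (ξ (Y η')) (∫ η, K₁ (Y η' - X η) ∂P) ∂P := by
    have hIc : ∀ Z : Ω → Space d, StronglyMeasurable Z →
        Integrable (fun η' => inner ℝ (ξ (Y η')) (∫ η, K₁ (Y η' - Z η) ∂P)) P := fun Z hZ => by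
      have hKZ : ∀ x, Integrable (fun η => K₁ (x - Z η)) P :=
        integrable_kernel_comp hZ.aestronglyMeasurable h₁
      refine integrable_inner_comp (f := fun x => ∫ η, K₁ (x - Z η) ∂P) hY hξ hB
        (continuous_of_norm_sub_le (c := k) fun x y => ?_)
        (fun x => norm_integral_le_of_bound fun η => h₁.norm_le _)
      rw [← integral_sub (hKZ x) (hKZ y)]
      exact norm_integral_le_of_bound fun η => (h₁.lip _ _).trans_eq (by
        rw [sub_sub_sub_cancel_right])
    rw [← integral_sub (hIc Y hY) (hIc X hX)]
    refine integral_congr_ae (Eventually.of_forall fun η' => ?_)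
    simp only [κ]
    rw [integral_sub (hKX _) (hKY _), ← inner_sub_right, neg_sub]
  have hsplit : ∫ η, (adjointSource P K₁ j g Y ξ (X η) + inner ℝ (ξ (X η))
      (velocity K₁ K₂ (P.map X) w (X η) - velocity K₁ K₂ (P.map Y) u (X η))) ∂P
      = (∫ η, adjointSource P K₁ j g Y ξ (X η) ∂P)
        + ((∫ η, inner ℝ (ξ (X η)) (κ (X η)) ∂P) - ∫ η, inner ℝ (ξ (X η)) (S (X η)) ∂P) := by
    rw [← integral_sub hκX hSX, ← integral_add (g := fun η => inner ℝ (ξ (X η)) (κ (X η))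
      - inner ℝ (ξ (X η)) (S (X η))) hiX (hκX.sub hSX)]
    refine integral_congr_ae (Eventually.of_forall fun η => ?_)
    simp only [hv, inner_sub_right]
  rw [hsplit, hEX, hEY]
  unfold J₁
  rw [map_sub] at h3
  set D := 2 * (Λ + A) ^ 2 + 2 * A ^ 2 * r with hD
  have hD0 : 0 ≤ D := by positivity
  have h4 : k * (e + β ^ 2 * D) ≤ k * (1 + D) * (e + ‖w - u‖ ^ 2) := by
    have h5 : β ^ 2 * D ≤ e * D := mul_le_mul_of_nonneg_right hβe hD0
    have h6 : e + β ^ 2 * D ≤ (1 + D) * (e + ‖w - u‖ ^ 2) := by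
      have : 0 ≤ (1 + D) * ‖w - u‖ ^ 2 := by positivity
      linarith
    rw [mul_assoc]
    exact mul_le_mul_of_nonneg_left h6 hk
  have h5 : M * k * (e + ‖w - u‖ ^ 2 * D) ≤ M * k * (1 + D) * (e + ‖w - u‖ ^ 2) := by
    rw [mul_assoc _ (1 + D)]
    refine mul_le_mul_of_nonneg_left ?_ (by positivity)
    have h6 : 0 ≤ D * e := by positivity
    have h7 : 0 ≤ ‖w - u‖ ^ 2 := by positivity
    linarith
  have h6 : c * (3 * a ^ 2 * (1 + 2 * r) * e)
      ≤ c * (3 * a ^ 2 * (1 + 2 * r)) * (e + ‖w - u‖ ^ 2) := by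
    have : 0 ≤ c * (3 * a ^ 2 * (1 + 2 * r)) * ‖w - u‖ ^ 2 := by positivity
    linarith
  unfold expansionConst
  rw [← hD]
  rw [abs_le] at h1 h2 h3 ⊢
  constructor <;> linarith [h1.1, h1.2, h2.1, h2.2, h3.1, h3.2]

end expansion

/-! ### Comparison of four trajectories -/

section comparison

variable {d M m : ℕ} {k T a B Λ c r R : ℝ} {K₁ K₂ : Space d → Space d} {Ω : Type*}
  [MeasurableSpace Ω] {P : Measure Ω} {j : (Fin m → ℝ) → ℝ}
  {g : Fin m → Space d → ℝ} {u v w : ℝ → ControlSpace d M} {X Y X₁ X₂ X₃ : ℝ → Ω → Space d}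
  {ξ : ℝ → Space d → Space d} {Q : ℝ → ℝ → Space d → Space d}

/-- The adjoint functional of a trajectory `X`: the expectation of the adjoint source along `X`,
corrected by the adjoint velocity paired with the deviation of the speed of `X` from the mean-field
velocity at `Y`. -/
noncomputable def adjointFunctional (P : Measure Ω) (K₁ K₂ : Space d → Space d)
    (j : (Fin m → ℝ) → ℝ) (g : Fin m → Space d → ℝ) (Y : Ω → Space d) (u : ControlSpace d M)
    (ξ : Space d → Space d) (X : Ω → Space d) (w : ControlSpace d M) : ℝ :=
  ∫ η, (adjointSource P K₁ j g Y ξ (X η) + inner ℝ (ξ (X η))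
    (velocity K₁ K₂ (P.map X) w (X η) - velocity K₁ K₂ (P.map Y) u (X η))) ∂P

theorem adjointFunctional_self (Y : Ω → Space d) (u : ControlSpace d M) (ξ : Space d → Space d) :
    adjointFunctional P K₁ K₂ j g Y u ξ Y u = ∫ η, adjointSource P K₁ j g Y ξ (Y η) ∂P := by
  simp [adjointFunctional]

variable [IsProbabilityMeasure P]

theorem abs_adjointSource_le (h₁ : KernelBound k K₁) (hg : MomentBound a g) {Z : Ω → Space d}
    {ζ : Space d → Space d} (hB : ∀ x, ‖ζ x‖ ≤ B)
    (hc : ‖fderiv ℝ j (moments g (P.map Z))‖ ≤ c) (x : Space d) :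
    ‖adjointSource P K₁ j g Z ζ x‖ ≤ (m * (c * a) + B * k) * (1 + ‖x‖ ^ 2) := by
  have hk := h₁.nonneg
  have hB0 : 0 ≤ B := (norm_nonneg _).trans (hB 0)
  have h1 : ‖∑ l, fderiv ℝ j (moments g (P.map Z)) (Pi.single l 1) * g l x‖
      ≤ m * (c * (a * (1 + ‖x‖ ^ 2))) := norm_sum_fin_le fun l => by
    rw [norm_mul]
    refine mul_le_mul ?_ (hg.abs_le l x) (norm_nonneg _) ((norm_nonneg _).trans hc)
    refine (ContinuousLinearMap.le_opNorm _ _).trans ?_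
    rw [Pi.norm_single, norm_one, mul_one]
    exact hc
  have h2 : ‖∫ η, inner ℝ (ζ (Z η)) (K₁ (Z η - x)) ∂P‖ ≤ B * k :=
    norm_integral_le_of_bound fun η => (norm_inner_le_norm _ _).trans
      (mul_le_mul (hB _) (h₁.norm_le _) (norm_nonneg _) hB0)
  refine (norm_add_le_of_le h1 h2).trans ?_
  have : 0 ≤ B * k * ‖x‖ ^ 2 := by positivity
  linarith

theorem IsMcKean.timeDominated_adjointFunctional (hX : IsMcKean P T K₁ K₂ w X)
    (hY : IsMcKean P T K₁ K₂ u Y) (h₁ : KernelBound k K₁) (h₂ : KernelBound k K₂)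
    (hg : MomentBound a g) (hj : ContDiff ℝ 2 j) (hw : ContinuousOn w (Icc 0 T))
    (S : IsAdjointSystem T ((1 + M) * k) B Λ (fun t => velocity K₁ K₂ (P.map (Y t)) (u t))
      (fun t => velocityDeriv K₁ K₂ (P.map (Y t)) (u t)) Q
      (fun t => adjointSource P K₁ j g (Y t) (ξ t)) (fun t => adjointForce P K₁ j g (Y t) (ξ t))
      ξ) :
    TimeDominated P T fun t η => adjointSource P K₁ j g (Y t) (ξ t) (X t η)
      + inner ℝ (ξ t (X t η)) (velocity K₁ K₂ (P.map (X t)) (w t) (X t η)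
        - velocity K₁ K₂ (P.map (Y t)) (u t) (X t η)) := by
  obtain ⟨c, hc⟩ := isCompact_Icc.exists_bound_of_continuousOn
    (hY.continuousOn_fderiv_moments h₁ h₂ hg hj)
  refine hX.timeDominated_comp h₁ h₂ (F := fun t x => adjointSource P K₁ j g (Y t) (ξ t) x
    + inner ℝ (ξ t x) (velocity K₁ K₂ (P.map (X t)) (w t) x
      - velocity K₁ K₂ (P.map (Y t)) (u t) x))
    (A := m * (c * a) + B * k + B * ((1 + M) * k + (1 + M) * k)) ?_ fun t ht x => ?_
  · exact S.continuousOn_H.add (S.continuousOn_ξ.inner (𝕜 := ℝ)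
      ((continuousOn_velocity_uncurry hX h₁ h₂ hw).sub S.continuousOn_b))
  · have := hX.isProbabilityMeasure_map ht
    have hB0 : 0 ≤ B := (norm_nonneg _).trans (S.norm_ξ_le t ht 0)
    have hk := h₁.nonneg
    have h3 := abs_adjointSource_le h₁ hg (S.norm_ξ_le t ht) (hc t ht) x
    have h4 : ‖inner ℝ (ξ t x) (velocity K₁ K₂ (P.map (X t)) (w t) x
        - velocity K₁ K₂ (P.map (Y t)) (u t) x)‖ ≤ B * ((1 + M) * k + (1 + M) * k) :=
      (norm_inner_le_norm _ _).trans (mul_le_mul (S.norm_ξ_le t ht x)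
        (norm_sub_le_of_le (norm_velocity_le h₁ h₂ _ _ _) (S.norm_le t ht x)) (norm_nonneg _) hB0)
    refine (norm_add_le_of_le h3 h4).trans ?_
    have : 0 ≤ B * ((1 + M) * k + (1 + M) * k) * ‖x‖ ^ 2 := by positivity
    linarith

/-- The time integral of the adjoint functional depends on the initial state only. -/
theorem IsMcKean.integral_adjointFunctional (hX : IsMcKean P T K₁ K₂ w X)
    (hY : IsMcKean P T K₁ K₂ u Y) (h₁ : KernelBound k K₁) (h₂ : KernelBound k K₂)
    (hg : MomentBound a g) (hj : ContDiff ℝ 2 j) (hT : 0 ≤ T) (hΛ : 0 ≤ Λ)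
    (hw : ContinuousOn w (Icc 0 T))
    (S : IsAdjointSystem T ((1 + M) * k) B Λ (fun t => velocity K₁ K₂ (P.map (Y t)) (u t))
      (fun t => velocityDeriv K₁ K₂ (P.map (Y t)) (u t)) Q
      (fun t => adjointSource P K₁ j g (Y t) (ξ t)) (fun t => adjointForce P K₁ j g (Y t) (ξ t))
      ξ) :
    ContinuousOn (fun t => adjointFunctional P K₁ K₂ j g (Y t) (u t) (ξ t) (X t) (w t))
      (Icc 0 T) ∧
    ∫ t in (0 : ℝ)..T, adjointFunctional P K₁ K₂ j g (Y t) (u t) (ξ t) (X t) (w t)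
      = ∫ η, potential T Q (fun t => adjointSource P K₁ j g (Y t) (ξ t)) 0 (X 0 η) ∂P := by
  have hd := hX.timeDominated_adjointFunctional hY h₁ h₂ hg hj hw S
  refine ⟨hd.continuousOn_integral, (hd.integral_swap hT).trans ?_⟩
  refine integral_congr_ae (Eventually.of_forall fun η => ?_)
  exact S.integral_curve_eq hT hΛ (fun t ht => hX.ode t ht η)
    (continuousOn_velocity h₁ h₂ hX.continuousOn
      (fun t ht => (hX.measurable t ht).aestronglyMeasurable) hw (hX.continuousOn η))

theorem IsMcKean.continuousOn_cost (hX : IsMcKean P T K₁ K₂ w X) (h₁ : KernelBound k K₁)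
    (h₂ : KernelBound k K₂) (hg : MomentBound a g) (hj : ContDiff ℝ 2 j) :
    ContinuousOn (fun t => J₁ j g (P.map (X t))) (Icc 0 T) :=
  hj.continuous.comp_continuousOn (hX.continuousOn_moments h₁ h₂ hg)

/-- The constant in the linear growth bound of the adjoint velocity. -/
noncomputable def adjointGrowth (M m : ℕ) (k T a c r : ℝ) : ℝ :=
  (2 * adjointRate M m k T a c r * T + 1) * Real.exp (2 * adjointRate M m k T a c r * T)

/-- The constant of the comparison of four trajectories. -/
noncomputable def comparisonConst (M m : ℕ) (k T a Λ c r : ℝ) : ℝ :=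
  adjointGrowth M m k T a c r * (2 + r) * (M * k)
    + 3 * expansionConst M k a (adjointGrowth M m k T a c r) Λ c r
      * (1 + T * (Real.exp ((4 + 4 * M) * k * T) * (1 + M * k)))

/-- The comparison of four trajectories. Both trajectories `X₁`, `X₃` use the midpoint `w` of the
controls `v` of `X₂` and `u` of `Y`. The first-order terms in the expansion of the costs around `Y`
cancel: the adjoint functionals because the initial states agree in pairs, the effect of the
controls because `w` is the midpoint. -/
theorem integral_cost_comparison_le (hT : 0 < T) (h₁ : KernelBound k K₁) (h₂ : KernelBound k K₂)
    (hg : MomentBound a g) (hj : ContDiff ℝ 2 j) (hΛ : 0 ≤ Λ)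
    (hX₁ : IsMcKean P T K₁ K₂ w X₁) (hX₂ : IsMcKean P T K₁ K₂ v X₂)
    (hX₃ : IsMcKean P T K₁ K₂ w X₃) (hY : IsMcKean P T K₁ K₂ u Y)
    (h12 : X₁ 0 = X₂ 0) (h3Y : X₃ 0 = Y 0)
    (hu : ContinuousOn u (Icc 0 T)) (hv : ContinuousOn v (Icc 0 T))
    (hw : ContinuousOn w (Icc 0 T)) (hmid : ∀ t ∈ Icc 0 T, v t - w t = w t - u t)
    (hR₂ : ∫ η, ‖X₂ 0 η‖ ^ 2 ∂P ≤ R) (hRY : ∫ η, ‖Y 0 η‖ ^ 2 ∂P ≤ R)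
    (hr : r = 2 * R + 2 * ((1 + M) * k * T) ^ 2)
    (hc : ∀ p q : Fin m → ℝ, ‖p‖ ≤ a * (1 + r) → ‖q‖ ≤ a * (1 + r) →
      ‖fderiv ℝ j q‖ ≤ c ∧ |j p - j q - fderiv ℝ j q (p - q)| ≤ c * ‖p - q‖ ^ 2)
    (hξ : IsAdjointVelocity T K₁ K₂ j g (fun t => P.map (Y t)) u ξ)
    (hB : ∀ t ∈ Icc 0 T, ∀ x, ‖ξ t x‖ ≤ B)
    (hξΛ : ∀ t ∈ Icc 0 T, ∀ x y, ‖ξ t x - ξ t y‖ ≤ Λ * ‖x - y‖) :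
    ((∫ t in (0 : ℝ)..T, J₁ j g (P.map (X₁ t))) - ∫ t in (0 : ℝ)..T, J₁ j g (P.map (X₂ t)))
      + ((∫ t in (0 : ℝ)..T, J₁ j g (P.map (X₃ t))) - ∫ t in (0 : ℝ)..T, J₁ j g (P.map (Y t)))
      ≤ comparisonConst M m k T a Λ c r
        * ((∫ η, ‖X₂ 0 η - Y 0 η‖ ^ 2 ∂P) + ∫ t in (0 : ℝ)..T, ‖v t - u t‖ ^ 2) := by
  have hk := h₁.nonneg
  have ha := hg.nonneg
  have hV0 : 0 ≤ (1 + M) * k := by positivity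
  have h0 : (0 : ℝ) ∈ Icc 0 T := left_mem_Icc.2 hT.le
  obtain ⟨Q, S⟩ := hY.exists_isAdjointSystem hu h₁ h₂ hg hj hξ hB hξΛ
  have hmom : ∀ {z : ℝ → ControlSpace d M} {Z : ℝ → Ω → Space d}, IsMcKean P T K₁ K₂ z Z →
      ∫ η, ‖Z 0 η‖ ^ 2 ∂P ≤ R → ∀ t ∈ Icc 0 T, ∫ η, ‖Z t η‖ ^ 2 ∂P ≤ r := fun hZ hZR t ht => by
    have := hZ.integral_norm_sq_le h₁ h₂ ht
    rw [hr]
    linarith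
  have hrY := hmom hY hRY
  have hr0 : 0 ≤ r := (integral_nonneg fun _ => sq_nonneg _).trans (hrY 0 h0)
  have hc0 : 0 ≤ c := (norm_nonneg _).trans (hc 0 0 (by simpa using by positivity)
    (by simpa using by positivity)).1
  have hρ : ∀ {z : ℝ → ControlSpace d M} {Z : ℝ → Ω → Space d}, IsMcKean P T K₁ K₂ z Z →
      ∫ η, ‖Z 0 η‖ ^ 2 ∂P ≤ R → ∀ t ∈ Icc 0 T, ‖moments g (P.map (Z t))‖ ≤ a * (1 + r) :=
    fun hZ hZR t ht => hZ.norm_moments_le h₁ h₂ hg ht (hmom hZ hZR t ht)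
  obtain ⟨A, hA⟩ : ∃ A, A = adjointGrowth M m k T a c r := ⟨_, rfl⟩
  have hξA : ∀ t ∈ Icc 0 T, ∀ x, ‖ξ t x‖ ≤ A * (1 + ‖x‖) := fun t ht x => by
    rw [hA]
    exact hY.norm_adjoint_le hT.le h₁ h₂ hg S hrY
      (fun t ht => (hc _ _ (hρ hY hRY t ht) (hρ hY hRY t ht)).1) ht x
  have hA0 : 0 ≤ A := by
    have := (norm_nonneg _).trans (hξA 0 h0 0)
    simpa using this
  obtain ⟨E, hE⟩ : ∃ E, E = expansionConst M k a A Λ c r := ⟨_, rfl⟩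
  have hE0 : 0 ≤ E := by rw [hE]; unfold expansionConst; positivity
  obtain ⟨L, hL⟩ : ∃ L, L = Real.exp ((4 + 4 * M) * k * T) := ⟨_, rfl⟩
  have hL0 : 0 ≤ L := hL ▸ Real.exp_nonneg _
  set U := ∫ t in (0 : ℝ)..T, ‖v t - u t‖ ^ 2 with hU
  have hU0 : 0 ≤ U := intervalIntegral.integral_nonneg hT.le fun _ _ => sq_nonneg _
  set e₀ := ∫ η, ‖X₂ 0 η - Y 0 η‖ ^ 2 ∂P with he₀
  have he₀0 : 0 ≤ e₀ := integral_nonneg fun _ => sq_nonneg _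
  have hUi : IntervalIntegrable (fun t => ‖v t - u t‖ ^ 2) volume 0 T :=
    ContinuousOn.intervalIntegrable (by rw [uIcc_of_le hT.le]; exact (hv.sub hu).norm.pow 2)
  have hwu : ∀ t ∈ Icc 0 T, ‖w t - u t‖ ^ 2 ≤ ‖v t - u t‖ ^ 2 := fun t ht => by
    have e : v t - u t = (2 : ℝ) • (w t - u t) := by
      rw [two_smul]; nth_rw 1 [← hmid t ht]; abel
    rw [e, norm_smul, Real.norm_of_nonneg (by norm_num : (0 : ℝ) ≤ 2), mul_pow]
    nlinarith [sq_nonneg ‖w t - u t‖]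
  have hwuU : ∫ t in (0 : ℝ)..T, ‖w t - u t‖ ^ 2 ≤ U :=
    intervalIntegral.integral_mono_on hT.le (ContinuousOn.intervalIntegrable (by
      rw [uIcc_of_le hT.le]; exact (hw.sub hu).norm.pow 2)) hUi hwu
  -- All trajectories stay close to `Y` in mean square.
  have hstab : ∀ {z : ℝ → ControlSpace d M} {Z : ℝ → Ω → Space d}, IsMcKean P T K₁ K₂ z Z →
      ContinuousOn z (Icc 0 T) → ∫ η, ‖Z 0 η - Y 0 η‖ ^ 2 ∂P ≤ e₀ →
      ∫ t in (0 : ℝ)..T, ‖z t - u t‖ ^ 2 ≤ U → ∀ t ∈ Icc 0 T,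
      ∫ η, ‖Z t η - Y t η‖ ^ 2 ∂P ≤ L * (1 + M * k) * (e₀ + U) := fun {z _} hZ hz hZ0 hzU t ht => by
    refine (hZ.integral_norm_sub_sq_le hY h₁ h₂ hz hu ht).trans ?_
    rw [← hL, mul_assoc L]
    refine mul_le_mul_of_nonneg_left ?_ hL0
    have h4 : M * k * ∫ s in (0 : ℝ)..T, ‖z s - u s‖ ^ 2 ≤ M * k * U :=
      mul_le_mul_of_nonneg_left hzU (by positivity)
    have h5 : 0 ≤ M * k * e₀ := by positivity
    linarith
  have hexp : ∀ {z : ℝ → ControlSpace d M} {Z : ℝ → Ω → Space d}, IsMcKean P T K₁ K₂ z Z →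
      ContinuousOn z (Icc 0 T) → ∫ η, ‖Z 0 η - Y 0 η‖ ^ 2 ∂P ≤ e₀ →
      ∫ t in (0 : ℝ)..T, ‖z t - u t‖ ^ 2 ≤ U → ∫ η, ‖Z 0 η‖ ^ 2 ∂P ≤ R → ∀ t ∈ Icc 0 T,
      ‖z t - u t‖ ^ 2 ≤ ‖v t - u t‖ ^ 2 →
      |J₁ j g (P.map (Z t)) - J₁ j g (P.map (Y t))
        - (adjointFunctional P K₁ K₂ j g (Y t) (u t) (ξ t) (Z t) (z t)
          - adjointFunctional P K₁ K₂ j g (Y t) (u t) (ξ t) (Y t) (u t))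
        - ∫ η, inner ℝ (ξ t (Y t η)) (∑ l, (K₂ (Y t η - z t l) - K₂ (Y t η - u t l))) ∂P|
      ≤ E * (L * (1 + M * k) * (e₀ + U) + ‖v t - u t‖ ^ 2) :=
    fun {z Z} hZ hz hZ0 hzU hZR t ht hzt => by
      rw [adjointFunctional_self]
      refine (abs_cost_sub_le (hZ.measurable t ht) (hY.measurable t ht) (hZ.memLp h₁ h₂ ht)
        (hY.memLp h₁ h₂ ht) (hmom hZ hZR t ht) (hrY t ht) h₁ h₂ hg hc0
        (hc _ _ (hρ hZ hZR t ht) (hρ hY hRY t ht)).2 (hξΛ t ht) (hξA t ht) (hB t ht)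
        (z t) (u t)).trans ?_
      rw [← hE]
      exact mul_le_mul_of_nonneg_left (add_le_add (hstab hZ hz hZ0 hzU t ht) hzt) hE0
  have hR₁ : ∫ η, ‖X₁ 0 η‖ ^ 2 ∂P ≤ R := by rw [h12]; exact hR₂
  have hR₃ : ∫ η, ‖X₃ 0 η‖ ^ 2 ∂P ≤ R := by rw [h3Y]; exact hRY
  have hexp₁ := hexp hX₁ hw (by rw [h12]) hwuU hR₁
  have hexp₂ := hexp hX₂ hv le_rfl le_rfl hR₂
  have hexp₃ := hexp hX₃ hw (by rw [h3Y]; simpa using he₀0) hwuU hR₃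
  -- The first-order effects of the controls cancel up to a second difference of `K₂`.
  have hctrl : ∀ t ∈ Icc 0 T,
      (∫ η, inner ℝ (ξ t (Y t η)) (∑ l, (K₂ (Y t η - w t l) - K₂ (Y t η - u t l))) ∂P)
      + (∫ η, inner ℝ (ξ t (Y t η)) (∑ l, (K₂ (Y t η - w t l) - K₂ (Y t η - u t l))) ∂P)
      - (∫ η, inner ℝ (ξ t (Y t η)) (∑ l, (K₂ (Y t η - v t l) - K₂ (Y t η - u t l))) ∂P)
      ≤ A * (2 + r) * (M * k) * ‖v t - u t‖ ^ 2 := fun t ht => by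
    have hSi : ∀ z : ControlSpace d M, Integrable (fun η =>
        inner ℝ (ξ t (Y t η)) (∑ l, (K₂ (Y t η - z l) - K₂ (Y t η - u t l)))) P := fun z =>
      integrable_inner_comp (f := fun x => ∑ l, (K₂ (x - z l) - K₂ (x - u t l)))
        (hY.measurable t ht) (continuous_of_norm_sub_le (hξΛ t ht)) (hB t ht)
        (continuous_finsetSum _ fun l _ =>
          (h₂.continuous.comp (continuous_id.sub continuous_const)).sub
          (h₂.continuous.comp (continuous_id.sub continuous_const)))
        (fun x => norm_sum_fin_le fun l => norm_sub_le_of_le (h₂.norm_le _) (h₂.norm_le _))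
    have hYi := (hY.memLp h₁ h₂ ht).norm.integrable (by norm_num : (1 : ℝ≥0∞) ≤ 2)
    rw [← integral_add (hSi (w t)) (hSi (w t)), ← integral_sub (f := fun η =>
      inner ℝ (ξ t (Y t η)) (∑ l, (K₂ (Y t η - w t l) - K₂ (Y t η - u t l)))
      + inner ℝ (ξ t (Y t η)) (∑ l, (K₂ (Y t η - w t l) - K₂ (Y t η - u t l))))
      ((hSi (w t)).add (hSi (w t))) (hSi (v t))]
    refine (le_abs_self _).trans ?_
    rw [← Real.norm_eq_abs]
    refine (norm_integral_le_of_norm_le ((((integrable_const 1).add hYi).const_mul A).mul_const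
      (M * (k * ‖v t - u t‖ ^ 2))) (Eventually.of_forall fun η => ?_)).trans ?_
    · rw [← inner_add_right, ← inner_sub_right]
      refine (norm_inner_le_norm _ _).trans (mul_le_mul (hξA t ht _) ?_ (norm_nonneg _)
        ((norm_nonneg _).trans (hξA t ht _)))
      rw [← Finset.sum_add_distrib, ← Finset.sum_sub_distrib]
      refine norm_sum_fin_le fun l => ?_
      have e : K₂ (Y t η - w t l) - K₂ (Y t η - u t l) + (K₂ (Y t η - w t l) - K₂ (Y t η - u t l))
          - (K₂ (Y t η - v t l) - K₂ (Y t η - u t l))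
          = K₂ (Y t η - w t l) + K₂ (Y t η - w t l) - K₂ (Y t η - v t l) - K₂ (Y t η - u t l) := by
        abel
      rw [e]
      have hl : v t l - w t l = w t l - u t l := by
        have := congrArg (fun z : ControlSpace d M => z l) (hmid t ht)
        simpa using this
      refine (h₂.midpoint_difference _ _ _ _ hl).trans (mul_le_mul_of_nonneg_left ?_ hk)
      exact pow_le_pow_left₀ (norm_nonneg _) (PiLp.norm_apply_le (v t - u t) l) 2
    · rw [integral_mul_const, integral_const_mul]
      have h4 : ∫ η, ((fun _ : Ω => (1 : ℝ)) + fun η => ‖Y t η‖) η ∂P ≤ 2 + r := by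
        refine (integral_add (integrable_const 1) hYi).trans_le ?_
        have := integral_norm_le_one_add (hY.memLp h₁ h₂ ht) (hrY t ht)
        simp only [integral_const, probReal_univ, one_smul]
        linarith
      have h5 : 0 ≤ M * (k * ‖v t - u t‖ ^ 2) := by positivity
      have h6 := mul_le_mul_of_nonneg_right (mul_le_mul_of_nonneg_left h4 hA0) h5
      linarith
  obtain ⟨hc₁, hI₁⟩ := hX₁.integral_adjointFunctional hY h₁ h₂ hg hj hT.le hΛ hw S
  obtain ⟨hc₂, hI₂⟩ := hX₂.integral_adjointFunctional hY h₁ h₂ hg hj hT.le hΛ hv S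
  obtain ⟨hc₃, hI₃⟩ := hX₃.integral_adjointFunctional hY h₁ h₂ hg hj hT.le hΛ hw S
  obtain ⟨hcY, hIY⟩ := hY.integral_adjointFunctional hY h₁ h₂ hg hj hT.le hΛ hu S
  have hii : ∀ {f : ℝ → ℝ}, ContinuousOn f (Icc 0 T) → IntervalIntegrable f volume 0 T :=
    fun hf => ContinuousOn.intervalIntegrable (by rwa [uIcc_of_le hT.le])
  have hJ₁ := hii (hX₁.continuousOn_cost h₁ h₂ hg hj)
  have hJ₂ := hii (hX₂.continuousOn_cost h₁ h₂ hg hj)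
  have hJ₃ := hii (hX₃.continuousOn_cost h₁ h₂ hg hj)
  have hJY := hii (hY.continuousOn_cost h₁ h₂ hg hj)
  have ha₁ := hii hc₁
  have ha₂ := hii hc₂
  have ha₃ := hii hc₃
  have haY := hii hcY
  have hmono := intervalIntegral.integral_mono_on hT.le ((hJ₁.sub hJ₂).add (hJ₃.sub hJY))
    (((ha₁.sub ha₂).add (ha₃.sub haY)).add ((hUi.const_mul (A * (2 + r) * (M * k) + 3 * E)).add
      (intervalIntegrable_const (c := 3 * E * (L * (1 + M * k) * (e₀ + U)))))) fun t ht => ?_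
  · rw [intervalIntegral.integral_add (hJ₁.sub hJ₂) (hJ₃.sub hJY),
      intervalIntegral.integral_sub hJ₁ hJ₂, intervalIntegral.integral_sub hJ₃ hJY,
      intervalIntegral.integral_add ((ha₁.sub ha₂).add (ha₃.sub haY))
        ((hUi.const_mul _).add intervalIntegrable_const),
      intervalIntegral.integral_add (ha₁.sub ha₂) (ha₃.sub haY),
      intervalIntegral.integral_sub ha₁ ha₂, intervalIntegral.integral_sub ha₃ haY,
      intervalIntegral.integral_add (hUi.const_mul _) intervalIntegrable_const,
      intervalIntegral.integral_const_mul, intervalIntegral.integral_const, hI₁, hI₂, hI₃, hIY,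
      h12, h3Y, ← hU, smul_eq_mul, sub_zero] at hmono
    refine hmono.trans ?_
    unfold comparisonConst
    rw [← hA, ← hE, ← hL]
    have h4 : 0 ≤ (A * (2 + r) * (M * k) + 3 * E) * e₀ := by positivity
    linarith
  · have h3 := hctrl t ht
    have h4 := (abs_le.1 (hexp₁ t ht (hwu t ht))).2
    have h5 := (abs_le.1 (hexp₂ t ht le_rfl)).1
    have h6 := (abs_le.1 (hexp₃ t ht (hwu t ht))).2
    linarith

end comparison

/-! ### Controls -/

namespace Control

variable {d M : ℕ} {T : ℝ} {u₀ : ControlSpace d M}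

theorem integrableOn_du (c : Control d M T u₀) : IntegrableOn c.du (Ioc 0 T) volume :=
  c.memLp.integrable (by norm_num)

theorem intervalIntegrable_du (c : Control d M T u₀) {t : ℝ} (ht : t ∈ Icc 0 T) :
    IntervalIntegrable c.du volume 0 t :=
  (intervalIntegrable_iff_integrableOn_Ioc_of_le ht.1).2
    (c.integrableOn_du.mono_set (Ioc_subset_Ioc_right ht.2))

theorem continuousOn_u (hT : 0 ≤ T) (c : Control d M T u₀) : ContinuousOn c.u (Icc 0 T) := by
  refine ContinuousOn.congr (continuousOn_const.add ?_) c.eq_integral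
  have := intervalIntegral.continuousOn_primitive_interval (f := c.du) (μ := volume) (a := 0)
    (b := T) (by rw [uIcc_of_le hT, integrableOn_Icc_iff_integrableOn_Ioc]; exact c.integrableOn_du)
  rwa [uIcc_of_le hT] at this

/-- The midpoint of two controls. -/
noncomputable def midpoint (c c' : Control d M T u₀) : Control d M T u₀ where
  u := fun t => (2⁻¹ : ℝ) • (c.u t + c'.u t)
  du := fun t => (2⁻¹ : ℝ) • (c.du t + c'.du t)
  memLp := (c.memLp.add c'.memLp).const_smul (2⁻¹ : ℝ)
  eq_integral := fun t ht => by
    rw [intervalIntegral.integral_smul, intervalIntegral.integral_add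
      (c.intervalIntegrable_du ht) (c'.intervalIntegrable_du ht), c.eq_integral t ht,
      c'.eq_integral t ht]
    module

theorem intervalIntegrable_norm_sq {f : ℝ → ControlSpace d M} (hT : 0 ≤ T)
    (hf : MemLp f 2 (volume.restrict (Ioc 0 T))) :
    IntervalIntegrable (fun t => ‖f t‖ ^ 2) volume 0 T :=
  (intervalIntegrable_iff_integrableOn_Ioc_of_le hT).2 hf.norm.integrable_sq

/-- The parallelogram identity for the control costs. -/
theorem integral_norm_sq_midpoint (hT : 0 ≤ T) (c c' : Control d M T u₀) :
    (∫ t in (0 : ℝ)..T, ‖c.du t‖ ^ 2) + (∫ t in (0 : ℝ)..T, ‖c'.du t‖ ^ 2)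
      = 2 * (∫ t in (0 : ℝ)..T, ‖(midpoint c c').du t‖ ^ 2)
        + 2⁻¹ * ∫ t in (0 : ℝ)..T, ‖c.du t - c'.du t‖ ^ 2 := by
  have hm : MemLp (fun t => c.du t - c'.du t) 2 (volume.restrict (Ioc 0 T)) :=
    c.memLp.sub c'.memLp
  rw [← intervalIntegral.integral_add (intervalIntegrable_norm_sq hT c.memLp)
    (intervalIntegrable_norm_sq hT c'.memLp), ← intervalIntegral.integral_const_mul,
    ← intervalIntegral.integral_const_mul, ← intervalIntegral.integral_add
    ((intervalIntegrable_norm_sq hT (midpoint c c').memLp).const_mul 2)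
    ((intervalIntegrable_norm_sq hT hm).const_mul 2⁻¹)]
  refine intervalIntegral.integral_congr fun t _ => ?_
  have h := parallelogram_law_with_norm ℝ (c.du t) (c'.du t)
  simp only [midpoint, norm_smul, norm_inv, Real.norm_ofNat]
  nlinarith

/-- Poincaré's inequality for the difference of two controls. -/
theorem integral_norm_sub_sq_le (hT : 0 ≤ T) (c c' : Control d M T u₀) :
    ∫ t in (0 : ℝ)..T, ‖c.u t - c'.u t‖ ^ 2
      ≤ T ^ 2 * ∫ t in (0 : ℝ)..T, ‖c.du t - c'.du t‖ ^ 2 := by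
  have hm : MemLp (fun t => c.du t - c'.du t) 2 (volume.restrict (Ioc 0 T)) :=
    c.memLp.sub c'.memLp
  have hCS := sq_integral_mul_le hm.norm (memLp_const (1 : ℝ))
  simp only [mul_one, one_pow, integral_const, smul_eq_mul, measureReal_restrict_apply_univ,
    Real.volume_real_Ioc, sub_zero, max_eq_left hT] at hCS
  rw [← intervalIntegral.integral_of_le hT, ← intervalIntegral.integral_of_le hT] at hCS
  have hp : ∀ t ∈ Icc 0 T, ‖c.u t - c'.u t‖ ^ 2
      ≤ (∫ t in (0 : ℝ)..T, ‖c.du t - c'.du t‖ ^ 2) * T := fun t ht => by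
    refine le_trans (pow_le_pow_left₀ (norm_nonneg _) ?_ 2) hCS
    rw [c.eq_integral t ht, c'.eq_integral t ht, add_sub_add_left_eq_sub,
      ← intervalIntegral.integral_sub (c.intervalIntegrable_du ht) (c'.intervalIntegrable_du ht)]
    refine (intervalIntegral.norm_integral_le_integral_norm ht.1).trans ?_
    exact intervalIntegral.integral_mono_interval le_rfl ht.1 ht.2
      (Eventually.of_forall fun _ => norm_nonneg _)
      ((c.intervalIntegrable_du (right_mem_Icc.2 hT)).sub
        (c'.intervalIntegrable_du (right_mem_Icc.2 hT))).norm
  have h := intervalIntegral.integral_mono_on hT (ContinuousOn.intervalIntegrable (by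
    rw [uIcc_of_le hT]
    exact ((c.continuousOn_u hT).sub (c'.continuousOn_u hT)).norm.pow 2))
    (intervalIntegrable_const (μ := volume)) hp
  rw [intervalIntegral.integral_const, smul_eq_mul, sub_zero] at h
  exact h.trans_eq (by ring)

end Control

/-! ### Optimal pairs as random trajectories -/

section optimal

variable {d M m : ℕ} {k T a : ℝ} {K₁ K₂ : Space d → Space d} {Ω : Type*} [MeasurableSpace Ω]
  {P : Measure Ω} {u w : ℝ → ControlSpace d M} {p : Ω → Space d} {ν₀ μ₀ : Measure (Space d)}

theorem IsMeanFieldFlow.map_comp {X : ℝ → Space d → Space d}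
    (h : IsMeanFieldFlow T K₁ K₂ ν₀ w X) (hp : Measurable p) (hν : P.map p = ν₀) (t : ℝ) :
    P.map (fun η => X t (p η)) = ν₀.map (X t) := by
  rw [← hν, Measure.map_map (h.continuous t).measurable hp]
  rfl

theorem memLp_of_map_eq (hp : Measurable p) (hν : P.map p = ν₀) (hν₀ : IsP2 ν₀) :
    MemLp p 2 P := by
  have h := hν₀.memLp
  rw [← hν] at h
  exact (memLp_map_measure_iff aestronglyMeasurable_id hp.aemeasurable).1 h

theorem IsMeanFieldFlow.isMcKean {X : ℝ → Space d → Space d}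
    (h : IsMeanFieldFlow T K₁ K₂ ν₀ w X) (hp : Measurable p) (hν : P.map p = ν₀)
    (hν₀ : IsP2 ν₀) : IsMcKean P T K₁ K₂ w fun t η => X t (p η) := by
  refine ⟨fun t _ => (h.continuous t).comp_stronglyMeasurable hp.stronglyMeasurable, ?_,
    fun t ht η => ?_⟩
  · simp only [h.init]
    exact memLp_of_map_eq hp hν hν₀
  · rw [h.map_comp hp hν]
    exact h.ode t ht _

/-- A weak solution of the continuity equation is the law of a random trajectory. -/
theorem IsWeakSolution.exists_isMcKean (hT : 0 < T) {μ : ℝ → Measure (Space d)}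
    (h : IsWeakSolution T K₁ K₂ μ₀ u μ) (hμ₀ : IsP2 μ₀) (h₁ : KernelBound k K₁)
    (h₂ : KernelBound k K₂) (hu : ContinuousOn u (Icc 0 T)) {Q : ℝ → ℝ → Space d → Space d}
    (hQ : IsFlow T (fun t => velocity K₁ K₂ (μ t) (u t)) Q) (hp : Measurable p)
    (hν : P.map p = μ₀) :
    (∀ t ∈ Icc 0 T, μ t = P.map fun η => Q t 0 (p η)) ∧
      IsMcKean P T K₁ K₂ u fun t η => Q t 0 (p η) := by
  have hk := h₁.nonneg
  have := hμ₀.prob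
  have h0 : (0 : ℝ) ∈ Icc 0 T := left_mem_Icc.2 hT.le
  have hQc : ∀ t ∈ Icc 0 T, Continuous (Q t 0) := fun t ht =>
    continuous_of_norm_sub_le (hQ.norm_sub_le (c := (1 + M) * k) (by positivity)
      (fun t ht x y => by
        have := (h.curve.isP2 t ht).prob
        exact norm_velocity_sub_le h₁ h₂ _ _ _ _) h0 ht)
  have hμ : ∀ t ∈ Icc 0 T, μ t = P.map fun η => Q t 0 (p η) := fun t ht => by
    rw [h.eq_map hT h₁ h₂ hu hQ ht, ← hν, Measure.map_map (hQc t ht).measurable hp]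
    rfl
  refine ⟨hμ, fun t ht => (hQc t ht).comp_stronglyMeasurable hp.stronglyMeasurable, ?_,
    fun t ht η => ?_⟩
  · simp only [fun x => (hQ 0 h0 x).1]
    exact memLp_of_map_eq hp hν hμ₀
  · rw [← hμ t ht]
    exact (hQ 0 h0 (p η)).2 t ht

theorem isP2_of_isCompact [IsProbabilityMeasure μ₀]
    (h : ∃ S : Set (Space d), IsCompact S ∧ μ₀ Sᶜ = 0) : IsP2 μ₀ := by
  obtain ⟨S, hS, h0⟩ := h
  obtain ⟨C, hC⟩ := hS.exists_bound_of_continuousOn continuousOn_id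
  refine ⟨inferInstance, MemLp.of_bound aestronglyMeasurable_id C ?_⟩
  filter_upwards [mem_ae_iff.2 h0] with x hx using hC x hx

theorem integral_norm_sq_map (hp : Measurable p) (hν : P.map p = ν₀) :
    ∫ η, ‖p η‖ ^ 2 ∂P = secondMoment ν₀ := by
  unfold secondMoment
  rw [← hν, integral_map hp.aemeasurable (by fun_prop)]

theorem W2sq_ne_top {μ ν : Measure (Space d)} (hμ : IsP2 μ) (hν : IsP2 ν) : W2sq μ ν ≠ ⊤ := by
  have := hμ.prob
  have := hν.prob
  have hπ : μ.prod ν ∈ couplings μ ν := ⟨by simp, by simp⟩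
  refine ne_top_of_le_ne_top ?_ (iInf₂_le (μ.prod ν) hπ)
  rw [← integral_cost_eq hμ hν hπ]
  exact ENNReal.ofReal_ne_top

/-- A real number below the cost of every coupling is below the squared Wasserstein distance. -/
theorem le_toReal_W2sq {μ ν : Measure (Space d)} (hμ : IsP2 μ) (hν : IsP2 ν) {b : ℝ}
    (h : ∀ π ∈ couplings μ ν, b ≤ ∫ z, ‖z.1 - z.2‖ ^ 2 ∂π) : b ≤ (W2sq μ ν).toReal := by
  refine (ENNReal.ofReal_le_iff_le_toReal (W2sq_ne_top hμ hν)).1 (le_iInf₂ fun π hπ => ?_)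
  rw [← integral_cost_eq hμ hν hπ]
  exact ENNReal.ofReal_le_ofReal (h π hπ)

/-- The comparison of both optimal pairs with the states of the midpoint control. Strict convexity
of the control cost gives the left-hand side. -/
theorem optimal_pair_estimate {N : ℕ} {c r R lam Λ B : ℝ} (hT : 0 < T) {j : (Fin m → ℝ) → ℝ}
    {g : Fin m → Space d → ℝ} (h₁ : KernelBound k K₁) (h₂ : KernelBound k K₂)
    (hg : MomentBound a g) (hj : ContDiff ℝ 2 j) (hΛ : 0 ≤ Λ)
    (hr : r = 2 * R + 2 * ((1 + M) * k * T) ^ 2)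
    (hc : ∀ p q : Fin m → ℝ, ‖p‖ ≤ a * (1 + r) → ‖q‖ ≤ a * (1 + r) →
      ‖fderiv ℝ j q‖ ≤ c ∧ |j p - j q - fderiv ℝ j q (p - q)| ≤ c * ‖p - q‖ ^ 2)
    (hN : 0 < N) {u₀ : ControlSpace d M} {x₀ : Fin N → Space d} (hμ₀ : IsP2 μ₀)
    (hRμ : secondMoment μ₀ ≤ R) (hRx : secondMoment (empirical x₀) ≤ R)
    {xN : ℝ → Fin N → Space d} {cN c' : Control d M T u₀} {μ : ℝ → Measure (Space d)}
    (hopt : IsParticleOptimal lam K₁ K₂ j g x₀ xN cN)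
    (hopt' : IsMeanFieldOptimal lam K₁ K₂ j g μ₀ μ c') {ξ : ℝ → Space d → Space d}
    (hξ : IsAdjointVelocity T K₁ K₂ j g μ c'.u ξ) (hB : ∀ t ∈ Icc 0 T, ∀ x, ‖ξ t x‖ ≤ B)
    (hξΛ : ∀ t ∈ Icc 0 T, ∀ x y, ‖ξ t x - ξ t y‖ ≤ Λ * ‖x - y‖)
    {π : Measure (Space d × Space d)} (hπ : π ∈ couplings (empirical x₀) μ₀) :
    lam / 4 * ∫ t in (0 : ℝ)..T, ‖cN.du t - c'.du t‖ ^ 2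
      ≤ comparisonConst M m k T a Λ c r * ((∫ z, ‖z.1 - z.2‖ ^ 2 ∂π)
        + ∫ t in (0 : ℝ)..T, ‖cN.u t - c'.u t‖ ^ 2) := by
  have hp₀ := isProbabilityMeasure_empirical hN x₀
  have hP₀ := isP2_empirical hN x₀
  have := hμ₀.prob
  have := isProbabilityMeasure_of_mem_couplings hπ
  set cm := Control.midpoint cN c' with hcm
  have hu := c'.continuousOn_u hT.le
  have hv := cN.continuousOn_u hT.le
  have hw := cm.continuousOn_u hT.le
  obtain ⟨X₁, hX₁⟩ := exists_isMeanFieldFlow hT h₁ h₂ (empirical x₀) hw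
  obtain ⟨X₂, hX₂⟩ := exists_isMeanFieldFlow hT h₁ h₂ (empirical x₀) hv
  obtain ⟨X₃, hX₃⟩ := exists_isMeanFieldFlow hT h₁ h₂ μ₀ hw
  obtain ⟨Q, hQ, -⟩ := hξ.representation
  have hm₁ := hX₁.isMcKean measurable_fst hπ.1 hP₀
  have hm₂ := hX₂.isMcKean measurable_fst hπ.1 hP₀
  have hm₃ := hX₃.isMcKean measurable_snd hπ.2 hμ₀
  obtain ⟨hμY, hmY⟩ := hopt'.admissible.exists_isMcKean hT hμ₀ h₁ h₂ hu hQ measurable_snd hπ.2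
  have h0 : (0 : ℝ) ∈ Icc 0 T := left_mem_Icc.2 hT.le
  have hQ0 : ∀ x, Q 0 0 x = x := fun x => (hQ 0 h0 x).1
  have hcomp := integral_cost_comparison_le (R := R) hT h₁ h₂ hg hj hΛ hm₁ hm₂ hm₃ hmY
    (by simp only [hX₁.init, hX₂.init]) (by simp only [hX₃.init, hQ0]) hu hv hw
    (fun t _ => by simp only [hcm, Control.midpoint]; module)
    (by simpa only [hX₂.init, integral_norm_sq_map measurable_fst hπ.1] using hRx)
    (by simpa only [hQ0, integral_norm_sq_map measurable_snd hπ.2] using hRμ)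
    hr hc (hξ.congr hμY) hB hξΛ
  simp only [hX₂.init, hQ0] at hcomp
  have hN' := hopt.minimal _ cm hX₁.isParticleSolution
  have hMF := hopt'.minimal _ cm (hX₃.isWeakSolution hT h₁ h₂ hμ₀ hw)
  have e₁ : ∀ t, empirical (fun i => X₁ t (x₀ i)) = π.map fun η => X₁ t η.1 := fun t => by
    rw [hX₁.map_comp measurable_fst hπ.1, map_empirical x₀ (hX₁.continuous t).measurable]
  have e₂ : ∀ t ∈ Icc 0 T, empirical (xN t) = π.map fun η => X₂ t η.1 := fun t ht => by
    rw [hX₂.map_comp measurable_fst hπ.1, map_empirical x₀ (hX₂.continuous t).measurable,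
      hopt.admissible.unique hN h₁ h₂ hX₂.isParticleSolution ht]
  have e₃ : ∀ t, μ₀.map (X₃ t) = π.map fun η => X₃ t η.2 := fun t =>
    (hX₃.map_comp measurable_snd hπ.2 t).symm
  have i₂ : ∫ t in (0 : ℝ)..T, J₁ j g (empirical (xN t))
      = ∫ t in (0 : ℝ)..T, J₁ j g (π.map fun η => X₂ t η.1) :=
    intervalIntegral.integral_congr fun t ht => by
      rw [uIcc_of_le hT.le] at ht
      simp only [e₂ t ht]
  have iY : ∫ t in (0 : ℝ)..T, J₁ j g (μ t)
      = ∫ t in (0 : ℝ)..T, J₁ j g (π.map fun η => Q t 0 η.2) :=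
    intervalIntegral.integral_congr fun t ht => by
      rw [uIcc_of_le hT.le] at ht
      simp only [hμY t ht]
  unfold totalCost J₂ at hN' hMF
  simp only [e₁] at hN'
  simp only [e₃] at hMF
  rw [i₂] at hN'
  rw [iY] at hMF
  have hpar := congrArg (fun s => lam / 2 * s) (Control.integral_norm_sq_midpoint hT.le cN c')
  simp only [← hcm] at hpar
  linarith

end optimal

end MeanFieldControl

theorem theorem5p1 {d M m : ℕ} (T : ℝ) (hT : 0 < T)
    (K₁ K₂ : Space d → Space d) (hK₁ : IsCb2 K₁) (hK₂ : IsCb2 K₂)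
    (j : (Fin m → ℝ) → ℝ) (hj : ContDiff ℝ 2 j)
    (g : Fin m → Space d → ℝ) (hg : ∀ l, ContDiff ℝ 1 (g l))
    (hg_growth : ∃ C : ℝ, ∀ l x, ‖gradient (g l) x‖ ≤ C * (1 + ‖x‖))
    -- a bound for the second moments of the initial data, a Lipschitz bound for the adjoint
    (R : ℝ) (Λ : ℝ≥0) :
    ∃ γ : ℝ, 0 < γ ∧ ∀ lam : ℝ, γ < lam →
      ∀ (N : ℕ) (_ : 0 < N) (u₀ : ControlSpace d M)
        (x₀ : Fin N → Space d) (μ₀ : Measure (Space d)),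
      IsProbabilityMeasure μ₀ → (∃ Ω : Set (Space d), IsCompact Ω ∧ μ₀ Ωᶜ = 0) →
      secondMoment μ₀ ≤ R → secondMoment (empirical x₀) ≤ R →
      ∀ (xN : ℝ → Fin N → Space d) (cN : Control d M T u₀)
        (μ : ℝ → Measure (Space d)) (c : Control d M T u₀),
      IsParticleOptimal lam K₁ K₂ j g x₀ xN cN →
      IsMeanFieldOptimal lam K₁ K₂ j g μ₀ μ c →
      ∀ ξ : ℝ → Space d → Space d,
      IsAdjointVelocity T K₁ K₂ j g μ c.u ξ →
      (∃ B : ℝ, ∀ t ∈ Icc 0 T, ∀ x, ‖ξ t x‖ ≤ B) →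
      (∀ t ∈ Icc 0 T, LipschitzWith Λ (ξ t)) →
      ∫ t in (0 : ℝ)..T, ‖cN.u t - c.u t‖ ^ 2
        ≤ γ / (lam - γ) * (W2sq (empirical x₀) μ₀).toReal := by
  obtain ⟨k₁, hk₁⟩ := hK₁.exists_kernelBound
  obtain ⟨k₂, hk₂⟩ := hK₂.exists_kernelBound
  obtain ⟨k, hk⟩ : ∃ k, k = max k₁ k₂ := ⟨_, rfl⟩
  have h₁ : KernelBound k K₁ := hk₁ k (hk ▸ le_max_left _ _)
  have h₂ : KernelBound k K₂ := hk₂ k (hk ▸ le_max_right _ _)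
  obtain ⟨a, ha⟩ := exists_momentBound hg hg_growth
  obtain ⟨r, hr⟩ : ∃ r, r = 2 * R + 2 * ((1 + M) * k * T) ^ 2 := ⟨_, rfl⟩
  obtain ⟨c, -, hc⟩ := exists_taylor_bound_closedBall hj (a * (1 + r))
  set C := max (comparisonConst M m k T a Λ c r) 0 with hC
  have hC0 : 0 ≤ C := le_max_right _ _
  refine ⟨4 * T ^ 2 * C + 1, by positivity, fun lam hlam N hN u₀ x₀ μ₀ hμ₀ hcpt hRμ hRx xN cN μ c'
    hopt hopt' ξ hξ hB hΛ => ?_⟩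
  obtain ⟨B, hB⟩ := hB
  have hP2 : IsP2 μ₀ := isP2_of_isCompact hcpt
  have hξΛ : ∀ t ∈ Icc 0 T, ∀ x y, ‖ξ t x - ξ t y‖ ≤ Λ * ‖x - y‖ := fun t ht x y => by
    simpa only [dist_eq_norm] using (hΛ t ht).dist_le_mul x y
  have hlam0 : 0 < lam - (4 * T ^ 2 * C + 1) := sub_pos.2 hlam
  have hlam1 : 0 < lam := by
    have : 0 ≤ 4 * T ^ 2 * C := by positivity
    linarith
  have hγ0 : 0 < 4 * T ^ 2 * C + 1 := by positivity
  set γ := 4 * T ^ 2 * C + 1 with hγ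
  set U := ∫ t in (0 : ℝ)..T, ‖cN.u t - c'.u t‖ ^ 2 with hU
  have hU0 : 0 ≤ U := intervalIntegral.integral_nonneg hT.le fun _ _ => sq_nonneg _
  have key : (lam - γ) / γ * U ≤ (W2sq (empirical x₀) μ₀).toReal := by
    refine le_toReal_W2sq (isP2_empirical hN x₀) hP2 fun π hπ => ?_
    have h := optimal_pair_estimate hT h₁ h₂ ha hj Λ.coe_nonneg hr hc hN hP2 hRμ hRx hopt hopt' hξ hB hξΛ hπ
    rw [← hU] at h
    set e := ∫ z, ‖z.1 - z.2‖ ^ 2 ∂π with he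
    have he0 : 0 ≤ e := integral_nonneg fun _ => sq_nonneg _
    have hle := h.trans (mul_le_mul_of_nonneg_right (le_max_left _ 0) (by positivity))
    rw [← hC] at hle
    have hP := mul_le_mul_of_nonneg_left (Control.integral_norm_sub_sq_le hT.le cN c') hlam1.le
    rw [← hU] at hP
    have h2 : lam * U ≤ γ * (e + U) := by
      have h3 := mul_le_mul_of_nonneg_left hle (by positivity : 0 ≤ 4 * T ^ 2)
      have h4 : 0 ≤ e + U := by positivity
      rw [hγ]
      linarith
    rw [div_mul_eq_mul_div, div_le_iff₀ hγ0]
    linarith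
  calc U = γ / (lam - γ) * ((lam - γ) / γ * U) := by field_simp
    _ ≤ γ / (lam - γ) * (W2sq (empirical x₀) μ₀).toReal :=
      mul_le_mul_of_nonneg_left key (by positivity)
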